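/- Let $\Upsilon$ be the class of all infinitely smooth functions $\varphi:[1,\infty)\to(0,\infty)$ such that $\varphi(\lambda t)/\varphi(t)\to1$ as $t\to\infty$ for every $\lambda>0$ and such that for each integer $m\ge1$ there is $c_m>0$ with $t^m|\varphi^{(m)}(t)|\le c_m\varphi(t)$ for all $t\ge1$. Let $d\ge1$ be an integer. Fix $\beta_0\in C^\infty(\mathbb{R}^d)$ with $\beta_0(y)=1$ for $|y|\le1$ and $\beta_0(y)=0$ for $|y|\ge2$, and put $\beta_k(y)=\beta_0(2^{-k}y)-\beta_0(2^{1-k}y)$ for integers $k\ge1$. For $s\in\mathbb{R}$, $\varphi\in\Upsilon$ and $p\in(1,\infty)$, the space $B^{s,\varphi}_p(\mathbb{R}^d)$ consists of all tempered distributions $w$ on $\mathbb{R}^d$ such that $w_k:=\mathcal{F}^{-1}[\beta_k\mathcal{F}w]\in L_p(\mathbb{R}^d)$ for all $k\ge0$ and $$\|w,B^{s,\varphi}_p(\mathbb{R}^d)\|^p:=\sum_{k=0}^\infty\bigl(2^{sk}\varphi(2^k)\,\|w_k,L_p(\mathbb{R}^d)\|\bigr)^p<\infty .$$ Let $\Omega\subset\mathbb{R}^{d+1}$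 be a bounded open set with boundary $\Gamma$ of class $C^\infty$ ($\Omega$ lying locally on one side of $\Gamma$). Fix finitely many local charts $\pi_j:V_j\leftrightarrow\Gamma_j$ of class $C^\infty$ between open sets $V_j\subset\mathbb{R}^d$ and open sets $\Gamma_j\subset\Gamma$, $j=1,\dots,\varkappa$, and functions $\chi_j\in C^\infty(\Gamma)$ with $\operatorname{supp}\chi_j\subset\Gamma_j$ and $\chi_1+\dots+\chi_\varkappa\equiv1$ on $\Gamma$. The space $B^{s,\varphi}_p(\Gamma)$ consists of all distributions $v\in\mathcal{D}'(\Gamma)$ such that for every $j$ the extension by zero $\mathcal{O}((\chi_jv)\circ\pi_j)$ onto $\mathbb{R}^d$ of the image of $\chi_jv$ in the chart $\pi_j$ belongs to $B^{s,\varphi}_p(\mathbb{R}^d)$; its norm is $\sum_{j=1}^{\varkappa}\|\mathcal{O}((\chi_jv)\circ\pi_j),B^{s,\varphi}_p(\mathbb{R}^d)\|$. **Theorem.** Let $s_0,s_1\in\mathbb{R}$, $\varphi_0,\varphi_1\in\Upsilon$, $p_0,p_1\in(1,\infty)$ and $\theta\in(0,1)$, and define $s$, $p$ and $\varphi$ by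 $$s=(1-\theta)s_0+\theta s_1,\qquad \frac1p=\frac{1-\theta}{p_0}+\frac{\theta}{p_1},\qquad \varphi(t)=\varphi_0(t)^{1-\theta}\varphi_1(t)^{\theta}\quad(t\ge1).$$ Then $\varphi\in\Upsilon$, and for $W=\mathbb{R}^d$ and for $W=\Gamma$ $$\bigl[B^{s_0,\varphi_0}_{p_0}(W),B^{s_1,\varphi_1}_{p_1}(W)\bigr]_\theta=B^{s,\varphi}_p(W)$$ up to equivalence of norms, where $[\cdot,\cdot]_\theta$ denotes the complex interpolation space with parameter $\theta$. -/

import Mathlib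

open Filter Topology MeasureTheory Set
open scoped ENNReal NNReal ContDiff SchwartzMap

noncomputable section

namespace RefinedBesov

/-- `ℝ^d` with the Euclidean norm. -/
abbrev Eu (d : ℕ) : Type := EuclideanSpace ℝ (Fin d)

/-! ### The class of function parameters -/

/-- The class `Υ` of function parameters: infinitely smooth functions `φ : [1, ∞) → (0, ∞)` that
vary slowly at infinity in the sense of Karamata and satisfy
`t ^ m * |φ^(m)(t)| ≤ c_m * φ t` for `t ≥ 1` and `m ≥ 1`.  Only the values of `φ` on `[1, ∞)`
matter. -/
structure IsUpsilon (φ : ℝ → ℝ) : Prop where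
  pos : ∀ t, 1 ≤ t → 0 < φ t
  smooth : ContDiffOn ℝ ∞ φ (Ici 1)
  slowlyVarying : ∀ l : ℝ, 0 < l → Tendsto (fun t => φ (l * t) / φ t) atTop (𝓝 1)
  derivBound : ∀ m : ℕ, 1 ≤ m → ∃ c : ℝ, 0 < c ∧
    ∀ t, 1 ≤ t → t ^ m * |iteratedDerivWithin m φ (Ici 1) t| ≤ c * φ t

/-! ### Complex interpolation

A normed space that is a linear part of a complex vector space `X` is described by its extended
norm `N : X → ℝ≥0∞`, which equals `∞` exactly off the space. -/

section Interpolation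

variable {X : Type*} [AddCommGroup X] [Module ℂ X]

/-- The norm of the sum `E₀ + E₁` of two normed spaces. -/
def sumENorm (N₀ N₁ : X → ℝ≥0∞) (x : X) : ℝ≥0∞ :=
  ⨅ (a : X) (b : X) (_ : a + b = x), N₀ a + N₁ b

/-- The closed strip `0 ≤ Re z ≤ 1`. -/
def closedStrip : Set ℂ := {z | 0 ≤ z.re ∧ z.re ≤ 1}

/-- The open strip `0 < Re z < 1`. -/
def openStrip : Set ℂ := {z | 0 < z.re ∧ z.re < 1}

/-- The functions `f` admissible for the complex method: bounded and continuous from the closed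
strip to `E₀ + E₁`, holomorphic in the open strip as `E₀ + E₁`-valued functions, and such that
`t ↦ f (it)` and `t ↦ f (1 + it)` are continuous functions with values in `E₀` and `E₁`. -/
structure IsAdmissible (N₀ N₁ : X → ℝ≥0∞) (f : ℂ → X) : Prop where
  bounded : ∃ C : ℝ≥0, ∀ z ∈ closedStrip, sumENorm N₀ N₁ (f z) ≤ C
  continuous : ∀ z ∈ closedStrip,
    Tendsto (fun w => sumENorm N₀ N₁ (f w - f z)) (𝓝[closedStrip] z) (𝓝 0)
  holomorphic : ∀ z ∈ openStrip, ∃ f' : X, sumENorm N₀ N₁ f' < (⊤ : ℝ≥0∞) ∧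
    Tendsto (fun w => sumENorm N₀ N₁ ((w - z)⁻¹ • (f w - f z) - f')) (𝓝[≠] z) (𝓝 0)
  mem_left : ∀ t : ℝ, N₀ (f (t * Complex.I)) < (⊤ : ℝ≥0∞)
  mem_right : ∀ t : ℝ, N₁ (f (1 + t * Complex.I)) < (⊤ : ℝ≥0∞)
  continuous_left : ∀ t : ℝ,
    Tendsto (fun r : ℝ => N₀ (f (r * Complex.I) - f (t * Complex.I))) (𝓝 t) (𝓝 0)
  continuous_right : ∀ t : ℝ,
    Tendsto (fun r : ℝ => N₁ (f (1 + r * Complex.I) - f (1 + t * Complex.I))) (𝓝 t) (𝓝 0)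

/-- The norm `max (sup_t ‖f (it)‖_{E₀}) (sup_t ‖f (1 + it)‖_{E₁})`. -/
def admissibleENorm (N₀ N₁ : X → ℝ≥0∞) (f : ℂ → X) : ℝ≥0∞ :=
  max (⨆ t : ℝ, N₀ (f (t * Complex.I))) (⨆ t : ℝ, N₁ (f (1 + t * Complex.I)))

/-- The norm of the complex interpolation space `[E₀, E₁]_θ`. -/
def interpENorm (N₀ N₁ : X → ℝ≥0∞) (θ : ℝ) (x : X) : ℝ≥0∞ :=
  ⨅ (f : ℂ → X) (_ : IsAdmissible N₀ N₁ f) (_ : f (θ : ℂ) = x), admissibleENorm N₀ N₁ f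

/-- Two normed spaces consist of the same elements and have equivalent norms. -/
def EquivENorm (N M : X → ℝ≥0∞) : Prop :=
  ∃ c : ℝ≥0, 0 < c ∧ ∀ x, N x ≤ c * M x ∧ M x ≤ c * N x

end Interpolation

/-! ### Besov spaces over `ℝ^d` -/

/-- The functions `β₀ ∈ C^∞(ℝ^d)` with `β₀ = 1` on `|y| ≤ 1` and `β₀ = 0` on `|y| ≥ 2`. -/
structure IsCutoff {d : ℕ} (β₀ : Eu d → ℂ) : Prop where
  smooth : ContDiff ℝ ∞ β₀
  eq_one : ∀ y, ‖y‖ ≤ 1 → β₀ y = 1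
  eq_zero : ∀ y, 2 ≤ ‖y‖ → β₀ y = 0

/-- The resolution of unity generated by `β₀`: `β_k(y) = β₀(2^{-k} y) - β₀(2^{1-k} y)`, `k ≥ 1`. -/
def dyadic {d : ℕ} (β₀ : Eu d → ℂ) : ℕ → Eu d → ℂ
  | 0 => β₀
  | k + 1 => fun y => β₀ (((2 : ℝ) ^ (k + 1))⁻¹ • y) - β₀ (((2 : ℝ) ^ k)⁻¹ • y)

/-- The `L_p(ℝ^d)` norm of a tempered distribution; it is `∞` if the distribution is not given by
a function from `L_p(ℝ^d)`. -/
def lpENorm {d : ℕ} (p : ℝ) (w : 𝓢'(Eu d, ℂ)) : ℝ≥0∞ :=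
  ⨅ (h : Eu d → ℂ) (_ : MemLp h (ENNReal.ofReal p) volume)
    (_ : ∀ f : 𝓢(Eu d, ℂ), w f = ∫ x, f x * h x), eLpNorm h (ENNReal.ofReal p) volume

/-- The norm of `B^{s,φ}_p(ℝ^d)`, with `w_k = 𝓕⁻¹[β_k 𝓕 w]`. -/
def besovENorm {d : ℕ} (β₀ : Eu d → ℂ) (s : ℝ) (φ : ℝ → ℝ) (p : ℝ) (w : 𝓢'(Eu d, ℂ)) : ℝ≥0∞ :=
  (∑' k : ℕ, (ENNReal.ofReal ((2 : ℝ) ^ (s * k) * φ (2 ^ k)) *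
    lpENorm p (TemperedDistribution.fourierMultiplierCLM ℂ (dyadic β₀ k) w)) ^ p) ^ (1 / p)

/-! ### Bounded domains with smooth boundary; smooth functions and distributions on `Γ` -/

/-- `Ω` is a bounded open subset of `ℝ^{d+1}` with boundary of class `C^∞`: near every boundary
point a `C^∞` diffeomorphism takes the half-space `x_{d+1} > 0` to `Ω` and the hyperplane
`x_{d+1} = 0` to the boundary. -/
structure IsSmoothBoundedDomain {d : ℕ} (Ω : Set (Eu (d + 1))) : Prop where
  isOpen : IsOpen Ω
  isBounded : Bornology.IsBounded Ω
  flat : ∀ x ∈ frontier Ω, ∃ Φ : OpenPartialHomeomorph (Eu (d + 1)) (Eu (d + 1)),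
    x ∈ Φ.target ∧ ContDiffOn ℝ ∞ Φ Φ.source ∧ ContDiffOn ℝ ∞ Φ.symm Φ.target ∧
    Φ '' (Φ.source ∩ {y | 0 < y (Fin.last d)}) = Φ.target ∩ Ω ∧
    Φ '' (Φ.source ∩ {y | y (Fin.last d) = 0}) = Φ.target ∩ frontier Ω

/-- A local chart `π : V ↔ Γ'` of class `C^∞` on a hypersurface `Γ ⊆ ℝ^{d+1}`: a homeomorphism
from an open set `V ⊆ ℝ^d` onto a relatively open set `Γ' ⊆ Γ` that is `C^∞` as an
`ℝ^{d+1}`-valued map and has an injective differential at every point of `V`. -/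
structure SmoothChart {d : ℕ} (Γ : Set (Eu (d + 1))) where
  π : OpenPartialHomeomorph (Eu d) Γ
  smooth : ContDiffOn ℝ ∞ (fun x => (π x : Eu (d + 1))) π.source
  immersion : ∀ x ∈ π.source,
    Function.Injective (fderiv ℝ (fun x => (π x : Eu (d + 1))) x)

/-- The density of the surface measure of `Γ` in a chart: `√(det (Dπ(x)ᵀ Dπ(x)))`. -/
def SmoothChart.density {d : ℕ} {Γ : Set (Eu (d + 1))} (e : SmoothChart Γ) (x : Eu d) : ℝ :=
  √((ContinuousLinearMap.adjoint (fderiv ℝ (fun x => (e.π x : Eu (d + 1))) x) ∘L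
    fderiv ℝ (fun x => (e.π x : Eu (d + 1))) x).det)

/-- The functions on `Γ` that are of class `C^∞` in every chart. -/
def smoothSubmodule {d : ℕ} (Γ : Set (Eu (d + 1))) : Submodule ℂ (Γ → ℂ) where
  carrier := {g | ∀ e : SmoothChart Γ, ContDiffOn ℝ ∞ (fun x => g (e.π x)) e.π.source}
  add_mem' := fun hf hg e => (hf e).add (hg e)
  zero_mem' := fun _ => contDiffOn_const
  smul_mem' := fun c _ hf e => (hf e).const_smul c

/-- The space `C^∞(Γ)`. -/
def SmoothFunction {d : ℕ} (Γ : Set (Eu (d + 1))) : Type := smoothSubmodule Γ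

namespace SmoothFunction

variable {d : ℕ} {Γ : Set (Eu (d + 1))}

instance : AddCommGroup (SmoothFunction Γ) := inferInstanceAs (AddCommGroup (smoothSubmodule Γ))

instance : Module ℂ (SmoothFunction Γ) := inferInstanceAs (Module ℂ (smoothSubmodule Γ))

instance : CoeFun (SmoothFunction Γ) (fun _ => Γ → ℂ) := ⟨fun g => g.1⟩

/-- The topology of `C^∞(Γ)`: in every chart, uniform convergence of all derivatives on the
compact subsets of the domain of the chart. -/
instance : TopologicalSpace (SmoothFunction Γ) :=
  ⨅ (e : SmoothChart Γ) (m : ℕ), TopologicalSpace.induced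
    (fun g => UniformOnFun.ofFun {K : Set (Eu d) | IsCompact K ∧ K ⊆ e.π.source}
      (iteratedFDeriv ℝ m (fun x => g (e.π x)))) inferInstance

end SmoothFunction

/-- The space `𝓓'(Γ)` of distributions on `Γ`: the topological dual of `C^∞(Γ)`.  A function `u`
on `Γ` is identified with the functional `g ↦ ∫_Γ u g dS`, with `dS` the surface measure. -/
abbrev BdryDistribution {d : ℕ} (Γ : Set (Eu (d + 1))) : Type := SmoothFunction Γ →L[ℂ] ℂ

/-! ### Besov spaces over `Γ` -/

/-- A finite collection of charts `π_j : V_j ↔ Γ_j` and of functions `χ_j ∈ C^∞(Γ)` with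
`supp χ_j ⊆ Γ_j` and `∑ χ_j = 1` (hence the sets `Γ_j` cover `Γ`). -/
structure LocalData {d : ℕ} (Γ : Set (Eu (d + 1))) where
  num : ℕ
  chart : Fin num → SmoothChart Γ
  χ : Fin num → SmoothFunction Γ
  supp : ∀ j, tsupport (χ j : Γ → ℂ) ⊆ (chart j).π.target
  sum_eq_one : ∀ y : Γ, ∑ j, χ j y = 1

/-- `w` is the extension by zero onto `ℝ^d` of the image `(χ v) ∘ π` of the distribution `χ v` in
the chart `π`, i.e. `w(f) = v(χ · (f / J) ∘ π⁻¹)` for every test function `f`, with `J` the density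
of the surface measure (if `v` is a function, then `w` is the function `(χ v) ∘ π`). Here
`χ · (f / J) ∘ π⁻¹` is zero off the range of the chart, for `supp χ` lies in this range. -/
def IsLocalImage {d : ℕ} {Γ : Set (Eu (d + 1))} (e : SmoothChart Γ) (χ : SmoothFunction Γ)
    (v : BdryDistribution Γ) (w : 𝓢'(Eu d, ℂ)) : Prop :=
  ∀ f : 𝓢(Eu d, ℂ), ∃ g : SmoothFunction Γ,
    (∀ y : Γ, g y = χ y * (f (e.π.symm y) / (e.density (e.π.symm y) : ℂ))) ∧ w f = v g

/-- The norm of `B^{s,φ}_p(Γ)`: the sum over `j` of the `B^{s,φ}_p(ℝ^d)` norms of the extensions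
by zero of `(χ_j v) ∘ π_j`.  The infimum is over the only `w` with the given property. -/
def besovBdryENorm {d : ℕ} {Γ : Set (Eu (d + 1))} (A : LocalData Γ) (β₀ : Eu d → ℂ)
    (s : ℝ) (φ : ℝ → ℝ) (p : ℝ) (v : BdryDistribution Γ) : ℝ≥0∞ :=
  ∑ j, ⨅ (w : 𝓢'(Eu d, ℂ)) (_ : IsLocalImage (A.chart j) (A.χ j) v w), besovENorm β₀ s φ p w

end RefinedBesov

end

/-! Over `ℝ^d` the Besov space is a retract of one weighted Lebesgue space. The same exponent `p`
sums over the blocks and integrates over `x`, so the norm of `w` is the `L_p` norm over `ℕ × ℝ^d` of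
`(k, x) ↦ w_k(x)` with the weight `W_k = 2^{sk} φ(2^k)`. A left inverse of `w ↦ (w_k)` is the
synthesis `(c_k) ↦ ∑ 𝓕⁻¹[n_k 𝓕 c_k]`, where `n_k` equals `1` wherever `β_k` does not vanish. It is
bounded because its matrix with respect to the blocks decays like `2^{-N|j-k|}` for every `N`, while
slow variation of `φ` gives `W_j ≤ D^{|j-k|} W_k`; Schur's test finishes (`exists_almost_diagonal`,
`seqENorm_le_of_almost_diagonal`).

For weighted `L_p` spaces the complex method is explicit, because `log W_k` and `1/p` are affine in
`θ`. For the embedding of the Besov space in the interpolation space, the blocks `h` of `w` are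
placed in a family `G exp(zL)` that equals `h` at `z = θ` and has the same norm `M = ‖w‖` in both
endpoint spaces (`exists_isAdmissible_cexp`, `exists_interpENorm_le`). For the converse, the blocks
of `f(z)` are paired with an analytic family of simple functions normalized in the dual spaces, and
the three lines theorem bounds the pairing at `θ` (`besovENorm_le_interpENorm`). The `L_p` norm of a
distribution is handled by duality throughout: a distribution bounded in the `L_q` norm on Schwartz
functions is an `L_p` function (`exists_rep_of_bound`).

Over `Γ`, let `T_j` send `v` to its local image and let `K_j` cut a distribution off in the `j`th
chart and carry it back to `Γ`. Then `∑ K_j T_j = id`, and `T_i K_j` is the transpose of an operator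
`f ↦ a · (f ∘ ψ)` with `ψ` a transition map. This operator and its transpose are bounded in all
Sobolev norms, hence almost diagonal, hence `T_i K_j` is bounded in every Besov space
(`exists_besovENorm_precomp_le`). The result over `ℝ^d` then passes to `Γ` by the retraction
argument `EquivENorm.of_retract`.

That `φ` belongs to `Υ` follows from the Leibniz rule once `φ₀^a` and `φ₁^a` are known to satisfy
the derivative bounds for every real `a`. -/

namespace RefinedBesov

/-! ### Function parameters -/

/-- `g` is smooth on `[1, ∞)` and `t ^ j * |g^(j)(t)| ≤ c * w t` there for all `j ≤ m`. -/
structure DerivBounded (g w : ℝ → ℝ) (m : ℕ) : Prop where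
  smooth : ContDiffOn ℝ ∞ g (Ici 1)
  bound : ∀ j ≤ m, ∃ c : ℝ, 0 ≤ c ∧
    ∀ t, 1 ≤ t → t ^ j * |iteratedDerivWithin j g (Ici 1) t| ≤ c * w t

theorem DerivBounded.mul {g h v w : ℝ → ℝ} {m : ℕ} (hg : DerivBounded g v m)
    (hh : DerivBounded h w m) : DerivBounded (fun t => g t * h t) (fun t => v t * w t) m := by
  refine ⟨hg.smooth.mul hh.smooth, fun j hj => ?_⟩
  choose! c hc0 hc using hg.bound
  choose! e he0 he using hh.bound
  refine ⟨∑ i ∈ Finset.range (j + 1), (j.choose i : ℝ) * (c i * e (j - i)), ?_, fun t ht => ?_⟩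
  · refine Finset.sum_nonneg fun i hi => ?_
    have := hc0 i (by simp at hi; omega)
    have := he0 (j - i) (by omega)
    positivity
  have ht0 : 0 ≤ t := by linarith
  have key := norm_iteratedFDerivWithin_mul_le (𝕜 := ℝ) (hg.smooth.of_le (mod_cast le_top))
    (hh.smooth.of_le (mod_cast le_top)) (uniqueDiffOn_Ici 1) (mem_Ici.2 ht) (n := j)
    (N := ((j : ℕ∞) : WithTop ℕ∞)) le_rfl
  simp only [norm_iteratedFDerivWithin_eq_norm_iteratedDerivWithin, Real.norm_eq_abs] at key
  refine (mul_le_mul_of_nonneg_left key (pow_nonneg ht0 j)).trans ?_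
  rw [Finset.mul_sum, Finset.sum_mul]
  refine Finset.sum_le_sum fun i hi => ?_
  have hi : i ≤ j := by simp at hi; omega
  have h1 := hc i (hi.trans hj) t ht
  have h2 := he (j - i) (by omega) t ht
  have h3 : t ^ j = t ^ i * t ^ (j - i) := by rw [← pow_add]; congr 1; omega
  calc _ = (j.choose i : ℝ) * ((t ^ i * |iteratedDerivWithin i g (Ici 1) t|) *
        (t ^ (j - i) * |iteratedDerivWithin (j - i) h (Ici 1) t|)) := by rw [h3]; ring
    _ ≤ (j.choose i : ℝ) * ((c i * v t) * (e (j - i) * w t)) := by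
        gcongr
        exact (mul_nonneg (pow_nonneg ht0 _) (abs_nonneg _)).trans h1
    _ = _ := by ring

/-- Since `t^{j+1} g^{(j+1)} = t · t^j (g')^{(j)}`, a bound of `g'` with the weight `w / t` is a
bound of `g` one order higher. This is the step of the induction on the order. -/
theorem DerivBounded.succ {g w : ℝ → ℝ} {m : ℕ} (hg : ContDiffOn ℝ ∞ g (Ici 1))
    (h0 : ∀ t, 1 ≤ t → |g t| ≤ w t)
    (h : DerivBounded (derivWithin g (Ici 1)) (fun t => w t * t⁻¹) m) :
    DerivBounded g w (m + 1) := by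
  refine ⟨hg, fun j hj => ?_⟩
  rcases j with _ | j
  · exact ⟨1, zero_le_one, fun t ht => by simpa using h0 t ht⟩
  obtain ⟨c, hc0, hc⟩ := h.bound j (by omega)
  refine ⟨c, hc0, fun t ht => ?_⟩
  have := hc t ht
  rw [iteratedDerivWithin_succ']
  have ht0 : 0 < t := by linarith
  calc _ = t * (t ^ j * |iteratedDerivWithin j (derivWithin g (Ici 1)) (Ici 1) t|) := by ring
    _ ≤ t * (c * (w t * t⁻¹)) := by gcongr
    _ = c * w t := by field_simp

theorem DerivBounded.congr {g g' w : ℝ → ℝ} {m : ℕ} (hg : DerivBounded g w m)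
    (h : ∀ t, 1 ≤ t → g' t = g t) : DerivBounded g' w m := by
  refine ⟨hg.smooth.congr h, fun j hj => ?_⟩
  obtain ⟨c, hc0, hc⟩ := hg.bound j hj
  refine ⟨c, hc0, fun t ht => ?_⟩
  rw [iteratedDerivWithin_congr (s := Ici 1) (g := g) (fun x hx => h x hx) (mem_Ici.2 ht)]
  exact hc t ht

theorem DerivBounded.congr_right {g w w' : ℝ → ℝ} {m : ℕ} (hg : DerivBounded g w m)
    (h : ∀ t, 1 ≤ t → w t = w' t) : DerivBounded g w' m := by
  refine ⟨hg.smooth, fun j hj => ?_⟩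
  obtain ⟨c, hc0, hc⟩ := hg.bound j hj
  exact ⟨c, hc0, fun t ht => (h t ht) ▸ hc t ht⟩

theorem DerivBounded.const_mul {g w : ℝ → ℝ} {m : ℕ} (a : ℝ) (hg : DerivBounded g w m) :
    DerivBounded (fun t => a * g t) w m := by
  have h1 : DerivBounded (fun _ => a) (fun _ => 1) m := by
    refine ⟨contDiffOn_const, fun j _ => ⟨|a|, abs_nonneg a, fun t ht => ?_⟩⟩
    rcases j with _ | j
    · simp
    · simp [iteratedDerivWithin_const]
  exact (h1.mul hg).congr_right fun t _ => one_mul _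

theorem IsUpsilon.derivBounded_deriv {φ : ℝ → ℝ} (hφ : IsUpsilon φ) (m : ℕ) :
    DerivBounded (derivWithin φ (Ici 1)) (fun t => φ t * t⁻¹) m := by
  refine ⟨((contDiffOn_infty_iff_derivWithin (uniqueDiffOn_Ici 1)).1 hφ.smooth).2, fun j _ => ?_⟩
  obtain ⟨c, hc0, hc⟩ := hφ.derivBound (j + 1) (by omega)
  refine ⟨c, hc0.le, fun t ht => ?_⟩
  have h := hc t ht
  have ht0 : 0 < t := by linarith
  rw [iteratedDerivWithin_succ'] at h
  have : c * (φ t * t⁻¹) = (c * φ t) * t⁻¹ := by ring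
  rw [this, le_mul_inv_iff₀ ht0]
  calc _ = _ := by ring
    _ ≤ _ := h

/-- Induction on the order by `(φ^a)' = a φ' φ^{a-1}`. The exponent drops by one at each
differentiation, so the induction has to run over all real `a` at once. -/
theorem IsUpsilon.derivBounded_rpow {φ : ℝ → ℝ} (hφ : IsUpsilon φ) (m : ℕ) :
    ∀ a : ℝ, DerivBounded (fun t => φ t ^ a) (fun t => φ t ^ a) m := by
  have hs : ∀ a : ℝ, ContDiffOn ℝ ∞ (fun t => φ t ^ a) (Ici 1) := fun a =>
    hφ.smooth.rpow_const_of_ne fun t ht => (hφ.pos t ht).ne'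
  induction m with
  | zero =>
    refine fun a => ⟨hs a, fun j hj => ⟨1, zero_le_one, fun t ht => ?_⟩⟩
    obtain rfl : j = 0 := by omega
    simp [abs_of_pos (Real.rpow_pos_of_pos (hφ.pos t ht) a)]
  | succ m ih =>
    refine fun a => DerivBounded.succ (hs a) (fun t ht =>
      (abs_of_pos (Real.rpow_pos_of_pos (hφ.pos t ht) a)).le) ?_
    have h := ((hφ.derivBounded_deriv m).mul (ih (a - 1))).const_mul a
    refine (h.congr fun t ht => ?_).congr_right fun t ht => ?_
    · rw [derivWithin_rpow_const ((hφ.smooth.differentiableOn (by simp)) t ht)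
        (Or.inl (hφ.pos t ht).ne') (uniqueDiffOn_Ici 1 t ht)]
      ring
    · have := Real.rpow_add (hφ.pos t ht) 1 (a - 1)
      rw [Real.rpow_one, add_sub_cancel] at this
      rw [this]; ring

/-- The class of function parameters is closed under weighted geometric means. -/
theorem IsUpsilon.geomMean {φ₀ φ₁ φ : ℝ → ℝ} {θ : ℝ} (h₀ : IsUpsilon φ₀) (h₁ : IsUpsilon φ₁)
    (hφ : ∀ t : ℝ, 1 ≤ t → φ t = φ₀ t ^ (1 - θ) * φ₁ t ^ θ) : IsUpsilon φ := by
  have hb : ∀ m, DerivBounded φ φ m := fun m =>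
    (((h₀.derivBounded_rpow m (1 - θ)).mul (h₁.derivBounded_rpow m θ)).congr hφ).congr_right
      fun t ht => (hφ t ht).symm
  have hpos : ∀ t, 1 ≤ t → 0 < φ t := fun t ht => by
    rw [hφ t ht]
    exact mul_pos (Real.rpow_pos_of_pos (h₀.pos t ht) _) (Real.rpow_pos_of_pos (h₁.pos t ht) _)
  refine ⟨hpos, (hb 0).smooth, fun l hl => ?_, fun m _ => ?_⟩
  · have h := ((h₀.slowlyVarying l hl).rpow_const (p := 1 - θ) (Or.inl one_ne_zero)).mul
      ((h₁.slowlyVarying l hl).rpow_const (p := θ) (Or.inl one_ne_zero))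
    simp only [Real.one_rpow, mul_one] at h
    refine h.congr' ?_
    -- From here on both `t` and `l * t` lie in `[1, ∞)`, where the formula for `φ` is available.
    filter_upwards [eventually_ge_atTop (max 1 (1 / l))] with t ht
    have ht1 : 1 ≤ t := (le_max_left _ _).trans ht
    have ht2 : 1 ≤ l * t := by
      have := (le_max_right _ _).trans ht
      rw [div_le_iff₀ hl] at this; linarith
    rw [hφ _ ht1, hφ _ ht2, Real.div_rpow (h₀.pos _ ht2).le (h₀.pos _ ht1).le,
      Real.div_rpow (h₁.pos _ ht2).le (h₁.pos _ ht1).le, div_mul_div_comm]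
  · obtain ⟨c, hc0, hc⟩ := (hb m).bound m le_rfl
    -- The constant in `DerivBounded` may be zero, whereas `Υ` asks for a positive one.
    refine ⟨c + 1, by linarith, fun t ht => (hc t ht).trans ?_⟩
    have := hpos t ht
    gcongr; linarith

/-- The weight of the `k`-th dyadic block in the norm of `B^{s,φ}_p`. -/
noncomputable def weight (s : ℝ) (φ : ℝ → ℝ) (k : ℕ) : ℝ := (2 : ℝ) ^ (s * k) * φ (2 ^ k)

theorem weight_pos {φ : ℝ → ℝ} (hφ : IsUpsilon φ) (s : ℝ) (k : ℕ) : 0 < weight s φ k :=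
  mul_pos (Real.rpow_pos_of_pos two_pos _) (hφ.pos _ (one_le_pow₀ one_le_two))

/-- A positive sequence whose consecutive terms are comparable. -/
structure IsSlowWeight (W : ℕ → ℝ) (D : ℝ) : Prop where
  pos : ∀ k, 0 < W k
  one_le : 1 ≤ D
  up : ∀ k, W (k + 1) ≤ D * W k
  down : ∀ k, W k ≤ D * W (k + 1)

/-- One of the two truncated differences is always zero, so the exponent `(j - k) + (k - j)` is `|j
- k|`. The same expression is used for the distance between levels throughout. -/
theorem IsSlowWeight.le_pow {W : ℕ → ℝ} {D : ℝ} (h : IsSlowWeight W D) (j k : ℕ) :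
    W j ≤ D ^ ((j - k) + (k - j)) * W k := by
  have hD : 0 ≤ D := zero_le_one.trans h.one_le
  have hup : ∀ k n, W (k + n) ≤ D ^ n * W k := fun k n => by
    induction n with
    | zero => simp
    | succ n ih =>
      calc _ ≤ D * W (k + n) := h.up _
        _ ≤ D * (D ^ n * W k) := by gcongr
        _ = _ := by ring
  have hdown : ∀ k n, W k ≤ D ^ n * W (k + n) := fun k n => by
    induction n with
    | zero => simp
    | succ n ih =>
      calc _ ≤ D ^ n * W (k + n) := ih
        _ ≤ D ^ n * (D * W (k + n + 1)) := by gcongr; exact h.down _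
        _ = _ := by rw [← add_assoc]; ring
  rcases le_total j k with hjk | hjk
  · have := hdown j (k - j)
    rw [Nat.add_sub_cancel' hjk] at this
    rwa [Nat.sub_eq_zero_of_le hjk, zero_add]
  · have := hup k (j - k)
    rw [Nat.add_sub_cancel' hjk] at this
    rwa [Nat.sub_eq_zero_of_le hjk, add_zero]

/-- Slow variation with `λ = 2` gives `W_{k+1} / W_k → 2^s > 0`; a convergent sequence is bounded,
and so is the sequence of its reciprocals. -/
theorem exists_isSlowWeight {φ : ℝ → ℝ} (hφ : IsUpsilon φ) (s : ℝ) :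
    ∃ D, IsSlowWeight (weight s φ) D := by
  have hlim : Tendsto (fun k : ℕ => weight s φ (k + 1) / weight s φ k) atTop
      (𝓝 ((2 : ℝ) ^ s * 1)) := by
    refine Tendsto.congr (fun k => ?_) (((hφ.slowlyVarying 2 two_pos).comp
      (tendsto_pow_atTop_atTop_of_one_lt (one_lt_two : (1 : ℝ) < 2))).const_mul ((2 : ℝ) ^ s))
    have : (2 : ℝ) ^ (s * ((k + 1 : ℕ) : ℝ)) = 2 ^ s * 2 ^ (s * (k : ℝ)) := by
      rw [← Real.rpow_add two_pos]; congr 1; push_cast; ring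
    simp only [weight, Function.comp_apply, this, pow_succ']
    have h1 := (Real.rpow_pos_of_pos two_pos (s * (k : ℝ))).ne'
    have h2 := (hφ.pos ((2 : ℝ) ^ k) (one_le_pow₀ one_le_two)).ne'
    field_simp
  have hlim' := hlim.inv₀ (by positivity)
  obtain ⟨D₁, hD₁⟩ := hlim.bddAbove_range
  obtain ⟨D₂, hD₂⟩ := hlim'.bddAbove_range
  have hp := weight_pos hφ s
  refine ⟨max 1 (max D₁ D₂), hp, le_max_left _ _, fun k => ?_, fun k => ?_⟩
  · have := hD₁ (mem_range_self k)
    rw [div_le_iff₀ (hp k)] at this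
    refine this.trans (mul_le_mul_of_nonneg_right ?_ (hp k).le)
    exact (le_max_left _ _).trans (le_max_right _ _)
  · have := hD₂ (mem_range_self k)
    rw [inv_div, div_le_iff₀ (hp _)] at this
    refine this.trans (mul_le_mul_of_nonneg_right ?_ (hp _).le)
    exact (le_max_right _ _).trans (le_max_right _ _)

end RefinedBesov

namespace RefinedBesov

/-! ### Complex interpolation of extended norms -/

section Interpolation

variable {X Y : Type*} [AddCommGroup X] [Module ℂ X] [AddCommGroup Y] [Module ℂ Y]

/-- A subadditive extended functional that vanishes at zero. -/
structure IsSubadditive (N : X → ℝ≥0∞) : Prop where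
  zero : N 0 = 0
  add : ∀ x y, N (x + y) ≤ N x + N y

theorem IsSubadditive.sum {N : X → ℝ≥0∞} (h : IsSubadditive N) {ι : Type*} (s : Finset ι)
    (x : ι → X) : N (∑ i ∈ s, x i) ≤ ∑ i ∈ s, N (x i) := by
  classical
  induction s using Finset.induction_on with
  | empty => simp [h.zero]
  | insert a s ha ih =>
    rw [Finset.sum_insert ha, Finset.sum_insert ha]
    exact (h.add _ _).trans (by gcongr)

theorem sumENorm_le (N₀ N₁ : X → ℝ≥0∞) {a b x : X} (h : a + b = x) :
    sumENorm N₀ N₁ x ≤ N₀ a + N₁ b :=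
  iInf_le_of_le a (iInf_le_of_le b (iInf_le_of_le h le_rfl))

theorem le_sumENorm {N₀ N₁ : X → ℝ≥0∞} {x : X} {c : ℝ≥0∞}
    (h : ∀ a b, a + b = x → c ≤ N₀ a + N₁ b) : c ≤ sumENorm N₀ N₁ x :=
  le_iInf fun a => le_iInf fun b => le_iInf fun hab => h a b hab

theorem sumENorm_isSubadditive {N₀ N₁ : X → ℝ≥0∞} (h₀ : IsSubadditive N₀)
    (h₁ : IsSubadditive N₁) : IsSubadditive (sumENorm N₀ N₁) := by
  refine ⟨?_, fun x y => ?_⟩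
  · simpa [h₀.zero, h₁.zero] using sumENorm_le N₀ N₁ (add_zero (0 : X))
  · simp only [sumENorm, ENNReal.iInf_add, ENNReal.add_iInf]
    refine le_iInf fun a => le_iInf fun b => le_iInf fun hab => le_iInf fun a' => le_iInf fun b' =>
      le_iInf fun hab' => ?_
    refine (sumENorm_le N₀ N₁ (a := a + a') (b := b + b') (by rw [← hab, ← hab']; abel)).trans ?_
    calc _ ≤ (N₀ a + N₀ a') + (N₁ b + N₁ b') := add_le_add (h₀.add _ _) (h₁.add _ _)
      _ = _ := by ring

theorem sumENorm_map_le {N₀ N₁ : X → ℝ≥0∞} {M₀ M₁ : Y → ℝ≥0∞} (L : X →ₗ[ℂ] Y) {C : ℝ≥0}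
    (hC : C ≠ 0) (h₀ : ∀ x, M₀ (L x) ≤ C * N₀ x) (h₁ : ∀ x, M₁ (L x) ≤ C * N₁ x) (x : X) :
    sumENorm M₀ M₁ (L x) ≤ C * sumENorm N₀ N₁ x := by
  have hC' : (C : ℝ≥0∞) ≠ 0 := by simpa using hC
  rw [← ENNReal.div_le_iff' hC' ENNReal.coe_ne_top]
  refine le_sumENorm fun a b hab => ?_
  rw [ENNReal.div_le_iff' hC' ENNReal.coe_ne_top, mul_add]
  exact (sumENorm_le M₀ M₁ (by rw [← map_add, hab])).trans (add_le_add (h₀ a) (h₁ b))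

theorem tendsto_zero_of_le_const_mul {α : Type*} {l : Filter α} {u v : α → ℝ≥0∞} (C : ℝ≥0)
    (hv : Tendsto v l (𝓝 0)) (h : ∀ᶠ a in l, u a ≤ C * v a) : Tendsto u l (𝓝 0) := by
  have : Tendsto (fun a => (C : ℝ≥0∞) * v a) l (𝓝 0) := by
    simpa using ENNReal.Tendsto.const_mul hv (Or.inr ENNReal.coe_ne_top)
  exact tendsto_of_tendsto_of_tendsto_of_le_of_le' tendsto_const_nhds this
    (Eventually.of_forall fun _ => zero_le) h

theorem IsAdmissible.map {N₀ N₁ : X → ℝ≥0∞} {M₀ M₁ : Y → ℝ≥0∞} (L : X →ₗ[ℂ] Y) {C : ℝ≥0}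
    (hC : C ≠ 0) (h₀ : ∀ x, M₀ (L x) ≤ C * N₀ x) (h₁ : ∀ x, M₁ (L x) ≤ C * N₁ x)
    {f : ℂ → X} (hf : IsAdmissible N₀ N₁ f) : IsAdmissible M₀ M₁ (fun z => L (f z)) := by
  have hs := sumENorm_map_le L hC h₀ h₁
  refine ⟨?_, fun z hz => ?_, fun z hz => ?_, fun t => ?_, fun t => ?_, fun t => ?_, fun t => ?_⟩
  · obtain ⟨B, hB⟩ := hf.bounded
    refine ⟨C * B, fun z hz => (hs _).trans ?_⟩
    rw [ENNReal.coe_mul]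
    gcongr
    exact hB z hz
  · refine tendsto_zero_of_le_const_mul C (hf.continuous z hz) (Eventually.of_forall fun w => ?_)
    rw [← map_sub]; exact hs _
  · obtain ⟨f', hf', h⟩ := hf.holomorphic z hz
    refine ⟨L f', (hs _).trans_lt (ENNReal.mul_lt_top ENNReal.coe_lt_top hf'), ?_⟩
    refine tendsto_zero_of_le_const_mul C h (Eventually.of_forall fun w => ?_)
    rw [← map_sub, ← map_smul, ← map_sub]; exact hs _
  · exact (h₀ _).trans_lt (ENNReal.mul_lt_top ENNReal.coe_lt_top (hf.mem_left t))
  · exact (h₁ _).trans_lt (ENNReal.mul_lt_top ENNReal.coe_lt_top (hf.mem_right t))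
  · refine tendsto_zero_of_le_const_mul C (hf.continuous_left t) (Eventually.of_forall fun w => ?_)
    rw [← map_sub]; exact h₀ _
  · refine tendsto_zero_of_le_const_mul C (hf.continuous_right t) (Eventually.of_forall fun w => ?_)
    rw [← map_sub]; exact h₁ _

theorem interpENorm_le {N₀ N₁ : X → ℝ≥0∞} {θ : ℝ} {f : ℂ → X} (hf : IsAdmissible N₀ N₁ f) :
    interpENorm N₀ N₁ θ (f θ) ≤ admissibleENorm N₀ N₁ f :=
  iInf_le_of_le f (iInf_le_of_le hf (iInf_le_of_le rfl le_rfl))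

theorem le_interpENorm {N₀ N₁ : X → ℝ≥0∞} {θ : ℝ} {x : X} {c : ℝ≥0∞}
    (h : ∀ f, IsAdmissible N₀ N₁ f → f θ = x → c ≤ admissibleENorm N₀ N₁ f) :
    c ≤ interpENorm N₀ N₁ θ x :=
  le_iInf fun f => le_iInf fun hf => le_iInf fun hx => h f hf hx

/-- The interpolation property: composition with an operator bounded between both pairs of endpoint
spaces preserves admissibility and multiplies the norms on the two boundary lines by at most `C`. -/
theorem interpENorm_map_le {N₀ N₁ : X → ℝ≥0∞} {M₀ M₁ : Y → ℝ≥0∞} (L : X →ₗ[ℂ] Y) {C : ℝ≥0}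
    (hC : C ≠ 0) (h₀ : ∀ x, M₀ (L x) ≤ C * N₀ x) (h₁ : ∀ x, M₁ (L x) ≤ C * N₁ x)
    (θ : ℝ) (x : X) : interpENorm M₀ M₁ θ (L x) ≤ C * interpENorm N₀ N₁ θ x := by
  have hC' : (C : ℝ≥0∞) ≠ 0 := by simpa using hC
  -- Division by `C ≠ 0` leaves the infimum alone on the right, so that it suffices to bound each
  -- competitor `f`.
  rw [← ENNReal.div_le_iff' hC' ENNReal.coe_ne_top]
  refine le_interpENorm fun f hf hx => ?_
  rw [ENNReal.div_le_iff' hC' ENNReal.coe_ne_top, ← hx]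
  refine (interpENorm_le (hf.map L hC h₀ h₁)).trans (max_le ?_ ?_)
  · exact iSup_le fun t => (h₀ _).trans (mul_le_mul_right ((le_iSup
      (fun t : ℝ => N₀ (f (t * Complex.I))) t).trans (le_max_left _ _)) _)
  · exact iSup_le fun t => (h₁ _).trans (mul_le_mul_right ((le_iSup
      (fun t : ℝ => N₁ (f (1 + t * Complex.I))) t).trans (le_max_right _ _)) _)

theorem tendsto_zero_of_le_add {α : Type*} {l : Filter α} {u v w : α → ℝ≥0∞}
    (hv : Tendsto v l (𝓝 0)) (hw : Tendsto w l (𝓝 0)) (h : ∀ a, u a ≤ v a + w a) :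
    Tendsto u l (𝓝 0) := by
  have : Tendsto (fun a => v a + w a) l (𝓝 0) := by simpa using hv.add hw
  exact tendsto_of_tendsto_of_tendsto_of_le_of_le tendsto_const_nhds this
    (fun _ => zero_le) h

theorem IsAdmissible.add {N₀ N₁ : X → ℝ≥0∞} (h₀ : IsSubadditive N₀) (h₁ : IsSubadditive N₁)
    {f g : ℂ → X} (hf : IsAdmissible N₀ N₁ f) (hg : IsAdmissible N₀ N₁ g) :
    IsAdmissible N₀ N₁ (fun z => f z + g z) := by
  have hs := sumENorm_isSubadditive h₀ h₁
  refine ⟨?_, fun z hz => ?_, fun z hz => ?_, fun t => ?_, fun t => ?_, fun t => ?_, fun t => ?_⟩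
  · obtain ⟨B, hB⟩ := hf.bounded
    obtain ⟨B', hB'⟩ := hg.bounded
    refine ⟨B + B', fun z hz => (hs.add _ _).trans ?_⟩
    rw [ENNReal.coe_add]
    exact add_le_add (hB z hz) (hB' z hz)
  · refine tendsto_zero_of_le_add (hf.continuous z hz) (hg.continuous z hz) fun w => ?_
    rw [add_sub_add_comm]; exact hs.add _ _
  · obtain ⟨f', hf', h⟩ := hf.holomorphic z hz
    obtain ⟨g', hg', h'⟩ := hg.holomorphic z hz
    refine ⟨f' + g', (hs.add _ _).trans_lt (ENNReal.add_lt_top.2 ⟨hf', hg'⟩), ?_⟩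
    refine tendsto_zero_of_le_add h h' fun w => ?_
    rw [add_sub_add_comm, smul_add, add_sub_add_comm]; exact hs.add _ _
  · exact (h₀.add _ _).trans_lt (ENNReal.add_lt_top.2 ⟨hf.mem_left t, hg.mem_left t⟩)
  · exact (h₁.add _ _).trans_lt (ENNReal.add_lt_top.2 ⟨hf.mem_right t, hg.mem_right t⟩)
  · refine tendsto_zero_of_le_add (hf.continuous_left t) (hg.continuous_left t) fun w => ?_
    rw [add_sub_add_comm]; exact h₀.add _ _
  · refine tendsto_zero_of_le_add (hf.continuous_right t) (hg.continuous_right t) fun w => ?_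
    rw [add_sub_add_comm]; exact h₁.add _ _

theorem isAdmissible_zero {N₀ N₁ : X → ℝ≥0∞} (h₀ : IsSubadditive N₀) (h₁ : IsSubadditive N₁) :
    IsAdmissible N₀ N₁ (fun _ => 0) := by
  have hs := (sumENorm_isSubadditive h₀ h₁).zero
  refine ⟨⟨0, fun z _ => by simp [hs]⟩, fun z _ => ?_, fun z _ => ⟨0, by simp [hs], ?_⟩,
    fun t => by simp [h₀.zero], fun t => by simp [h₁.zero], fun t => ?_, fun t => ?_⟩
  · simp [hs, tendsto_const_nhds]
  · simp [hs]
  · simp [h₀.zero]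
  · simp [h₁.zero]

theorem interpENorm_isSubadditive {N₀ N₁ : X → ℝ≥0∞} (h₀ : IsSubadditive N₀)
    (h₁ : IsSubadditive N₁) (θ : ℝ) : IsSubadditive (interpENorm N₀ N₁ θ) := by
  refine ⟨?_, fun x y => ?_⟩
  · refine le_antisymm ((interpENorm_le (θ := θ) (isAdmissible_zero h₀ h₁)).trans ?_) zero_le
    simp [admissibleENorm, h₀.zero, h₁.zero]
  · rw [interpENorm.eq_1 N₀ N₁ θ x, interpENorm.eq_1 N₀ N₁ θ y]
    simp only [ENNReal.iInf_add, ENNReal.add_iInf]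
    refine le_iInf fun g => le_iInf fun hg => le_iInf fun hy => le_iInf fun f => le_iInf fun hf =>
      le_iInf fun hx => ?_
    rw [← hx, ← hy]
    refine (interpENorm_le (θ := θ) (hf.add h₀ h₁ hg)).trans (max_le ?_ ?_)
    · exact iSup_le fun t => (h₀.add _ _).trans (add_le_add
        ((le_iSup (fun t : ℝ => N₀ (f (t * Complex.I))) t).trans (le_max_left _ _))
        ((le_iSup (fun t : ℝ => N₀ (g (t * Complex.I))) t).trans (le_max_left _ _)))
    · exact iSup_le fun t => (h₁.add _ _).trans (add_le_add
        ((le_iSup (fun t : ℝ => N₁ (f (1 + t * Complex.I))) t).trans (le_max_right _ _))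
        ((le_iSup (fun t : ℝ => N₁ (g (1 + t * Complex.I))) t).trans (le_max_right _ _)))

/-- Retraction argument: a space that is a finite retract of copies of another one inherits the
description of its complex interpolation spaces. -/
theorem EquivENorm.of_retract {N₀ N₁ N : X → ℝ≥0∞} {n : ℕ} (T : Fin n → Y →ₗ[ℂ] X)
    (K : Fin n → X →ₗ[ℂ] Y) (hKT : ∀ v, ∑ j, K j (T j v) = v)
    {M₀ M₁ M : Y → ℝ≥0∞} (hM₀ : ∀ v, M₀ v = ∑ j, N₀ (T j v)) (hM₁ : ∀ v, M₁ v = ∑ j, N₁ (T j v))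
    (hM : ∀ v, M v = ∑ j, N (T j v)) (h₀ : IsSubadditive N₀) (h₁ : IsSubadditive N₁) {C : ℝ≥0}
    (hC : C ≠ 0) (hK₀ : ∀ i j w, N₀ (T i (K j w)) ≤ C * N₀ w)
    (hK₁ : ∀ i j w, N₁ (T i (K j w)) ≤ C * N₁ w) {θ : ℝ}
    (h : EquivENorm (interpENorm N₀ N₁ θ) N) : EquivENorm (interpENorm M₀ M₁ θ) M := by
  obtain ⟨c, hc, hcN⟩ := h
  have hsub : ∀ {N : X → ℝ≥0∞} {M : Y → ℝ≥0∞}, IsSubadditive N → (∀ v, M v = ∑ j, N (T j v)) →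
      IsSubadditive M := fun hN hM => by
    refine ⟨by simp [hM, hN.zero], fun x y => ?_⟩
    rw [hM, hM, hM, ← Finset.sum_add_distrib]
    exact Finset.sum_le_sum fun j _ => by rw [map_add]; exact hN.add _ _
  -- `M (K_j w)` is a sum of `n` terms `N (T_i K_j w)`; the factor `n + 1` in place of `n` keeps the
  -- constant nonzero when `n = 0`. This bound is needed for the endpoint spaces only.
  have hKM : ∀ {N : X → ℝ≥0∞} {M : Y → ℝ≥0∞}, (∀ v, M v = ∑ j, N (T j v)) →
      (∀ i j w, N (T i (K j w)) ≤ C * N w) → ∀ j w, M (K j w) ≤ ((n + 1) * C : ℝ≥0) * N w :=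
    fun {N _} hM hK j w => by
      rw [hM]
      calc _ ≤ ∑ i : Fin n, C * N w := Finset.sum_le_sum fun i _ => hK i j w
        _ = n * (C * N w) := by simp
        _ ≤ _ := by
            push_cast
            rw [← mul_assoc]
            gcongr
            exact le_self_add
  have hTM : ∀ {N : X → ℝ≥0∞} {M : Y → ℝ≥0∞}, (∀ v, M v = ∑ j, N (T j v)) →
      ∀ j v, N (T j v) ≤ (1 : ℝ≥0) * M v := fun {N _} hM j v => by
    rw [hM, ENNReal.coe_one, one_mul]
    exact Finset.single_le_sum (f := fun j => N (T j v)) (fun _ _ => zero_le) (Finset.mem_univ j)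
  have hD : ((n + 1) * C : ℝ≥0) ≠ 0 := by positivity
  -- The constant dominates both `(n + 1) C c`, which comes from interpolating the `K_j` in `v = ∑
  -- K_j T_j v`, and `n c`, which comes from interpolating the `T_j`.
  refine ⟨((n + 1) * C + n + 1) * c, by positivity, fun v => ⟨?_, ?_⟩⟩
  · have hI := interpENorm_isSubadditive (hsub h₀ hM₀) (hsub h₁ hM₁) θ
    calc interpENorm M₀ M₁ θ v = interpENorm M₀ M₁ θ (∑ j, K j (T j v)) := by rw [hKT]
      _ ≤ ∑ j, interpENorm M₀ M₁ θ (K j (T j v)) := hI.sum _ _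
      _ ≤ ∑ j, ((n + 1) * C : ℝ≥0) * (c * N (T j v)) := by
          refine Finset.sum_le_sum fun j _ => (interpENorm_map_le (K j) hD
            (hKM hM₀ hK₀ j) (hKM hM₁ hK₁ j) θ _).trans ?_
          gcongr
          exact (hcN _).1
      _ = ((n + 1) * C : ℝ≥0) * c * M v := by
          rw [hM, Finset.mul_sum]; simp only [mul_assoc]
      _ ≤ _ := by
          rw [← ENNReal.coe_mul]
          gcongr
          rw [add_assoc]
          exact le_self_add
  · rw [hM]
    calc _ ≤ ∑ j : Fin n, (c : ℝ≥0∞) * ((1 : ℝ≥0) * interpENorm M₀ M₁ θ v) := by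
          refine Finset.sum_le_sum fun j _ => (hcN _).2.trans ?_
          gcongr
          exact interpENorm_map_le (T j) one_ne_zero (hTM hM₀ j) (hTM hM₁ j) θ v
      _ = (n * c : ℝ≥0) * interpENorm M₀ M₁ θ v := by
          simp [mul_assoc]
      _ ≤ _ := by
          gcongr
          rw [add_assoc]
          exact le_add_left le_self_add

end Interpolation

end RefinedBesov

namespace RefinedBesov

/-! ### Lebesgue spaces: Schur's test, dominated convergence, duality -/

section Lebesgue

variable {α β : Type*} [MeasurableSpace α] [MeasurableSpace β] {μ : Measure α} {ν : Measure β}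
  {p q : ℝ}

theorem ofReal_ne_zero_of_conj (hpq : p.HolderConjugate q) : ENNReal.ofReal p ≠ 0 := by
  simpa using hpq.pos

theorem eLpNorm_ofReal {E : Type*} [NormedAddCommGroup E] (hp : 0 < p) (f : α → E) :
    eLpNorm f (ENNReal.ofReal p) μ = (∫⁻ x, ‖f x‖ₑ ^ p ∂μ) ^ (1 / p) := by
  rw [eLpNorm_eq_lintegral_rpow_enorm_toReal (by simpa using hp) ENNReal.ofReal_ne_top,
    ENNReal.toReal_ofReal hp.le]

/-- Hölder's inequality for the splitting `κ g = κ^{1/q} · (κ^{1/p} g)`, raised to the power `p`;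
note `p / q = p - 1`. -/
theorem lintegral_mul_rpow_le (hpq : p.HolderConjugate q) {κ g : α → ℝ≥0∞}
    (hκ : AEMeasurable κ μ) (hg : AEMeasurable g μ) :
    (∫⁻ x, κ x * g x ∂μ) ^ p ≤ (∫⁻ x, κ x ∂μ) ^ (p - 1) * ∫⁻ x, κ x * g x ^ p ∂μ := by
  have hp := hpq.pos
  have hq := hpq.symm.pos
  have h := ENNReal.lintegral_mul_le_Lp_mul_Lq μ hpq.symm (f := fun x => κ x ^ (1 / q))
    (g := fun x => κ x ^ (1 / p) * g x) (hκ.pow_const _) ((hκ.pow_const _).mul hg)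
  have h1 : ∀ x, ((fun x => κ x ^ (1 / q)) * fun x => κ x ^ (1 / p) * g x) x = κ x * g x := by
    intro x
    simp only [Pi.mul_apply]
    rw [← mul_assoc, ← ENNReal.rpow_add_of_nonneg _ _ (by positivity) (by positivity)]
    have : 1 / q + 1 / p = 1 := by
      have := hpq.inv_add_inv_eq_one; simp only [one_div]; linarith
    rw [this, ENNReal.rpow_one]
  have h2 : ∀ x, (κ x ^ (1 / q)) ^ q = κ x := fun x => by
    rw [← ENNReal.rpow_mul, one_div_mul_cancel hq.ne', ENNReal.rpow_one]
  have h3 : ∀ x, (κ x ^ (1 / p) * g x) ^ p = κ x * g x ^ p := fun x => by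
    rw [ENNReal.mul_rpow_of_nonneg _ _ hp.le, ← ENNReal.rpow_mul, one_div_mul_cancel hp.ne',
      ENNReal.rpow_one]
  simp only [h1, h2, h3] at h
  calc _ ≤ ((∫⁻ x, κ x ∂μ) ^ (1 / q) * (∫⁻ x, κ x * g x ^ p ∂μ) ^ (1 / p)) ^ p :=
        ENNReal.rpow_le_rpow h hp.le
    _ = _ := by
      rw [ENNReal.mul_rpow_of_nonneg _ _ hp.le, ← ENNReal.rpow_mul, ← ENNReal.rpow_mul,
        one_div_mul_cancel hp.ne', ENNReal.rpow_one]
      congr 2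
      have := hpq.sub_one_mul_conj
      field_simp
      linarith

/-- **Schur's test** for positive kernels on Lebesgue spaces. -/
theorem schur_test [SFinite μ] [SFinite ν] (hpq : p.HolderConjugate q) {κ : α → β → ℝ≥0∞}
    (hκ : Measurable (Function.uncurry κ)) {g : β → ℝ≥0∞} (hg : Measurable g) {A : ℝ≥0∞}
    (h₁ : ∀ x, ∫⁻ y, κ x y ∂ν ≤ A) (h₂ : ∀ y, ∫⁻ x, κ x y ∂μ ≤ A) :
    (∫⁻ x, (∫⁻ y, κ x y * g y ∂ν) ^ p ∂μ) ^ (1 / p) ≤ A * (∫⁻ y, g y ^ p ∂ν) ^ (1 / p) := by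
  have hp := hpq.pos
  have hp1 : 0 ≤ p - 1 := by linarith [hpq.lt]
  have key : ∫⁻ x, (∫⁻ y, κ x y * g y ∂ν) ^ p ∂μ ≤ A ^ p * ∫⁻ y, g y ^ p ∂ν := by
    -- Hölder in `y` uses the row sums, and after Tonelli the column sums supply the remaining
    -- factor `A`.
    calc _ ≤ ∫⁻ x, A ^ (p - 1) * ∫⁻ y, κ x y * g y ^ p ∂ν ∂μ := by
          refine lintegral_mono fun x => (lintegral_mul_rpow_le (κ := κ x) hpq
            (hκ.comp measurable_prodMk_left).aemeasurable hg.aemeasurable).trans ?_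
          gcongr
          exact h₁ x
      _ = A ^ (p - 1) * ∫⁻ x, ∫⁻ y, κ x y * g y ^ p ∂ν ∂μ := by
          rw [lintegral_const_mul]
          exact Measurable.lintegral_prod_right
            (hκ.mul ((hg.comp measurable_snd).pow_const p))
      _ = A ^ (p - 1) * ∫⁻ y, ∫⁻ x, κ x y * g y ^ p ∂μ ∂ν := by
          rw [lintegral_lintegral_swap]
          exact (hκ.mul ((hg.comp measurable_snd).pow_const p)).aemeasurable
      _ ≤ A ^ (p - 1) * ∫⁻ y, A * g y ^ p ∂ν := by
          gcongr with y
          rw [lintegral_mul_const (f := fun x => κ x y) _ (hκ.comp measurable_prodMk_right)]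
          gcongr
          exact h₂ y
      _ = A ^ p * ∫⁻ y, g y ^ p ∂ν := by
          rw [lintegral_const_mul _ (hg.pow_const p), ← mul_assoc]
          congr 1
          nth_rewrite 2 [← ENNReal.rpow_one A]
          rw [← ENNReal.rpow_add_of_nonneg _ _ hp1 zero_le_one]
          congr 1; ring
  calc _ ≤ (A ^ p * ∫⁻ y, g y ^ p ∂ν) ^ (1 / p) := ENNReal.rpow_le_rpow key (by positivity)
    _ = _ := by
      rw [ENNReal.mul_rpow_of_nonneg _ _ (by positivity), ← ENNReal.rpow_mul,
        mul_one_div_cancel hp.ne', ENNReal.rpow_one]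

/-- Dominated convergence for the `p`th powers. A general countably generated filter covers finite
subsets of `ℕ` as well as punctured and relative neighbourhoods in the plane. -/
theorem tendsto_eLpNorm_zero {ι : Type*} {l : Filter ι} [l.IsCountablyGenerated] (hp : 0 < p)
    {F : ι → α → ℂ} {G : α → ℝ} (hF : ∀ᶠ i in l, Measurable (F i))
    (hG : MemLp G (ENNReal.ofReal p) μ) (hle : ∀ᶠ i in l, ∀ y, ‖F i y‖ ≤ G y)
    (hlim : ∀ y, Tendsto (fun i => F i y) l (𝓝 0)) :
    Tendsto (fun i => eLpNorm (F i) (ENNReal.ofReal p) μ) l (𝓝 0) := by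
  simp only [eLpNorm_ofReal hp]
  have h : Tendsto (fun i => ∫⁻ x, ‖F i x‖ₑ ^ p ∂μ) l (𝓝 (∫⁻ _, 0 ∂μ)) := by
    refine tendsto_lintegral_filter_of_dominated_convergence (fun x => ‖G x‖ₑ ^ p)
      (hF.mono fun i hi => hi.enorm.pow_const p) (hle.mono fun i hi => ae_of_all _ fun y => ?_)
      ?_ (ae_of_all _ fun y => ?_)
    · gcongr
      rw [enorm_le_iff_norm_le, Real.norm_eq_abs]
      exact (hi y).trans (le_abs_self _)
    · have h := hG.2
      rw [eLpNorm_ofReal hp, ENNReal.rpow_lt_top_iff_of_pos (by positivity)] at h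
      exact h.ne
    · have := ((hlim y).enorm).ennrpow_const p
      simpa [hp] using this
  simpa [hp] using h.ennrpow_const (1 / p)

/-- An element of the dual of `L_q` tested on simple functions has `L_p` norm at most its bound. -/
theorem eLpNorm_le_of_simpleFunc_test (hpq : p.HolderConjugate q) {S : ℕ → Set α}
    (hS : ∀ n, MeasurableSet (S n)) (hmono : Monotone S) (hU : ⋃ n, S n = univ)
    (hfin : ∀ n, μ (S n) < ⊤) {ρ : α → ℝ} (hρm : Measurable ρ)
    (hρ : ∀ n, ∃ c, 0 < c ∧ ∀ y ∈ S n, c ≤ ρ y) {h : α → ℂ} (hm : Measurable h)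
    (hint : ∀ n, IntegrableOn h (S n) μ) {C : ℝ≥0∞}
    (H : ∀ n (s : SimpleFunc α ℂ), (∀ y ∉ S n, s y = 0) →
      ‖∫ y, h y * (s y * ρ y) ∂μ‖ₑ ≤ C * eLpNorm (fun y => s y * ρ y) (ENNReal.ofReal q) μ) :
    eLpNorm h (ENNReal.ofReal p) μ ≤ C := by
  have hp := hpq.pos
  have hq := hpq.symm.pos
  rcases eq_or_ne C ⊤ with rfl | hC
  · exact le_top
  have hρ0 : ∀ y, ρ y ≠ 0 := fun y => by
    obtain ⟨n, hn⟩ := mem_iUnion.1 (hU ▸ mem_univ y : y ∈ ⋃ n, S n)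
    obtain ⟨c, hc, h⟩ := hρ n
    exact (hc.trans_le (h y hn)).ne'
  -- The hypothesis only covers tests `s · ρ` with `s` simple. A bounded `b` supported in `S n` is
  -- reached by approximating `b / ρ` by simple functions, with dominated convergence on both sides.
  have H' : ∀ n (b : α → ℂ), Measurable b → (∃ B, ∀ y, ‖b y‖ ≤ B) → (∀ y ∉ S n, b y = 0) →
      ‖∫ y, h y * b y ∂μ‖ₑ ≤ C * (∫⁻ y, ‖b y‖ₑ ^ q ∂μ) ^ (1 / q) := by
    intro n b hb ⟨B, hB⟩ hbS
    have hb' : Measurable fun y => b y / ρ y := by fun_prop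
    let s : ℕ → SimpleFunc α ℂ := fun k =>
      SimpleFunc.approxOn (fun y => b y / ρ y) hb' univ 0 (mem_univ 0) k
    have hs_le : ∀ k y, ‖s k y * ρ y‖ ≤ 2 * ‖b y‖ := fun k y => by
      have h1 := SimpleFunc.norm_approxOn_zero_le hb' (mem_univ (0 : ℂ)) y k
      have h2 : ‖b y / ρ y‖ * ‖(ρ y : ℂ)‖ = ‖b y‖ := by
        rw [← norm_mul, div_mul_cancel₀]; simpa using hρ0 y
      rw [norm_mul]
      calc _ ≤ (‖b y / ρ y‖ + ‖b y / ρ y‖) * ‖(ρ y : ℂ)‖ := by gcongr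
        _ = _ := by linear_combination 2 * h2
    have hs_lim : ∀ y, Tendsto (fun k => s k y * ρ y) atTop (𝓝 (b y)) := fun y => by
      have := (SimpleFunc.tendsto_approxOn hb' (mem_univ (0 : ℂ)) (x := y) (by simp)).mul_const
        (ρ y : ℂ)
      rwa [div_mul_cancel₀] at this
      simpa using hρ0 y
    have hs_zero : ∀ k, ∀ y ∉ S n, s k y = 0 := fun k y hy => by
      have h1 := SimpleFunc.norm_approxOn_zero_le hb' (mem_univ (0 : ℂ)) y k
      simpa [hbS y hy] using h1
    have hsm : ∀ k, Measurable fun y => s k y * (ρ y : ℂ) := fun k => by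
      have := (s k).measurable
      fun_prop
    have L1 : Tendsto (fun k => ‖∫ y, h y * (s k y * ρ y) ∂μ‖ₑ) atTop
        (𝓝 ‖∫ y, h y * b y ∂μ‖ₑ) := by
      refine Tendsto.enorm (tendsto_integral_of_dominated_convergence
        (fun y => (S n).indicator (fun y => ‖h y‖ * (2 * B)) y)
        (fun k => (hm.mul (hsm k)).aestronglyMeasurable) ?_ (fun k => ae_of_all _ fun y => ?_)
        (ae_of_all _ fun y => (hs_lim y).const_mul _))
      · exact (integrable_indicator_iff (hS n)).2 ((hint n).norm.mul_const _)
      · by_cases hy : y ∈ S n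
        · rw [indicator_of_mem hy, norm_mul]
          gcongr
          exact (hs_le k y).trans (by gcongr; exact hB y)
        · simp [indicator_of_notMem hy, hs_zero k y hy]
    have L2 : Tendsto (fun k => ∫⁻ y, ‖s k y * ρ y‖ₑ ^ q ∂μ) atTop
        (𝓝 (∫⁻ y, ‖b y‖ₑ ^ q ∂μ)) := by
      refine tendsto_lintegral_of_dominated_convergence
        (fun y => (S n).indicator (fun y => ENNReal.ofReal (2 * B) ^ q) y)
        (fun k => (hsm k).enorm.pow_const q) (fun k => ae_of_all _ fun y => ?_) ?_
        (ae_of_all _ fun y => (hs_lim y).enorm.ennrpow_const q)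
      · by_cases hy : y ∈ S n
        · simp only [indicator_of_mem hy]
          gcongr
          rw [← ofReal_norm]
          exact ENNReal.ofReal_le_ofReal ((hs_le k y).trans (by gcongr; exact hB y))
        · simp [indicator_of_notMem hy, hs_zero k y hy, hq]
      · rw [lintegral_indicator (hS n), setLIntegral_const]
        exact ENNReal.mul_ne_top (ENNReal.rpow_ne_top_of_nonneg hq.le ENNReal.ofReal_ne_top)
          (hfin n).ne
    refine le_of_tendsto_of_tendsto L1 (ENNReal.Tendsto.const_mul (L2.ennrpow_const (1 / q))
      (Or.inr hC)) (Eventually.of_forall fun k => ?_)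
    have := H n (s k) (hs_zero k)
    rwa [eLpNorm_ofReal hq] at this
  -- Truncation in the domain and in the values makes `∫_{E n} |h|^p` finite before anything is
  -- known about `h`, so that it can be divided by.
  let E : ℕ → Set α := fun n => S n ∩ {y | ‖h y‖ ≤ n}
  have hEm : ∀ n, MeasurableSet (E n) := fun n =>
    (hS n).inter (measurableSet_le hm.norm measurable_const)
  have hEmono : Monotone E := fun m n hmn => inter_subset_inter (hmono hmn) fun y (hy : ‖h y‖ ≤ m) =>
    hy.trans (Nat.cast_le.2 hmn)
  have hEU : ⋃ n, E n = univ := by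
    refine eq_univ_of_forall fun y => ?_
    obtain ⟨n, hn⟩ := mem_iUnion.1 (hU ▸ mem_univ y : y ∈ ⋃ n, S n)
    obtain ⟨m, hm⟩ := exists_nat_ge ‖h y‖
    refine mem_iUnion.2 ⟨max n m, hmono (le_max_left _ _) hn, hm.trans ?_⟩
    exact Nat.cast_le.2 (le_max_right _ _)
  have hE : ∀ n, ∫⁻ y in E n, ‖h y‖ₑ ^ p ∂μ ≤ C ^ p := by
    intro n
    set I := ∫⁻ y in E n, ‖h y‖ₑ ^ p ∂μ with hI
    have hI_top : I ≠ ⊤ := by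
      refine ne_top_of_le_ne_top (b := (n : ℝ≥0∞) ^ p * μ (S n)) (ENNReal.mul_ne_top
        (ENNReal.rpow_ne_top_of_nonneg hp.le (ENNReal.natCast_ne_top n)) (hfin n).ne) ?_
      calc I ≤ ∫⁻ y in E n, (n : ℝ≥0∞) ^ p ∂μ := by
            refine setLIntegral_mono measurable_const fun y hy => ?_
            gcongr
            have : ‖h y‖ ≤ n := hy.2
            rw [← ofReal_norm, ← ENNReal.ofReal_natCast]
            exact ENNReal.ofReal_le_ofReal this
        _ ≤ _ := by
            rw [setLIntegral_const]
            gcongr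
            exact inter_subset_left
    -- The extremal test function of Hölder's inequality: `h b = |h|^p` and `|b|^q = |h|^p` on `E
    -- n`. The test then reads `I ≤ C I^{1/q}`, that is, `I^{1/p} ≤ C`.
    let b : α → ℂ := (E n).indicator fun y =>
      (starRingEnd ℂ) (h y) * ((‖h y‖ ^ (p - 2) : ℝ) : ℂ)
    have hbm : Measurable b := by
      refine Measurable.indicator ?_ (hEm n)
      have : Measurable fun y => (starRingEnd ℂ) (h y) := Complex.continuous_conj.measurable.comp hm
      fun_prop
    have hnb : ∀ y ∈ E n, ‖b y‖ = ‖h y‖ ^ (p - 1) := fun y hy => by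
      simp only [b, indicator_of_mem hy, norm_mul, RCLike.norm_conj, Complex.norm_real,
        Real.norm_eq_abs, abs_of_nonneg (Real.rpow_nonneg (norm_nonneg (h y)) _)]
      rcases eq_or_ne (h y) 0 with h0 | h0
      · simp [h0, Real.zero_rpow (by linarith [hpq.lt] : p - 1 ≠ 0)]
      · have := norm_pos_iff.2 h0
        nth_rewrite 1 [← Real.rpow_one ‖h y‖]
        rw [← Real.rpow_add this]
        congr 1; ring
    have hhb : ∀ y, h y * b y = (E n).indicator (fun y => ((‖h y‖ ^ p : ℝ) : ℂ)) y := fun y => by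
      by_cases hy : y ∈ E n
      · simp only [b, indicator_of_mem hy]
        rw [← mul_assoc, Complex.mul_conj, Complex.normSq_eq_norm_sq, ← Complex.ofReal_mul]
        congr 1
        rcases eq_or_ne (h y) 0 with h0 | h0
        · simp [h0, Real.zero_rpow hp.ne']
        · have := norm_pos_iff.2 h0
          rw [← Real.rpow_natCast, ← Real.rpow_add this]
          congr 1; push_cast; ring
      · simp [b, indicator_of_notMem hy]
    have key := H' n b hbm ⟨(n : ℝ) ^ (p - 1), fun y => ?_⟩ fun y hy =>
      indicator_of_notMem (fun h => hy h.1) _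
    rotate_left
    · by_cases hy : y ∈ E n
      · rw [hnb y hy]
        exact Real.rpow_le_rpow (norm_nonneg _) hy.2 (by linarith [hpq.lt])
      · simp only [b, indicator_of_notMem hy, norm_zero]
        positivity
    have e1 : ‖∫ y, h y * b y ∂μ‖ₑ = I := by
      simp only [hhb]
      rw [integral_indicator (hEm n), integral_complex_ofReal]
      rw [← ofReal_norm, Complex.norm_real, ofReal_norm,
        Real.enorm_of_nonneg (integral_nonneg fun y => by positivity),
        ofReal_integral_eq_lintegral_ofReal]
      · refine lintegral_congr fun y => ?_
        rw [← ofReal_norm, ENNReal.ofReal_rpow_of_nonneg (norm_nonneg _) hp.le]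
      · refine ⟨(hm.norm.pow_const p).aestronglyMeasurable, ?_⟩
        rw [HasFiniteIntegral]
        convert hI_top.lt_top using 2
        funext y
        rw [Real.enorm_of_nonneg (by positivity), ← ofReal_norm,
          ENNReal.ofReal_rpow_of_nonneg (norm_nonneg _) hp.le]
      · exact ae_of_all _ fun y => by positivity
    have e2 : ∫⁻ y, ‖b y‖ₑ ^ q ∂μ = I := by
      rw [hI, ← lintegral_indicator (hEm n)]
      refine lintegral_congr fun y => ?_
      by_cases hy : y ∈ E n
      · rw [indicator_of_mem hy, ← ofReal_norm, hnb y hy,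
          ENNReal.ofReal_rpow_of_nonneg (by positivity) hq.le, ← Real.rpow_mul (norm_nonneg _),
          hpq.sub_one_mul_conj, ← ENNReal.ofReal_rpow_of_nonneg (norm_nonneg _) hp.le, ofReal_norm]
      · simp [b, indicator_of_notMem hy, hq]
    rw [e1, e2] at key
    rcases eq_or_ne I 0 with h0 | h0
    · simp [h0]
    have h1 : I ^ (1 / p) ≤ C := by
      have h2 : I ^ (1 / p) = I / I ^ (1 / q) := by
        nth_rewrite 2 [← ENNReal.rpow_one I]
        rw [← ENNReal.rpow_sub _ _ h0 hI_top]
        congr 1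
        have := hpq.inv_add_inv_eq_one; simp only [one_div]; linarith
      rw [h2]
      refine ENNReal.div_le_of_le_mul key
    calc I = (I ^ (1 / p)) ^ p := by
          rw [← ENNReal.rpow_mul, one_div_mul_cancel hp.ne', ENNReal.rpow_one]
      _ ≤ C ^ p := ENNReal.rpow_le_rpow h1 hp.le
  rw [eLpNorm_ofReal hp, ← setLIntegral_univ, ← hEU,
    setLIntegral_iUnion_of_directed _ hEmono.directed_le]
  calc _ ≤ (C ^ p) ^ (1 / p) := ENNReal.rpow_le_rpow (iSup_le hE) (by positivity)
    _ = C := by rw [← ENNReal.rpow_mul, mul_one_div_cancel hp.ne', ENNReal.rpow_one]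

end Lebesgue

end RefinedBesov

namespace RefinedBesov

/-! ### Duality of `L_p` and `L_q` over a σ-finite measure -/

section Riesz

variable {α : Type*} [MeasurableSpace α] {μ : Measure α} {p q : ℝ}

theorem fact_one_le_ofReal (hpq : p.HolderConjugate q) : Fact (1 ≤ ENNReal.ofReal p) :=
  ⟨by simpa using hpq.lt.le⟩

theorem memLp_mul_of_bounded {ρ : α → ℝ} (hρ : MemLp ρ (ENNReal.ofReal q) μ) {b : α → ℂ}
    (hb : Measurable b) {B : ℝ} (hB : ∀ y, ‖b y‖ ≤ B) :
    MemLp (fun y => b y * (ρ y : ℂ)) (ENNReal.ofReal q) μ := by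
  refine hρ.of_le_mul (c := B) (hb.aestronglyMeasurable.mul
    (Complex.continuous_ofReal.comp_aestronglyMeasurable hρ.1)) (ae_of_all _ fun y => ?_)
  rw [norm_mul, Complex.norm_real]
  gcongr
  exact hB y

/-- The complex measure `A ↦ Λ (1_A ρ)` of a functional `Λ` on `L_q`. -/
theorem exists_complexMeasure (hpq : p.HolderConjugate q) {ρ : α → ℝ} (hρm : Measurable ρ)
    (hρ : MemLp ρ (ENNReal.ofReal q) μ) (Λ : (α → ℂ) → ℂ)
    (hadd : ∀ f g, MemLp f (ENNReal.ofReal q) μ → MemLp g (ENNReal.ofReal q) μ →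
      Λ (fun y => f y + g y) = Λ f + Λ g) {C : ℝ≥0∞} (hC : C ≠ ⊤)
    (hbound : ∀ f, MemLp f (ENNReal.ofReal q) μ → ‖Λ f‖ₑ ≤ C * eLpNorm f (ENNReal.ofReal q) μ) :
    ∃ m : ComplexMeasure α, ∀ A, MeasurableSet A →
      m A = Λ (A.indicator fun y => (ρ y : ℂ)) := by
  classical
  have hq := hpq.symm.pos
  have hmem : ∀ A, MeasurableSet A →
      MemLp (A.indicator fun y => (ρ y : ℂ)) (ENNReal.ofReal q) μ := fun A hA =>
    hρ.ofReal.indicator hA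
  have hzero : Λ (fun _ => 0) = 0 := by
    have := hadd (fun _ => 0) (fun _ => 0) MemLp.zero' MemLp.zero'
    simpa using this
  have hsum : ∀ (s : Finset ℕ) (f : ℕ → α → ℂ), (∀ i ∈ s, MemLp (f i) (ENNReal.ofReal q) μ) →
      Λ (fun y => ∑ i ∈ s, f i y) = ∑ i ∈ s, Λ (f i) := by
    intro s f hf
    induction s using Finset.induction_on with
    | empty => simpa using hzero
    | insert a s ha ih =>
      simp only [Finset.sum_insert ha]
      rw [hadd _ _ (hf a (by simp)) (memLp_finsetSum s fun i hi => hf i (by simp [hi])),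
        ih fun i hi => hf i (by simp [hi])]
  refine ⟨⟨fun A => if MeasurableSet A then Λ (A.indicator fun y => (ρ y : ℂ)) else 0, ?_, ?_, ?_⟩,
    fun A hA => if_pos hA⟩
  · simpa using hzero
  · intro A hA; exact if_neg hA
  · intro A hA hd
    have hU := MeasurableSet.iUnion hA
    simp only [hA, hU, if_true]
    rw [HasSum, ← tendsto_sub_nhds_zero_iff, tendsto_zero_iff_enorm_tendsto_zero]
    simp only [SummationFilter.unconditional_filter]
    -- Up to sign, `F s` is `ρ` restricted to the part of the union not yet covered by `s`. It is
    -- dominated by `|ρ|` and vanishes at each point as soon as `s` contains an index of a set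
    -- containing that point, so it tends to zero in `L_q`.
    let F : Finset ℕ → α → ℂ := fun s y =>
      (∑ i ∈ s, (A i).indicator (fun y => (ρ y : ℂ)) y) -
        (⋃ i, A i).indicator (fun y => (ρ y : ℂ)) y
    have hFU : ∀ s y, F s y = - ((⋃ i, A i) \ ⋃ i ∈ s, A i).indicator (fun y => (ρ y : ℂ)) y := by
      intro s y
      have h1 : ∑ i ∈ s, (A i).indicator (fun y => (ρ y : ℂ)) y =
          (⋃ i ∈ s, A i).indicator (fun y => (ρ y : ℂ)) y := by
        rw [Finset.indicator_biUnion]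
        exact fun i _ j _ hij => hd hij
      simp only [F, h1]
      have hsub : (⋃ i ∈ s, A i) ⊆ ⋃ i, A i := iUnion₂_subset fun i _ => subset_iUnion A i
      by_cases h2 : y ∈ ⋃ i ∈ s, A i
      · rw [indicator_of_mem h2, indicator_of_mem (hsub h2), indicator_of_notMem fun h => h.2 h2]
        simp
      · rw [indicator_of_notMem h2]
        by_cases h3 : y ∈ ⋃ i, A i
        · rw [indicator_of_mem h3, indicator_of_mem (show y ∈ _ \ _ from ⟨h3, h2⟩), zero_sub]
        · rw [indicator_of_notMem h3, indicator_of_notMem fun h => h3 h.1]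
          simp
    have hF0 : ∀ y, Tendsto (fun s => F s y) atTop (𝓝 0) := by
      intro y
      refine tendsto_const_nhds.congr' ?_
      by_cases hy : y ∈ ⋃ i, A i
      · obtain ⟨i, hi⟩ := mem_iUnion.1 hy
        filter_upwards [eventually_ge_atTop {i}] with s hs
        rw [hFU, indicator_of_notMem, neg_zero]
        exact fun h => h.2 (mem_biUnion (by simpa using hs) hi)
      · refine Eventually.of_forall fun s => ?_
        change 0 = F s y
        rw [hFU, indicator_of_notMem fun h => hy h.1, neg_zero]
    have hFm : ∀ s, MemLp (F s) (ENNReal.ofReal q) μ := fun s =>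
      (memLp_finsetSum s fun i _ => hmem _ (hA i)).sub (hmem _ hU)
    have hlim := tendsto_eLpNorm_zero (μ := μ) (l := atTop) hq (F := F) (G := fun y => ‖ρ y‖)
      (Eventually.of_forall fun s => ?_) hρ.norm (Eventually.of_forall fun s y => ?_) hF0
    rotate_left
    · refine Measurable.sub (Finset.measurable_sum _ fun i _ => ?_) ?_
      · exact (Complex.measurable_ofReal.comp hρm).indicator (hA i)
      · exact (Complex.measurable_ofReal.comp hρm).indicator hU
    · rw [hFU, norm_neg]
      exact (norm_indicator_le_norm_self _ _).trans (by simp)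
    refine tendsto_of_tendsto_of_tendsto_of_le_of_le tendsto_const_nhds
      (by simpa using ENNReal.Tendsto.const_mul hlim (Or.inr hC)) (fun s => zero_le) fun s => ?_
    have h2 : ∑ i ∈ s, Λ ((A i).indicator fun y => (ρ y : ℂ)) -
        Λ ((⋃ i, A i).indicator fun y => (ρ y : ℂ)) = Λ (F s) := by
      rw [← hsum s _ fun i _ => hmem _ (hA i), sub_eq_iff_eq_add, ← hadd _ _ (hFm s) (hmem _ hU)]
      simp [F]
    simp only [h2]
    exact hbound _ (hFm s)

/-- **Riesz representation** of the functionals on `L_q`, `1 < q < ∞`. -/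
theorem exists_memLp_of_functional [SigmaFinite μ] (hpq : p.HolderConjugate q)
    (Λ : (α → ℂ) → ℂ)
    (hadd : ∀ f g, MemLp f (ENNReal.ofReal q) μ → MemLp g (ENNReal.ofReal q) μ →
      Λ (fun y => f y + g y) = Λ f + Λ g)
    (hsmul : ∀ (c : ℂ) f, MemLp f (ENNReal.ofReal q) μ → Λ (fun y => c * f y) = c * Λ f)
    {C : ℝ≥0∞} (hC : C ≠ ⊤)
    (hbound : ∀ f, MemLp f (ENNReal.ofReal q) μ → ‖Λ f‖ₑ ≤ C * eLpNorm f (ENNReal.ofReal q) μ) :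
    ∃ h : α → ℂ, Measurable h ∧ eLpNorm h (ENNReal.ofReal p) μ ≤ C ∧
      ∀ f, Measurable f → MemLp f (ENNReal.ofReal q) μ → Λ f = ∫ y, f y * h y ∂μ := by
  have hp := hpq.pos
  have hq := hpq.symm.pos
  obtain ⟨g₀, hg₀, hg₀m, hg₀i⟩ := exists_pos_lintegral_lt_of_sigmaFinite μ one_ne_zero
  -- Indicators need not belong to `L_q` when `μ` is infinite; multiplication by a strictly positive
  -- `ρ` repairs this. As `ρ ≤ 1` and `q > 1`, `ρ^q ≤ ρ ≤ g₀`, which is integrable.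
  let ρ : α → ℝ := fun y => min (g₀ y : ℝ) 1
  have hρpos : ∀ y, 0 < ρ y := fun y => lt_min (by exact_mod_cast hg₀ y) one_pos
  have hρ1 : ∀ y, ρ y ≤ 1 := fun y => min_le_right _ _
  have hρm : Measurable ρ := (measurable_coe_nnreal_real.comp hg₀m).min measurable_const
  have hρle : ∀ y, ENNReal.ofReal (ρ y) ≤ g₀ y := fun y => by
    rw [← ENNReal.ofReal_coe_nnreal]
    exact ENNReal.ofReal_le_ofReal (min_le_left _ _)
  have hρLq : MemLp ρ (ENNReal.ofReal q) μ := by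
    refine ⟨hρm.aestronglyMeasurable, ?_⟩
    rw [eLpNorm_ofReal hq, ENNReal.rpow_lt_top_iff_of_pos (by positivity)]
    refine lt_of_le_of_lt (lintegral_mono fun y => ?_) (hg₀i.trans ENNReal.one_lt_top)
    rw [Real.enorm_of_nonneg (hρpos y).le]
    refine le_trans ?_ (hρle y)
    exact ENNReal.rpow_le_self_of_le_one (by simpa using hρ1 y) hpq.symm.lt.le
  obtain ⟨m, hm⟩ := exists_complexMeasure hpq hρm hρLq Λ hadd hC hbound
  -- A null set has an indicator of zero `L_q` norm, so the bound on `Λ` kills it and Radon–Nikodym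
  -- applies to the real and imaginary parts.
  have hac : m ≪ᵥ μ.toENNRealVectorMeasure := by
    refine VectorMeasure.AbsolutelyContinuous.mk fun A hA h0 => ?_
    rw [Measure.toENNRealVectorMeasure_apply_measurable hA] at h0
    rw [hm A hA, ← enorm_eq_zero]
    refine le_antisymm ((hbound _ (hρLq.ofReal.indicator hA)).trans ?_) zero_le
    have : eLpNorm (A.indicator fun y => (ρ y : ℂ)) (ENNReal.ofReal q) μ = 0 := by
      rw [eLpNorm_indicator_eq_eLpNorm_restrict hA, Measure.restrict_eq_zero.2 h0,
        eLpNorm_measure_zero]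
    simp [this]
  rw [ComplexMeasure.absolutelyContinuous_ennreal_iff] at hac
  have hre := (SignedMeasure.absolutelyContinuous_iff_withDensityᵥ_rnDeriv_eq _ _).1 hac.1
  have him := (SignedMeasure.absolutelyContinuous_iff_withDensityᵥ_rnDeriv_eq _ _).1 hac.2
  set gr := (ComplexMeasure.re m).rnDeriv μ with hgr
  set gi := (ComplexMeasure.im m).rnDeriv μ with hgi
  have hgrm : Measurable gr := SignedMeasure.measurable_rnDeriv _ _
  have hgim : Measurable gi := SignedMeasure.measurable_rnDeriv _ _
  have hgri : Integrable gr μ := SignedMeasure.integrable_rnDeriv _ _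
  have hgii : Integrable gi μ := SignedMeasure.integrable_rnDeriv _ _
  let g : α → ℂ := fun y => gr y + gi y * Complex.I
  have hgm : Measurable g := by fun_prop
  have hgint : Integrable g μ := hgri.ofReal.add (hgii.ofReal.mul_const _)
  have hmg : ∀ A, MeasurableSet A → Λ (A.indicator fun y => (ρ y : ℂ)) = ∫ y in A, g y ∂μ := by
    intro A hA
    have e1 : (m A).re = ∫ y in A, gr y ∂μ := by
      rw [← withDensityᵥ_apply hgri hA, hre]; rfl
    have e2 : (m A).im = ∫ y in A, gi y ∂μ := by
      rw [← withDensityᵥ_apply hgii hA, him]; rfl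
    rw [← hm A hA, ← Complex.re_add_im (m A), e1, e2]
    simp only [g]
    rw [integral_add hgri.ofReal.restrict (hgii.ofReal.mul_const _).restrict,
      integral_mul_const, integral_complex_ofReal, integral_complex_ofReal]
  have hsimple : ∀ s : SimpleFunc α ℂ, Λ (fun y => s y * ρ y) = ∫ y, s y * g y ∂μ := by
    intro s
    have hmemS : ∀ s : SimpleFunc α ℂ, MemLp (fun y => s y * (ρ y : ℂ)) (ENNReal.ofReal q) μ :=
      fun s => by
        obtain ⟨B, hB⟩ := s.exists_forall_norm_le
        exact memLp_mul_of_bounded hρLq s.measurable hB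
    have hintS : ∀ s : SimpleFunc α ℂ, Integrable (fun y => s y * g y) μ := fun s => by
      obtain ⟨B, hB⟩ := s.exists_forall_norm_le
      exact hgint.bdd_mul s.measurable.aestronglyMeasurable (ae_of_all _ hB)
    induction s using SimpleFunc.induction with
    | @const c A hA =>
      have h1 : (fun y => (SimpleFunc.piecewise A hA (SimpleFunc.const α c)
          (SimpleFunc.const α 0)) y * (ρ y : ℂ)) =
          fun y => c * A.indicator (fun y => (ρ y : ℂ)) y := by
        funext y; by_cases hy : y ∈ A <;> simp [hy]
      have h2 : (fun y => (SimpleFunc.piecewise A hA (SimpleFunc.const α c)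
          (SimpleFunc.const α 0)) y * g y) = A.indicator fun y => c * g y := by
        funext y; by_cases hy : y ∈ A <;> simp [hy]
      have h3 : MemLp (A.indicator fun y => (ρ y : ℂ)) (ENNReal.ofReal q) μ :=
        hρLq.ofReal.indicator hA
      rw [h1, h2, hsmul _ _ h3, hmg A hA, integral_indicator hA,
        integral_const_mul]
    | @add s t _ hs ht =>
      simp only [SimpleFunc.coe_add, Pi.add_apply, add_mul]
      rw [hadd _ _ (hmemS s) (hmemS t), hs, ht, integral_add (hintS s) (hintS t)]
  -- The density `g` represents `s ↦ Λ (s ρ)`; undoing the factor `ρ` gives the density of `Λ`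
  -- itself.
  let h : α → ℂ := fun y => g y / ρ y
  have hhm : Measurable h := by fun_prop
  have hρc : ∀ y, (ρ y : ℂ) ≠ 0 := fun y => by simpa using (hρpos y).ne'
  have hnorm : eLpNorm h (ENNReal.ofReal p) μ ≤ C := by
    -- On `{ρ ≥ 1/(n+1)}` the measure is finite by Markov's inequality, and `|h| ≤ (n + 1) |g|`
    -- makes `h` integrable.
    let S : ℕ → Set α := fun n => {y | 1 / ((n : ℝ) + 1) ≤ ρ y}
    have hS : ∀ n, MeasurableSet (S n) := fun n => measurableSet_le measurable_const hρm
    refine eLpNorm_le_of_simpleFunc_test hpq (S := S) hS ?_ ?_ ?_ hρm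
      (fun n => ⟨1 / ((n : ℝ) + 1), by positivity, fun y hy => hy⟩) hhm (fun n => ?_)
      fun n s _ => ?_
    · intro m n hmn y hy
      refine le_trans ?_ (show 1 / ((m : ℝ) + 1) ≤ ρ y from hy)
      have : (m : ℝ) ≤ n := by exact_mod_cast hmn
      gcongr
    · refine eq_univ_of_forall fun y => ?_
      obtain ⟨n, hn⟩ := exists_nat_one_div_lt (hρpos y)
      exact mem_iUnion.2 ⟨n, hn.le⟩
    · intro n
      have h1 := meas_ge_le_lintegral_div (μ := μ) (f := fun y => ENNReal.ofReal (ρ y))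
        hρm.ennreal_ofReal.aemeasurable (ε := ENNReal.ofReal (1 / ((n : ℝ) + 1)))
        (by simp only [ne_eq, ENNReal.ofReal_eq_zero, not_le]; positivity) ENNReal.ofReal_ne_top
      refine lt_of_le_of_lt (measure_mono fun y hy => ?_) (lt_of_le_of_lt h1 ?_)
      · exact ENNReal.ofReal_le_ofReal hy
      · refine ENNReal.div_lt_top ?_
          (by simp only [ne_eq, ENNReal.ofReal_eq_zero, not_le]; positivity)
        exact ((lintegral_mono hρle).trans_lt (hg₀i.trans ENNReal.one_lt_top)).ne
    · refine Integrable.mono' (g := fun y => ((n : ℝ) + 1) * ‖g y‖)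
        (hgint.norm.const_mul _).integrableOn hhm.aestronglyMeasurable ?_
      refine (ae_restrict_iff' (hS n)).2 (ae_of_all _ fun y hy => ?_)
      have hy' : 1 / ((n : ℝ) + 1) ≤ ρ y := hy
      simp only [h, norm_div, Complex.norm_real, Real.norm_eq_abs, abs_of_pos (hρpos y)]
      rw [div_le_iff₀ (hρpos y), mul_right_comm]
      have : 1 ≤ ((n : ℝ) + 1) * ρ y := by
        rw [div_le_iff₀ (by positivity)] at hy'; linarith
      nlinarith [norm_nonneg (g y)]
    · have : (∫ y, h y * (s y * ρ y) ∂μ) = Λ (fun y => s y * ρ y) := by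
        rw [hsimple]
        congr 1; funext y
        have := hρc y
        simp only [h]; field_simp
      rw [this]
      obtain ⟨B, hB⟩ := s.exists_forall_norm_le
      exact hbound _ (memLp_mul_of_bounded hρLq s.measurable hB)
  refine ⟨h, hhm, hnorm, fun f hfm hf => ?_⟩
  have hh : MemLp h (ENNReal.ofReal p) μ :=
    ⟨hhm.aestronglyMeasurable, hnorm.trans_lt hC.lt_top⟩
  -- Simple approximations `s_k` of `f / ρ` give `s_k ρ → f` with `|s_k ρ| ≤ 2 |f|`. Both `Λ` and
  -- integration against `h` are continuous along this sequence, and they agree on `s_k ρ`.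
  have hb' : Measurable fun y => f y / ρ y := by fun_prop
  let s : ℕ → SimpleFunc α ℂ := fun k =>
    SimpleFunc.approxOn (fun y => f y / ρ y) hb' univ 0 (mem_univ 0) k
  have hs_le : ∀ k y, ‖s k y * ρ y‖ ≤ 2 * ‖f y‖ := fun k y => by
    have h1 := SimpleFunc.norm_approxOn_zero_le hb' (mem_univ (0 : ℂ)) y k
    have h2 : ‖f y / ρ y‖ * ‖(ρ y : ℂ)‖ = ‖f y‖ := by
      rw [← norm_mul, div_mul_cancel₀ _ (hρc y)]
    rw [norm_mul]
    calc _ ≤ (‖f y / ρ y‖ + ‖f y / ρ y‖) * ‖(ρ y : ℂ)‖ := by gcongr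
      _ = _ := by linear_combination 2 * h2
  have hs_lim : ∀ y, Tendsto (fun k => s k y * ρ y) atTop (𝓝 (f y)) := fun y => by
    have := (SimpleFunc.tendsto_approxOn hb' (mem_univ (0 : ℂ)) (x := y) (by simp)).mul_const
      (ρ y : ℂ)
    rwa [div_mul_cancel₀ _ (hρc y)] at this
  have hsm : ∀ k, Measurable fun y => s k y * (ρ y : ℂ) := fun k => by
    have := (s k).measurable
    fun_prop
  have hsmem : ∀ k, MemLp (fun y => s k y * (ρ y : ℂ)) (ENNReal.ofReal q) μ := fun k =>
    hf.of_le_mul (c := 2) (hsm k).aestronglyMeasurable (ae_of_all _ (hs_le k))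
  have L1 : Tendsto (fun k => Λ (fun y => s k y * ρ y)) atTop (𝓝 (Λ f)) := by
    rw [← tendsto_sub_nhds_zero_iff, tendsto_zero_iff_enorm_tendsto_zero]
    have hlim := tendsto_eLpNorm_zero (μ := μ) (l := atTop) hq
      (F := fun k y => s k y * ρ y - f y) (G := fun y => 3 * ‖f y‖)
      (Eventually.of_forall fun k => (hsm k).sub hfm) (hf.norm.const_mul 3)
      (Eventually.of_forall fun k y => ?_) fun y => ?_
    · refine tendsto_of_tendsto_of_tendsto_of_le_of_le tendsto_const_nhds
        (by simpa using ENNReal.Tendsto.const_mul hlim (Or.inr hC)) (fun s => zero_le) fun k => ?_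
      have hd : MemLp (fun y => s k y * (ρ y : ℂ) - f y) (ENNReal.ofReal q) μ := (hsmem k).sub hf
      have : Λ (fun y => s k y * ρ y) - Λ f = Λ (fun y => s k y * ρ y - f y) := by
        rw [sub_eq_iff_eq_add, ← hadd _ _ hd hf]
        simp
      simp only [this]
      exact hbound _ hd
    · calc _ ≤ ‖s k y * ρ y‖ + ‖f y‖ := norm_sub_le _ _
        _ ≤ 2 * ‖f y‖ + ‖f y‖ := by gcongr; exact hs_le k y
        _ = _ := by ring
    · simpa using (hs_lim y).sub_const (f y)
  have L2 : Tendsto (fun k => Λ (fun y => s k y * ρ y)) atTop (𝓝 (∫ y, f y * h y ∂μ)) := by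
    have := hpq.symm.ennrealOfReal
    have e : ∀ k, Λ (fun y => s k y * ρ y) = ∫ y, (s k y * ρ y) * h y ∂μ := fun k => by
      rw [hsimple]
      congr 1; funext y
      have := hρc y
      simp only [h]; field_simp
    simp only [e]
    refine tendsto_integral_of_dominated_convergence (fun y => 2 * ‖f y * h y‖)
      (fun k => ((hsm k).mul hhm).aestronglyMeasurable) ?_ (fun k => ae_of_all _ fun y => ?_)
      (ae_of_all _ fun y => (hs_lim y).mul_const _)
    · exact (MemLp.integrable_mul hf hh).norm.const_mul 2
    · rw [norm_mul, norm_mul (f y), ← mul_assoc]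
      gcongr
      exact hs_le k y
  exact tendsto_nhds_unique L1 L2

end Riesz

end RefinedBesov

namespace RefinedBesov

/-! ### The `L_p` norm of a tempered distribution -/

section LpDistribution

variable {d : ℕ} {p q : ℝ}

theorem enorm_integral_mul_le {α : Type*} [MeasurableSpace α] {μ : Measure α}
    (hpq : p.HolderConjugate q) {f h : α → ℂ} (hf : AEStronglyMeasurable f μ)
    (hh : AEStronglyMeasurable h μ) :
    ‖∫ x, f x * h x ∂μ‖ₑ ≤ eLpNorm h (ENNReal.ofReal p) μ * eLpNorm f (ENNReal.ofReal q) μ := by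
  have := hpq.symm.ennrealOfReal
  calc _ ≤ ∫⁻ x, ‖f x * h x‖ₑ ∂μ := enorm_integral_le_lintegral_enorm _
    _ = eLpNorm (f • h) 1 μ := by rw [eLpNorm_one_eq_lintegral_enorm]; rfl
    _ ≤ eLpNorm f (ENNReal.ofReal q) μ * eLpNorm h (ENNReal.ofReal p) μ :=
        eLpNorm_smul_le_mul_eLpNorm hh hf
    _ = _ := mul_comm _ _

theorem eLpNorm_schwartz_ne_top (f : 𝓢(Eu d, ℂ)) (r : ℝ≥0∞) : eLpNorm f r volume ≠ ⊤ :=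
  (f.memLp r volume).2.ne

/-- Hölder's inequality for each representing function, followed by the infimum. No representative
is needed: without one the right-hand side is infinite unless `f = 0`. -/
theorem enorm_apply_le_lpENorm (hpq : p.HolderConjugate q) (w : 𝓢'(Eu d, ℂ)) (f : 𝓢(Eu d, ℂ)) :
    ‖w f‖ₑ ≤ lpENorm p w * eLpNorm f (ENNReal.ofReal q) volume := by
  rcases eq_or_ne f 0 with rfl | hf
  · simp
  have h0 : eLpNorm f (ENNReal.ofReal q) volume ≠ 0 := by
    rw [Ne, eLpNorm_eq_zero_iff f.continuous.aestronglyMeasurable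
      (ofReal_ne_zero_of_conj hpq.symm), f.continuous.ae_eq_iff_eq volume continuous_zero]
    exact fun h => hf (SchwartzMap.ext fun x => congrFun h x)
  rw [← ENNReal.div_le_iff h0 (eLpNorm_schwartz_ne_top f _)]
  refine le_iInf fun h => le_iInf fun hh => le_iInf fun hw => ?_
  rw [ENNReal.div_le_iff h0 (eLpNorm_schwartz_ne_top f _), hw f]
  exact enorm_integral_mul_le hpq f.continuous.aestronglyMeasurable hh.1

/-- A tempered distribution that is bounded in the `L_q` norm is given by an `L_p` function. -/
theorem exists_rep_of_bound (hpq : p.HolderConjugate q) {w : 𝓢'(Eu d, ℂ)} {C : ℝ≥0∞}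
    (hC : C ≠ ⊤) (H : ∀ f : 𝓢(Eu d, ℂ), ‖w f‖ₑ ≤ C * eLpNorm f (ENNReal.ofReal q) volume) :
    ∃ h : Eu d → ℂ, Measurable h ∧ eLpNorm h (ENNReal.ofReal p) volume ≤ C ∧
      ∀ f : 𝓢(Eu d, ℂ), w f = ∫ x, f x * h x := by
  have := fact_one_le_ofReal hpq.symm
  let e : 𝓢(Eu d, ℂ) →ₗ[ℂ] Lp ℂ (ENNReal.ofReal q) (volume : Measure (Eu d)) :=
    (SchwartzMap.toLpCLM ℂ ℂ (ENNReal.ofReal q) volume).toLinearMap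
  let w' : 𝓢(Eu d, ℂ) →ₗ[ℂ] ℂ := w.toLinearMap
  -- Schwartz functions are dense in `L_q` for `q < ∞`, so `w` extends to a bounded functional on
  -- `L_q`, to which Riesz representation applies.
  have he : DenseRange e := SchwartzMap.denseRange_toLpCLM (F := ℂ) ENNReal.ofReal_ne_top
  have hn : ∀ f, ‖w' f‖ ≤ C.toReal * ‖e f‖ := fun f => by
    have h1 := H f
    have h2 : ‖e f‖ = (eLpNorm f (ENNReal.ofReal q) volume).toReal := SchwartzMap.norm_toLp
    rw [h2, ← ENNReal.toReal_mul, ← toReal_enorm]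
    exact ENNReal.toReal_mono (ENNReal.mul_ne_top hC (eLpNorm_schwartz_ne_top f _)) h1
  let Λ' := w'.extendOfNorm e
  have hΛ' : ∀ f, Λ' (e f) = w f := LinearMap.extendOfNorm_eq he ⟨_, hn⟩
  have hΛn : ∀ x, ‖Λ' x‖ ≤ C.toReal * ‖x‖ :=
    LinearMap.norm_extendOfNorm_apply_le he C.toReal hn
  classical
  let Λ : (Eu d → ℂ) → ℂ := fun f =>
    if hf : MemLp f (ENNReal.ofReal q) volume then Λ' (hf.toLp f) else 0
  have hΛ : ∀ f (hf : MemLp f (ENNReal.ofReal q) volume), Λ f = Λ' (hf.toLp f) := fun f hf =>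
    dif_pos hf
  obtain ⟨h, hm, hh, hrep⟩ := exists_memLp_of_functional (μ := (volume : Measure (Eu d))) hpq Λ
    (fun f g hf hg => by
      have h : MemLp (fun y => f y + g y) (ENNReal.ofReal q) volume := hf.add hg
      rw [hΛ _ hf, hΛ _ hg, hΛ _ h, ← map_add]; rfl)
    (fun c f hf => by
      have h : MemLp (fun y => c * f y) (ENNReal.ofReal q) volume := hf.const_smul c
      rw [hΛ _ hf, hΛ _ h, ← smul_eq_mul, ← map_smul]; rfl) hC
    (fun f hf => by
      rw [hΛ _ hf, ← Lp.enorm_toLp hf]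
      have := hΛn (hf.toLp f)
      rw [← ENNReal.ofReal_toReal hC, ← ofReal_norm, ← ofReal_norm,
        ← ENNReal.ofReal_mul ENNReal.toReal_nonneg]
      exact ENNReal.ofReal_le_ofReal this)
  refine ⟨h, hm, hh, fun f => ?_⟩
  rw [← hΛ' f, ← hrep f f.continuous.measurable (f.memLp (ENNReal.ofReal q) volume),
    hΛ _ (f.memLp (ENNReal.ofReal q) volume)]
  rfl

/-- Together with `enorm_apply_le_lpENorm` this identifies `lpENorm` with the dual norm on Schwartz
functions, which turns estimates of blocks into estimates of operators on test functions. -/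
theorem lpENorm_le_of_bound (hpq : p.HolderConjugate q) {w : 𝓢'(Eu d, ℂ)} {C : ℝ≥0∞}
    (H : ∀ f : 𝓢(Eu d, ℂ), ‖w f‖ₑ ≤ C * eLpNorm f (ENNReal.ofReal q) volume) :
    lpENorm p w ≤ C := by
  rcases eq_or_ne C ⊤ with rfl | hC
  · exact le_top
  obtain ⟨h, hm, hh, hrep⟩ := exists_rep_of_bound hpq hC H
  have hmem : MemLp h (ENNReal.ofReal p) volume :=
    ⟨hm.aestronglyMeasurable, hh.trans_lt hC.lt_top⟩
  refine le_trans ?_ hh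
  exact iInf_le_of_le h (iInf_le_of_le hmem (iInf_le_of_le hrep le_rfl))

theorem exists_rep (hpq : p.HolderConjugate q) {w : 𝓢'(Eu d, ℂ)} (hw : lpENorm p w ≠ ⊤) :
    ∃ h : Eu d → ℂ, Measurable h ∧ eLpNorm h (ENNReal.ofReal p) volume = lpENorm p w ∧
      MemLp h (ENNReal.ofReal p) volume ∧ ∀ f : 𝓢(Eu d, ℂ), w f = ∫ x, f x * h x := by
  obtain ⟨h, hm, hh, hrep⟩ := exists_rep_of_bound hpq hw (enorm_apply_le_lpENorm hpq w)
  have hmem : MemLp h (ENNReal.ofReal p) volume :=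
    ⟨hm.aestronglyMeasurable, hh.trans_lt hw.lt_top⟩
  exact ⟨h, hm, le_antisymm hh (iInf_le_of_le h (iInf_le_of_le hmem (iInf_le_of_le hrep le_rfl))),
    hmem, hrep⟩

theorem lpENorm_isSubadditive (hpq : p.HolderConjugate q) :
    IsSubadditive (lpENorm p : 𝓢'(Eu d, ℂ) → ℝ≥0∞) := by
  refine ⟨le_antisymm (lpENorm_le_of_bound hpq fun f => by simp) zero_le, fun u v => ?_⟩
  refine lpENorm_le_of_bound hpq fun f => ?_
  rw [add_mul]
  exact (enorm_add_le (u f) (v f)).trans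
    (add_le_add (enorm_apply_le_lpENorm hpq u f) (enorm_apply_le_lpENorm hpq v f))

end LpDistribution

/-! ### Weighted sequence spaces -/

section Sequences

variable {p q : ℝ}

/-- The norm of the weighted sequence space that enters the definition of `B^{s,φ}_p`. -/
noncomputable def seqENorm (p : ℝ) (W : ℕ → ℝ) (a : ℕ → ℝ≥0∞) : ℝ≥0∞ :=
  (∑' k : ℕ, (ENNReal.ofReal (W k) * a k) ^ p) ^ (1 / p)

theorem seqENorm_mono (hp : 0 < p) (W : ℕ → ℝ) {a b : ℕ → ℝ≥0∞} (h : ∀ k, a k ≤ b k) :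
    seqENorm p W a ≤ seqENorm p W b := by
  refine ENNReal.rpow_le_rpow (ENNReal.tsum_le_tsum fun k => ?_) (by positivity)
  gcongr
  exact h k

theorem seqENorm_add_le (hp : 1 ≤ p) (W : ℕ → ℝ) (a b : ℕ → ℝ≥0∞) :
    seqENorm p W (fun k => a k + b k) ≤ seqENorm p W a + seqENorm p W b := by
  simp only [seqENorm, ← lintegral_count, mul_add]
  exact ENNReal.lintegral_Lp_add_le (f := fun k => ENNReal.ofReal (W k) * a k)
    (g := fun k => ENNReal.ofReal (W k) * b k) (Measurable.of_discrete).aemeasurable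
    (Measurable.of_discrete).aemeasurable hp

theorem weight_mul_le_seqENorm (hp : 0 < p) (W : ℕ → ℝ) (a : ℕ → ℝ≥0∞) (k : ℕ) :
    ENNReal.ofReal (W k) * a k ≤ seqENorm p W a := by
  calc _ = ((ENNReal.ofReal (W k) * a k) ^ p) ^ (1 / p) := by
        rw [← ENNReal.rpow_mul, mul_one_div_cancel hp.ne', ENNReal.rpow_one]
    _ ≤ _ := ENNReal.rpow_le_rpow (ENNReal.le_tsum k) (by positivity)

theorem sum_range_two_inv_pow_le (j : ℕ) :
    ∑ k ∈ Finset.range j, (2⁻¹ : ℝ≥0∞) ^ (j - k) ≤ 1 := by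
  induction j with
  | zero => simp
  | succ j ih =>
    rw [Finset.sum_range_succ]
    have h : ∀ k ∈ Finset.range j, (2⁻¹ : ℝ≥0∞) ^ (j + 1 - k) = 2⁻¹ * (2⁻¹ : ℝ≥0∞) ^ (j - k) :=
      fun k hk => by
        rw [← pow_succ', Nat.succ_sub (Finset.mem_range.1 hk).le]
    rw [Finset.sum_congr rfl h, ← Finset.mul_sum, Nat.add_sub_cancel_left, pow_one]
    calc _ ≤ (2⁻¹ : ℝ≥0∞) * 1 + 2⁻¹ := by gcongr
      _ = 1 := by rw [mul_one, ENNReal.inv_two_add_inv_two]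

theorem tsum_two_inv_pow_dist_le (j : ℕ) :
    ∑' k : ℕ, (2⁻¹ : ℝ≥0∞) ^ ((j - k) + (k - j)) ≤ 4 := by
  have h0 : ∑ k ∈ Finset.range j, (2⁻¹ : ℝ≥0∞) ^ ((j - k) + (k - j)) =
      ∑ k ∈ Finset.range j, (2⁻¹ : ℝ≥0∞) ^ (j - k) := Finset.sum_congr rfl fun k hk => by
    rw [Nat.sub_eq_zero_of_le (Finset.mem_range.1 hk).le, add_zero]
  have h2 : ∑' k : ℕ, (2⁻¹ : ℝ≥0∞) ^ ((j - (k + j)) + (k + j - j)) = 2 := by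
    have : ∀ k : ℕ, (2⁻¹ : ℝ≥0∞) ^ ((j - (k + j)) + (k + j - j)) = 2⁻¹ ^ k := fun k => by
      rw [Nat.sub_eq_zero_of_le (Nat.le_add_left j k), zero_add, Nat.add_sub_cancel]
    simp only [this, ENNReal.tsum_geometric, ENNReal.one_sub_inv_two, inv_inv]
  have h3 := Summable.sum_add_tsum_nat_add' (f := fun k : ℕ =>
    (2⁻¹ : ℝ≥0∞) ^ ((j - k) + (k - j))) (k := j) ENNReal.summable
  rw [← h3, h0, h2]
  calc _ ≤ (1 : ℝ≥0∞) + 2 := by gcongr; exact sum_range_two_inv_pow_le j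
    _ = 3 := by norm_num
    _ ≤ 4 := by norm_num

/-- A matrix that decays fast enough off the diagonal acts in weighted sequence spaces. -/
theorem seqENorm_le_of_almost_diagonal (hpq : p.HolderConjugate q) {W : ℕ → ℝ} {D : ℝ}
    (hW : IsSlowWeight W D) {N : ℕ} (hN : 2 * D ≤ 2 ^ N) {C : ℝ≥0∞} {a b : ℕ → ℝ≥0∞}
    (h : ∀ j, b j ≤ ∑' k, C * 2⁻¹ ^ (N * ((j - k) + (k - j))) * a k) :
    seqENorm p W b ≤ 4 * C * seqENorm p W a := by
  have hp := hpq.pos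
  have hD0 : 0 ≤ D := zero_le_one.trans hW.one_le
  have key : ∀ j, ENNReal.ofReal (W j) * b j ≤
      ∑' k, C * 2⁻¹ ^ ((j - k) + (k - j)) * (ENNReal.ofReal (W k) * a k) := by
    intro j
    refine (mul_le_mul_right (h j) _).trans ?_
    rw [← ENNReal.tsum_mul_left]
    refine ENNReal.tsum_le_tsum fun k => ?_
    set n := (j - k) + (k - j) with hn
    -- Moving the weight from level `j` to level `k` costs at most `D^n`. As `2 D ≤ 2^N`, the decay
    -- `2^{-Nn}` absorbs it and still leaves `2^{-n}`.
    have h1 : ENNReal.ofReal (W j) * 2⁻¹ ^ (N * n) ≤ 2⁻¹ ^ n * ENNReal.ofReal (W k) := by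
      have e2 : (2⁻¹ : ℝ≥0∞) = ENNReal.ofReal 2⁻¹ := by
        rw [ENNReal.ofReal_inv_of_pos two_pos]; simp
      rw [e2, ← ENNReal.ofReal_pow (by positivity), ← ENNReal.ofReal_pow (by positivity),
        ← ENNReal.ofReal_mul (hW.pos j).le, ← ENNReal.ofReal_mul (by positivity)]
      refine ENNReal.ofReal_le_ofReal ?_
      have h3 : D ^ n * (2⁻¹ : ℝ) ^ (N * n) ≤ 2⁻¹ ^ n := by
        rw [pow_mul, ← mul_pow]
        gcongr
        rw [inv_pow, ← div_eq_mul_inv, div_le_iff₀ (by positivity)]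
        linarith
      calc W j * 2⁻¹ ^ (N * n) ≤ (D ^ n * W k) * 2⁻¹ ^ (N * n) := by
            gcongr; exact hW.le_pow j k
        _ = (D ^ n * 2⁻¹ ^ (N * n)) * W k := by ring
        _ ≤ _ := by
            have := (hW.pos k).le
            gcongr
    calc _ = C * (ENNReal.ofReal (W j) * 2⁻¹ ^ (N * n)) * a k := by ring
      _ ≤ C * (2⁻¹ ^ n * ENNReal.ofReal (W k)) * a k := by gcongr
      _ = _ := by ring
  -- Schur's test with counting measures: the rows and columns of `2^{-|j-k|}` sum to at most `4`.
  have hs := schur_test (μ := (Measure.count : Measure ℕ)) (ν := (Measure.count : Measure ℕ))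
    hpq (κ := fun j k => C * 2⁻¹ ^ ((j - k) + (k - j))) Measurable.of_discrete
    (g := fun k => ENNReal.ofReal (W k) * a k) Measurable.of_discrete (A := 4 * C)
    (fun j => by
      rw [lintegral_count, ENNReal.tsum_mul_left, mul_comm]
      gcongr; exact tsum_two_inv_pow_dist_le j)
    (fun k => by
      rw [lintegral_count, ENNReal.tsum_mul_left, mul_comm]
      gcongr; simpa only [add_comm] using tsum_two_inv_pow_dist_le k)
  simp only [lintegral_count] at hs
  refine le_trans (ENNReal.rpow_le_rpow (ENNReal.tsum_le_tsum fun j => ?_) (by positivity)) hs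
  exact ENNReal.rpow_le_rpow (key j) hp.le

end Sequences

/-- The dyadic blocks of a tempered distribution. -/
noncomputable def block {d : ℕ} (β₀ : Eu d → ℂ) (k : ℕ) : 𝓢'(Eu d, ℂ) →L[ℂ] 𝓢'(Eu d, ℂ) :=
  TemperedDistribution.fourierMultiplierCLM ℂ (dyadic β₀ k)

theorem besovENorm_eq {d : ℕ} (β₀ : Eu d → ℂ) (s : ℝ) (φ : ℝ → ℝ) (p : ℝ) (w : 𝓢'(Eu d, ℂ)) :
    besovENorm β₀ s φ p w = seqENorm p (weight s φ) fun k => lpENorm p (block β₀ k w) := rfl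

theorem besovENorm_isSubadditive {d : ℕ} {p q : ℝ} (hpq : p.HolderConjugate q) (β₀ : Eu d → ℂ)
    (s : ℝ) (φ : ℝ → ℝ) : IsSubadditive (besovENorm β₀ s φ p) := by
  have h := lpENorm_isSubadditive (d := d) hpq
  have hp := hpq.pos
  refine ⟨?_, fun u v => ?_⟩
  · simp [besovENorm_eq, seqENorm, h.zero, hp]
  · simp only [besovENorm_eq, map_add]
    exact (seqENorm_mono hp _ fun k => h.add _ _).trans (seqENorm_add_le hpq.lt.le _ _ _)

end RefinedBesov

namespace RefinedBesov

open scoped FourierTransform LineDeriv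

/-! ### Fourier multipliers on the Schwartz space -/

section Multipliers

variable {d : ℕ} {p q : ℝ}

/-- The reflection `f ↦ f (-x)`. -/
noncomputable def reflect : 𝓢(Eu d, ℂ) →L[ℂ] 𝓢(Eu d, ℂ) :=
  SchwartzMap.compCLMOfContinuousLinearEquiv ℂ
    (LinearIsometryEquiv.neg ℝ (E := Eu d)).toContinuousLinearEquiv

theorem reflect_apply (f : 𝓢(Eu d, ℂ)) (x : Eu d) : reflect f x = f (-x) := rfl

theorem reflect_reflect (f : 𝓢(Eu d, ℂ)) : reflect (reflect f) = f := by
  ext x; simp [reflect_apply]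

theorem fourierInv_eq_reflect (f : 𝓢(Eu d, ℂ)) : 𝓕⁻ f = reflect (𝓕 f) := rfl

theorem fourier_reflect (f : 𝓢(Eu d, ℂ)) : 𝓕 (reflect f) = 𝓕⁻ f := by
  have h1 : reflect f = 𝓕⁻ (𝓕⁻ f : 𝓢(Eu d, ℂ)) := by
    have h2 : 𝓕 (𝓕⁻ f : 𝓢(Eu d, ℂ)) = f := FourierTransform.fourier_fourierInv_eq f
    rw [fourierInv_eq_reflect (𝓕⁻ f), h2]
  rw [h1]
  exact FourierTransform.fourier_fourierInv_eq (𝓕⁻ f : 𝓢(Eu d, ℂ))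

/-- The pointwise product of Schwartz functions. -/
noncomputable def smulS (m : 𝓢(Eu d, ℂ)) : 𝓢(Eu d, ℂ) →L[ℂ] 𝓢(Eu d, ℂ) :=
  SchwartzMap.smulLeftCLM ℂ m

theorem smulS_apply (m f : 𝓢(Eu d, ℂ)) (x : Eu d) : smulS m f x = m x * f x :=
  SchwartzMap.smulLeftCLM_apply_apply m.hasTemperateGrowth f x

/-- The operator on test functions whose transpose is the Fourier multiplier with symbol `m`. -/
noncomputable def mult (m : 𝓢(Eu d, ℂ)) : 𝓢(Eu d, ℂ) →L[ℂ] 𝓢(Eu d, ℂ) :=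
  FourierTransform.fourierCLM ℂ 𝓢(Eu d, ℂ) ∘L smulS m ∘L FourierTransform.fourierInvCLM ℂ 𝓢(Eu d, ℂ)

theorem mult_apply (m f : 𝓢(Eu d, ℂ)) : mult m f = 𝓕 (smulS m (𝓕⁻ f)) := rfl

/-- Reflection intertwines `𝓕` and `𝓕⁻¹`. This second form of the multiplier gives both the
transposition formula and the convolution kernel. -/
theorem mult_apply_eq_fourierInv (m f : 𝓢(Eu d, ℂ)) :
    mult m f = 𝓕⁻ (smulS (reflect m) (𝓕 f)) := by
  have h : smulS m (𝓕⁻ f) = reflect (smulS (reflect m) (𝓕 f)) := by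
    ext x
    simp [smulS_apply, reflect_apply, fourierInv_eq_reflect]
  rw [mult_apply, h, fourier_reflect]

theorem mult_add (m n f : 𝓢(Eu d, ℂ)) : mult (m + n) f = mult m f + mult n f := by
  have h : smulS (m + n) (𝓕⁻ f) = smulS m (𝓕⁻ f) + smulS n (𝓕⁻ f) := by
    ext x; simp [smulS_apply, add_mul]
  rw [mult_apply, h, FourierTransform.fourier_add]; rfl

theorem mult_smul (c : ℂ) (m f : 𝓢(Eu d, ℂ)) : mult (c • m) f = c • mult m f := by
  have h : smulS (c • m) (𝓕⁻ f) = c • smulS m (𝓕⁻ f) := by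
    ext x; simp [smulS_apply, mul_assoc]
  rw [mult_apply, h, FourierTransform.fourier_smul]; rfl

theorem mult_zero (f : 𝓢(Eu d, ℂ)) : mult 0 f = 0 := by
  simpa using mult_smul 0 0 f

theorem mult_sum {ι : Type*} (s : Finset ι) (m : ι → 𝓢(Eu d, ℂ)) (f : 𝓢(Eu d, ℂ)) :
    mult (∑ i ∈ s, m i) f = ∑ i ∈ s, mult (m i) f := by
  classical
  induction s using Finset.induction_on with
  | empty => simp [mult_zero]
  | insert a s ha ih => rw [Finset.sum_insert ha, Finset.sum_insert ha, mult_add, ih]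

theorem mult_mult (m n f : 𝓢(Eu d, ℂ)) : mult m (mult n f) = mult (smulS m n) f := by
  rw [mult_apply, mult_apply n, FourierTransform.fourierInv_fourier_eq, mult_apply]
  congr 1
  ext x; simp [smulS_apply, mul_assoc]

/-- The transpose of a multiplier is the multiplier with the reflected symbol. -/
theorem integral_mult_mul (m f g : 𝓢(Eu d, ℂ)) :
    ∫ x, mult m f x * g x = ∫ x, f x * mult (reflect m) g x := by
  rw [mult_apply, SchwartzMap.integral_fourier_mul_eq, mult_apply_eq_fourierInv, reflect_reflect,
    ← SchwartzMap.integral_fourierInv_mul_eq]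
  congr 1; funext x
  simp only [smulS_apply]; ring

theorem mult_apply_eq_integral (m f : 𝓢(Eu d, ℂ)) (x : Eu d) :
    mult m f x = ∫ y, 𝓕 m (x - y) * f y := by
  have h : mult m f = SchwartzMap.convolution (ContinuousLinearMap.mul ℂ ℂ) (𝓕 m) f := by
    have h1 : SchwartzMap.convolution (ContinuousLinearMap.mul ℂ ℂ) (𝓕 m) f =
        𝓕⁻ (𝓕 (SchwartzMap.convolution (ContinuousLinearMap.mul ℂ ℂ) (𝓕 m) f) : 𝓢(Eu d, ℂ)) :=
      (FourierTransform.fourierInv_fourier_eq _).symm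
    rw [h1, SchwartzMap.fourier_convolution, mult_apply_eq_fourierInv]
    congr 1
    ext x
    rw [smulS_apply, SchwartzMap.pairing_apply_apply, ContinuousLinearMap.mul_apply']
    congr 2
    have h2 : 𝓕 (𝓕 m : 𝓢(Eu d, ℂ)) = reflect m := by
      have h3 : 𝓕 m = 𝓕⁻ (reflect m) := by
        rw [fourierInv_eq_reflect, fourier_reflect, fourierInv_eq_reflect, reflect_reflect]
      rw [h3]
      exact FourierTransform.fourier_fourierInv_eq (reflect m)
    rw [h2]
  rw [h, SchwartzMap.convolution_apply, convolution_eq_swap]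
  rfl

/-- Young's inequality as a case of Schur's test: each row and each column of the kernel `|𝓕 m (x -
y)|` integrates to the `L_1` norm of `𝓕 m`. -/
theorem eLpNorm_mult_le (hpq : p.HolderConjugate q) (m f : 𝓢(Eu d, ℂ)) :
    eLpNorm (mult m f) (ENNReal.ofReal p) volume ≤
      (∫⁻ x, ‖𝓕 m x‖ₑ) * eLpNorm f (ENNReal.ofReal p) volume := by
  have hp := hpq.pos
  rw [eLpNorm_ofReal hp, eLpNorm_ofReal hp]
  have hm : Measurable fun z : Eu d => ‖𝓕 m z‖ₑ := (𝓕 m).continuous.measurable.enorm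
  refine le_trans (ENNReal.rpow_le_rpow (lintegral_mono fun x => ?_) (by positivity))
    (schur_test hpq (κ := fun x y => ‖𝓕 m (x - y)‖ₑ) (g := fun y => ‖f y‖ₑ)
      (hm.comp (measurable_fst.sub measurable_snd)) f.continuous.measurable.enorm
      (fun x => ?_) fun y => ?_)
  · refine ENNReal.rpow_le_rpow ?_ hp.le
    rw [mult_apply_eq_integral]
    refine (enorm_integral_le_lintegral_enorm _).trans (le_of_eq ?_)
    simp only [enorm_mul]
  · rw [lintegral_sub_left_eq_self (fun z => ‖𝓕 m z‖ₑ) x]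
  · rw [lintegral_sub_right_eq_self (fun z => ‖𝓕 m z‖ₑ) y]

/-- The dilation `m (2 ^ (-k) x)`. -/
noncomputable def dil (k : ℕ) : 𝓢(Eu d, ℂ) →L[ℂ] 𝓢(Eu d, ℂ) :=
  SchwartzMap.compCLMOfContinuousLinearEquiv ℂ
    (ContinuousLinearEquiv.smulLeft (Units.mk0 (((2 : ℝ) ^ k)⁻¹) (by positivity)))

theorem dil_apply (k : ℕ) (m : 𝓢(Eu d, ℂ)) (x : Eu d) : dil k m x = m (((2 : ℝ) ^ k)⁻¹ • x) := rfl

theorem fourier_dil (k : ℕ) (m : 𝓢(Eu d, ℂ)) (x : Eu d) :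
    𝓕 (dil k m) x = ((((2 : ℝ) ^ k) ^ d : ℝ) : ℂ) * 𝓕 m ((2 : ℝ) ^ k • x) := by
  have h0 : (2 : ℝ) ^ k ≠ 0 := by positivity
  rw [SchwartzMap.fourier_coe, SchwartzMap.fourier_coe, Real.fourier_eq, Real.fourier_eq]
  have h := Measure.integral_comp_smul (volume : Measure (Eu d))
    (fun v => Real.fourierChar (-inner ℝ v ((2 : ℝ) ^ k • x)) • m v) (((2 : ℝ) ^ k)⁻¹)
  simp only [finrank_euclideanSpace_fin, inv_pow, inv_inv] at h
  rw [abs_of_pos (by positivity)] at h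
  rw [← Complex.real_smul, ← h]
  congr 1; funext v
  rw [dil_apply, inner_smul_left, inner_smul_right]
  simp [h0]

/-- The dilation of the symbol is an `L_1`-normalized dilation of the kernel. Hence the multipliers
`dil k m` are bounded in `L_p` uniformly in `k`. -/
theorem lintegral_fourier_dil (k : ℕ) (m : 𝓢(Eu d, ℂ)) :
    ∫⁻ x, ‖𝓕 (dil k m) x‖ₑ = ∫⁻ x, ‖𝓕 m x‖ₑ := by
  have h0 : (2 : ℝ) ^ k ≠ 0 := by positivity
  have e : ∀ g : 𝓢(Eu d, ℂ), ∫⁻ x, ‖g x‖ₑ = ENNReal.ofReal (∫ x, ‖g x‖) := fun g => by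
    rw [ofReal_integral_norm_eq_lintegral_enorm g.integrable]
  rw [e, e]
  congr 1
  simp only [fourier_dil, norm_mul, Complex.norm_real, Real.norm_eq_abs]
  rw [integral_const_mul, Measure.integral_comp_smul (volume : Measure (Eu d)) (fun x => ‖𝓕 m x‖)]
  simp only [finrank_euclideanSpace_fin, smul_eq_mul]
  rw [← mul_assoc, ← abs_mul, mul_inv_cancel₀ (by positivity), abs_one, one_mul]

theorem exists_eLpNorm_mult_dil_le (hpq : p.HolderConjugate q) (m : 𝓢(Eu d, ℂ)) :
    ∃ C : ℝ≥0, ∀ k f, eLpNorm (mult (dil k m) f) (ENNReal.ofReal p) volume ≤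
      C * eLpNorm f (ENNReal.ofReal p) volume := by
  have h : ∫⁻ x, ‖𝓕 m x‖ₑ ≠ ⊤ := (𝓕 m).integrable.2.ne
  refine ⟨(∫⁻ x, ‖𝓕 m x‖ₑ).toNNReal, fun k f => ?_⟩
  rw [ENNReal.coe_toNNReal h, ← lintegral_fourier_dil k]
  exact eLpNorm_mult_le hpq _ _

/-! #### Derivatives -/

/-- Multiplication of a Schwartz function by a linear coordinate. -/
noncomputable def coordMul (e : Eu d) (m : 𝓢(Eu d, ℂ)) : 𝓢(Eu d, ℂ) :=
  SchwartzMap.smulLeftCLM ℂ (fun x => inner ℝ x e) m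

theorem coordMul_apply (e : Eu d) (m : 𝓢(Eu d, ℂ)) (x : Eu d) :
    coordMul e m x = (inner ℝ x e : ℝ) * m x := by
  have : (inner ℝ · e : Eu d → ℝ).HasTemperateGrowth := by fun_prop
  rw [coordMul, SchwartzMap.smulLeftCLM_apply_apply this, Complex.real_smul]

theorem coordMul_dil (e : Eu d) (k : ℕ) (m : 𝓢(Eu d, ℂ)) :
    coordMul e (dil k m) = ((2 : ℂ) ^ k) • dil k (coordMul e m) := by
  ext x
  have h0 : (2 : ℂ) ^ k ≠ 0 := pow_ne_zero k two_ne_zero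
  simp only [coordMul_apply, dil_apply, smul_apply, inner_smul_left, smul_eq_mul]
  push_cast
  simp only [conj_trivial, Complex.ofReal_inv, Complex.ofReal_pow, Complex.ofReal_ofNat]
  field_simp

theorem lineDeriv_mult (e : Eu d) (m f : 𝓢(Eu d, ℂ)) :
    ∂_{e} (mult m f) = mult (-(2 * Real.pi * Complex.I) • coordMul e m) f := by
  rw [mult_apply, SchwartzMap.lineDerivOp_fourier_eq, mult_apply]
  congr 1
  ext x
  have := coordMul_apply e (smulS m (𝓕⁻ f)) x
  rw [coordMul] at this
  rw [smul_apply, this, smulS_apply, smulS_apply, smul_apply,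
    coordMul_apply]
  simp only [smul_eq_mul]; ring

/-- A linear factor of the symbol can be traded for a derivative of the argument; this is how
annular symbols turn smoothness into decay. -/
theorem mult_coordMul (e : Eu d) (m f : 𝓢(Eu d, ℂ)) :
    mult (coordMul e m) f = (-(2 * Real.pi * Complex.I))⁻¹ • mult m (∂_{e} f) := by
  have hc : -(2 * Real.pi * Complex.I) ≠ 0 := by simp [Real.pi_ne_zero]
  rw [mult_apply, mult_apply, SchwartzMap.fourierInv_lineDerivOp_eq, map_smul,
    FourierTransform.fourier_smul, smul_smul, inv_mul_cancel₀ hc, one_smul]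
  congr 1
  ext x
  have := coordMul_apply e (𝓕⁻ f) x
  rw [coordMul] at this
  rw [smulS_apply, smulS_apply, coordMul_apply, this]
  ring

/-- The `L_p` norm of the derivative of order `i`. -/
noncomputable def derivNorm (p : ℝ) (i : ℕ) (u : 𝓢(Eu d, ℂ)) : ℝ≥0∞ :=
  eLpNorm (iteratedFDeriv ℝ i u) (ENNReal.ofReal p) volume

theorem derivNorm_zero (p : ℝ) (u : 𝓢(Eu d, ℂ)) :
    derivNorm p 0 u = eLpNorm u (ENNReal.ofReal p) volume :=
  eLpNorm_congr_norm_ae (ae_of_all _ fun _ => norm_iteratedFDeriv_zero)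

theorem derivNorm_smul (c : ℂ) (i : ℕ) (u : 𝓢(Eu d, ℂ)) :
    derivNorm p i (c • u) = ‖c‖ₑ * derivNorm p i u := by
  have : iteratedFDeriv ℝ i (⇑(c • u)) = c • iteratedFDeriv ℝ i u := by
    funext x
    exact iteratedFDeriv_const_smul_apply (u.smooth i).contDiffAt
  rw [derivNorm, this, eLpNorm_const_smul]; rfl

theorem continuous_iteratedFDeriv_schwartz (i : ℕ) (u : 𝓢(Eu d, ℂ)) :
    Continuous (iteratedFDeriv ℝ i u) :=
  (u.smooth ⊤).continuous_iteratedFDeriv (mod_cast le_top)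

theorem norm_iteratedFDeriv_lineDeriv_le (i : ℕ) (e : Eu d) (u : 𝓢(Eu d, ℂ)) (x : Eu d) :
    ‖iteratedFDeriv ℝ i (∂_{e} u : 𝓢(Eu d, ℂ)) x‖ ≤ ‖e‖ * ‖iteratedFDeriv ℝ (i + 1) u x‖ := by
  have h1 : (⇑(∂_{e} u : 𝓢(Eu d, ℂ))) = fun y => fderiv ℝ u y e :=
    funext fun y => SchwartzMap.lineDerivOp_apply_eq_fderiv e u y
  rw [h1, ← norm_iteratedFDeriv_fderiv]
  exact norm_iteratedFDeriv_clm_apply_const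
    (((u.smooth ⊤).fderiv_right (m := ∞) (mod_cast le_top)).contDiffAt) (mod_cast le_top)

theorem norm_iteratedFDeriv_succ_le (i : ℕ) (u : 𝓢(Eu d, ℂ)) (x : Eu d) :
    ‖iteratedFDeriv ℝ (i + 1) u x‖ ≤
      ∑ a : Fin d, ‖iteratedFDeriv ℝ i (∂_{EuclideanSpace.single a (1 : ℝ)} u : 𝓢(Eu d, ℂ)) x‖ := by
  -- `S a c` is the map `v ↦ v_a c`, of norm at most `|c|`, and `Du = ∑ S_a ∘ ∂_a u`; so each
  -- partial derivative enters with constant one.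
  let S : Fin d → ℂ →L[ℝ] (Eu d →L[ℝ] ℂ) := fun a =>
    ContinuousLinearMap.smulRightL ℝ (Eu d) ℂ (EuclideanSpace.proj a)
  have hS : ∀ a, ‖S a‖ ≤ 1 := fun a => by
    refine ContinuousLinearMap.opNorm_le_bound _ zero_le_one fun c => ?_
    refine ContinuousLinearMap.opNorm_le_bound _ (by positivity) fun v => ?_
    have : S a c v = (v a) • c := rfl
    rw [this, norm_smul, one_mul, mul_comm]
    gcongr
    exact PiLp.norm_apply_le v a
  have h1 : fderiv ℝ u = fun y => ∑ a, (S a ∘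
      (∂_{EuclideanSpace.single a (1 : ℝ)} u : 𝓢(Eu d, ℂ))) y := by
    funext y
    ext v
    have hv : v = ∑ a, v a • EuclideanSpace.single a (1 : ℝ) := by
      ext b
      simp [Finset.sum_apply, Pi.single_apply]
    conv_lhs => rw [hv]
    rw [map_sum, sum_apply]
    refine Finset.sum_congr rfl fun a _ => ?_
    rw [map_smul]
    change _ = (v a) • (∂_{EuclideanSpace.single a (1 : ℝ)} u : 𝓢(Eu d, ℂ)) y
    rw [SchwartzMap.lineDerivOp_apply_eq_fderiv]
  rw [← norm_iteratedFDeriv_fderiv, h1, iteratedFDeriv_sum]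
  · rw [Finset.sum_apply]
    refine (norm_sum_le _ _).trans (Finset.sum_le_sum fun a _ => ?_)
    refine (ContinuousLinearMap.norm_iteratedFDeriv_comp_left (S a)
      ((SchwartzMap.smooth _ ⊤).contDiffAt) (mod_cast le_top)).trans ?_
    exact mul_le_of_le_one_left (norm_nonneg _) (hS a)
  · exact fun a _ => (S a).contDiff.comp ((SchwartzMap.smooth _ ⊤).of_le (mod_cast le_top))

theorem derivNorm_lineDeriv_le (p : ℝ) (i : ℕ) (a : Fin d) (u : 𝓢(Eu d, ℂ)) :
    derivNorm p i (∂_{EuclideanSpace.single a (1 : ℝ)} u) ≤ derivNorm p (i + 1) u := by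
  refine eLpNorm_mono fun x => (norm_iteratedFDeriv_lineDeriv_le i _ u x).trans ?_
  simp

theorem derivNorm_succ_le (hpq : p.HolderConjugate q) (i : ℕ) (u : 𝓢(Eu d, ℂ)) :
    derivNorm p (i + 1) u ≤
      ∑ a : Fin d, derivNorm p i (∂_{EuclideanSpace.single a (1 : ℝ)} u) := by
  refine (eLpNorm_mono_real (g := fun x => ∑ a : Fin d, ‖iteratedFDeriv ℝ i
    (∂_{EuclideanSpace.single a (1 : ℝ)} u : 𝓢(Eu d, ℂ)) x‖)
    fun x => norm_iteratedFDeriv_succ_le i u x).trans ?_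
  have h := eLpNorm_sum_le (μ := (volume : Measure (Eu d))) (p := ENNReal.ofReal p)
    (s := Finset.univ) (f := fun (a : Fin d) x => ‖iteratedFDeriv ℝ i
    (∂_{EuclideanSpace.single a (1 : ℝ)} u : 𝓢(Eu d, ℂ)) x‖)
    (fun a _ => (continuous_iteratedFDeriv_schwartz i _).norm.aestronglyMeasurable)
    (fact_one_le_ofReal hpq).out
  simp only [eLpNorm_norm] at h
  refine le_trans (le_of_eq ?_) h
  congr 1
  funext x
  rw [Finset.sum_apply]

/-- Bernstein's inequality. -/
theorem exists_derivNorm_mult_dil_le (hpq : p.HolderConjugate q) (i : ℕ) :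
    ∀ m : 𝓢(Eu d, ℂ), ∃ C : ℝ≥0, ∀ k f, derivNorm p i (mult (dil k m) f) ≤
      C * 2 ^ (k * i) * eLpNorm f (ENNReal.ofReal p) volume := by
  induction i with
  | zero =>
    intro m
    obtain ⟨C, hC⟩ := exists_eLpNorm_mult_dil_le hpq m
    exact ⟨C, fun k f => by simpa [derivNorm_zero] using hC k f⟩
  | succ i ih =>
    intro m
    choose C hC using fun a : Fin d => ih (-(2 * Real.pi * Complex.I) •
      coordMul (EuclideanSpace.single a (1 : ℝ)) m)
    refine ⟨∑ a, C a, fun k f => (derivNorm_succ_le hpq i _).trans ?_⟩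
    rw [ENNReal.ofNNReal_finsetSum, Finset.sum_mul, Finset.sum_mul]
    refine Finset.sum_le_sum fun a _ => ?_
    -- The derivative multiplies the symbol by a coordinate, and a coordinate passes through the
    -- dilation at the price of `2^k`. The induction runs over all symbols because the symbol
    -- changes.
    have h : (∂_{EuclideanSpace.single a (1 : ℝ)} (mult (dil k m) f) : 𝓢(Eu d, ℂ)) =
        ((2 : ℂ) ^ k) • mult (dil k (-(2 * Real.pi * Complex.I) •
          coordMul (EuclideanSpace.single a (1 : ℝ)) m)) f := by
      rw [lineDeriv_mult, coordMul_dil, map_smul, ← mult_smul]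
      congr 1
      rw [smul_comm]
    rw [h, derivNorm_smul]
    have e2 : ‖(2 : ℂ) ^ k‖ₑ = 2 ^ k := by
      rw [enorm_pow, ← ofReal_norm]; simp
    calc _ ≤ 2 ^ k * (C a * 2 ^ (k * i) * eLpNorm f (ENNReal.ofReal p) volume) := by
          rw [e2]; gcongr; exact hC a k f
      _ = _ := by rw [mul_add, mul_one, pow_add]; ring

/-- The symbols that vanish near the origin and have compact support. -/
structure IsAnnular (m : 𝓢(Eu d, ℂ)) : Prop where
  compact : HasCompactSupport m
  zero : (0 : Eu d) ∉ tsupport m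

/-- Write `m = ∑ x_a · (x_a / |x|²) m`; the quotients are smooth because `m` vanishes near the
origin. -/
theorem IsAnnular.exists_eq_sum {m : 𝓢(Eu d, ℂ)} (hm : IsAnnular m) :
    ∃ n : Fin d → 𝓢(Eu d, ℂ), (∀ a, IsAnnular (n a)) ∧
      m = ∑ a, coordMul (EuclideanSpace.single a (1 : ℝ)) (n a) := by
  let g : Fin d → Eu d → ℂ := fun a x => ((x a / ‖x‖ ^ 2 : ℝ) : ℂ) * m x
  have hts : ∀ a, tsupport (g a) ⊆ tsupport m := fun a => tsupport_mul_subset_right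
  have hcs : ∀ a, HasCompactSupport (g a) := fun a => hm.compact.mul_left
  have hsm : ∀ a, ContDiff ℝ ∞ (g a) := fun a => by
    refine contDiff_iff_contDiffAt.2 fun x => ?_
    by_cases hx : x ∈ tsupport (g a)
    swap
    · exact contDiffAt_const.congr_of_eventuallyEq (notMem_tsupport_iff_eventuallyEq.1 hx)
    have hx0 : x ≠ 0 := fun h => hm.zero (h ▸ hts a hx)
    refine ContDiffAt.mul ?_ (m.smooth ⊤).contDiffAt
    refine Complex.ofRealCLM.contDiff.contDiffAt.comp x ?_
    refine ContDiffAt.div ?_ (contDiff_norm_sq ℝ).contDiffAt (by positivity)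
    exact (EuclideanSpace.proj (𝕜 := ℝ) a).contDiff.contDiffAt
  refine ⟨fun a => (hcs a).toSchwartzMap (hsm a), fun a => ⟨hcs a, fun h => hm.zero (hts a h)⟩, ?_⟩
  ext x
  rw [sum_apply]
  have e : ∀ a, coordMul (EuclideanSpace.single a (1 : ℝ)) ((hcs a).toSchwartzMap (hsm a)) x =
      ((x a * (x a / ‖x‖ ^ 2) : ℝ) : ℂ) * m x := fun a => by
    rw [coordMul_apply]
    change _ * g a x = _
    simp only [g, EuclideanSpace.inner_single_right]
    push_cast
    simp
    ring
  simp only [e]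
  rw [← Finset.sum_mul, ← Complex.ofReal_sum]
  rcases eq_or_ne x 0 with rfl | hx
  · rw [image_eq_zero_of_notMem_tsupport hm.zero, mul_zero]
  · have : ∑ a, x a * (x a / ‖x‖ ^ 2) = 1 := by
      have h1 := EuclideanSpace.real_norm_sq_eq x
      have h2 : ‖x‖ ^ 2 ≠ 0 := by positivity
      simp only [← mul_div_assoc]
      rw [← Finset.sum_div, div_eq_one_iff_eq h2, h1]
      simp [sq]
    rw [this]; simp

/-- The counterpart of Bernstein's inequality: each coordinate factored out of an annular symbol at
scale `2^k` gains `2^{-k}` and puts one derivative on `f`. -/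
theorem exists_eLpNorm_mult_annular_le (hpq : p.HolderConjugate q) (N : ℕ) :
    ∀ m : 𝓢(Eu d, ℂ), IsAnnular m → ∃ C : ℝ≥0, ∀ k f,
      eLpNorm (mult (dil k m) f) (ENNReal.ofReal p) volume ≤
        C * 2⁻¹ ^ (k * N) * derivNorm p N f := by
  induction N with
  | zero =>
    intro m _
    obtain ⟨C, hC⟩ := exists_eLpNorm_mult_dil_le hpq m
    exact ⟨C, fun k f => by simpa [derivNorm_zero] using hC k f⟩
  | succ N ih =>
    intro m hm
    obtain ⟨n, hn, hsum⟩ := hm.exists_eq_sum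
    choose C hC using fun a => ih (n a) (hn a)
    let c : ℂ := (-(2 * Real.pi * Complex.I))⁻¹
    refine ⟨∑ a, ‖c‖₊ * C a, fun k f => ?_⟩
    have h : mult (dil k m) f = ∑ a, (((2 : ℂ) ^ k)⁻¹ * c) •
        mult (dil k (n a)) (∂_{EuclideanSpace.single a (1 : ℝ)} f) := by
      have h0 : (2 : ℂ) ^ k ≠ 0 := pow_ne_zero k two_ne_zero
      conv_lhs => rw [hsum, map_sum, mult_sum]
      refine Finset.sum_congr rfl fun a _ => ?_
      rw [mul_smul, ← mult_coordMul, coordMul_dil, mult_smul, smul_smul, inv_mul_cancel₀ h0,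
        one_smul]
    have h' : (⇑(mult (dil k m) f)) = ∑ a, ⇑((((2 : ℂ) ^ k)⁻¹ * c) •
        mult (dil k (n a)) (∂_{EuclideanSpace.single a (1 : ℝ)} f)) := by
      rw [h]; funext x; simp
    rw [h']
    refine (eLpNorm_sum_le (fun a _ => (SchwartzMap.continuous _).aestronglyMeasurable)
      (fact_one_le_ofReal hpq).out).trans ?_
    rw [ENNReal.ofNNReal_finsetSum, Finset.sum_mul, Finset.sum_mul]
    refine Finset.sum_le_sum fun a _ => ?_
    rw [← derivNorm_zero, derivNorm_smul, derivNorm_zero, enorm_mul]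
    have e2 : ‖((2 : ℂ) ^ k)⁻¹‖ₑ = 2⁻¹ ^ k := by
      rw [enorm_inv (pow_ne_zero k two_ne_zero), enorm_pow, ← ofReal_norm, ENNReal.inv_pow]; simp
    rw [e2]
    calc _ ≤ 2⁻¹ ^ k * ‖c‖ₑ * (C a * 2⁻¹ ^ (k * N) * derivNorm p (N + 1) f) := by
          gcongr
          refine (hC a k _).trans ?_
          gcongr
          exact derivNorm_lineDeriv_le p N a f
      _ = _ := by
          rw [mul_add, mul_one, pow_add, ENNReal.coe_mul]
          change _ = ‖c‖ₑ * _ * _ * _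
          ring

end Multipliers

end RefinedBesov

namespace RefinedBesov

open scoped FourierTransform LineDeriv

/-! ### Dyadic families of multipliers -/

section DyadicFamilies

variable {d : ℕ} {p q : ℝ}

/-- A dyadic family of symbols: `m₀` at the level `0`, the dilations of `m` at higher levels. -/
noncomputable def dyadicFamily (m₀ m : 𝓢(Eu d, ℂ)) : ℕ → 𝓢(Eu d, ℂ)
  | 0 => m₀
  | k + 1 => dil (k + 1) m

theorem dil_zero (m : 𝓢(Eu d, ℂ)) : dil 0 m = m := by
  ext x; simp [dil_apply]

theorem reflect_dil (k : ℕ) (m : 𝓢(Eu d, ℂ)) : reflect (dil k m) = dil k (reflect m) := by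
  ext x; simp [dil_apply, reflect_apply]

theorem reflect_dyadicFamily (m₀ m : 𝓢(Eu d, ℂ)) (k : ℕ) :
    reflect (dyadicFamily m₀ m k) = dyadicFamily (reflect m₀) (reflect m) k := by
  cases k with
  | zero => rfl
  | succ k => exact reflect_dil _ _

theorem IsAnnular.reflect {m : 𝓢(Eu d, ℂ)} (hm : IsAnnular m) : IsAnnular (reflect m) := by
  have h : (⇑(RefinedBesov.reflect m) : Eu d → ℂ) = m ∘ Homeomorph.neg (Eu d) := rfl
  constructor
  · rw [h]
    exact hm.compact.comp_homeomorph _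
  · rw [h, tsupport_comp_eq_preimage]
    simpa using hm.zero

theorem exists_derivNorm_mult_dyadicFamily_le (hpq : p.HolderConjugate q) (i : ℕ)
    (m₀ m : 𝓢(Eu d, ℂ)) :
    ∃ C : ℝ≥0, ∀ k f, derivNorm p i (mult (dyadicFamily m₀ m k) f) ≤
      C * 2 ^ (k * i) * eLpNorm f (ENNReal.ofReal p) volume := by
  obtain ⟨C₀, h₀⟩ := exists_derivNorm_mult_dil_le hpq i m₀
  obtain ⟨C₁, h₁⟩ := exists_derivNorm_mult_dil_le hpq i m
  refine ⟨max C₀ C₁, fun k f => ?_⟩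
  cases k with
  | zero =>
    refine le_trans ?_ ((h₀ 0 f).trans ?_)
    · rw [dil_zero]; rfl
    · gcongr; exact le_max_left _ _
  | succ k =>
    refine (h₁ (k + 1) f).trans ?_
    gcongr; exact le_max_right _ _

/-- The symbol `m₀` at level `0` need not be annular and yields no derivatives. The term `derivNorm
p 0 f` covers it, at no loss since the decay factor is `1` at `k = 0`. -/
theorem exists_eLpNorm_mult_dyadicFamily_le (hpq : p.HolderConjugate q) (N : ℕ)
    (m₀ m : 𝓢(Eu d, ℂ)) (hm : IsAnnular m) :
    ∃ C : ℝ≥0, ∀ k f, eLpNorm (mult (dyadicFamily m₀ m k) f) (ENNReal.ofReal p) volume ≤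
      C * 2⁻¹ ^ (k * N) * (derivNorm p 0 f + derivNorm p N f) := by
  obtain ⟨C₀, h₀⟩ := exists_eLpNorm_mult_dil_le hpq m₀
  obtain ⟨C₁, h₁⟩ := exists_eLpNorm_mult_annular_le hpq N m hm
  refine ⟨max C₀ C₁, fun k f => ?_⟩
  cases k with
  | zero =>
    refine le_trans ?_ ((h₀ 0 f).trans ?_)
    · rw [dil_zero]; rfl
    · rw [← derivNorm_zero, zero_mul, pow_zero, mul_one]
      gcongr
      · exact le_max_left _ _
      · exact le_self_add
  | succ k =>
    refine (h₁ (k + 1) f).trans ?_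
    gcongr
    · exact le_max_right _ _
    · exact le_add_self

/-- The operators on test functions that are bounded in the Sobolev norms built on `L_p`. -/
def IsSobolevBounded (p : ℝ) (T : 𝓢(Eu d, ℂ) → 𝓢(Eu d, ℂ)) : Prop :=
  ∀ N : ℕ, ∃ C : ℝ≥0, ∀ f, derivNorm p N (T f) ≤ C * ∑ i ∈ Finset.range (N + 1), derivNorm p i f

theorem isSobolevBounded_id (p : ℝ) : IsSobolevBounded p (id : 𝓢(Eu d, ℂ) → 𝓢(Eu d, ℂ)) :=
  fun N => ⟨1, fun f => by
    rw [ENNReal.coe_one, one_mul]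
    exact Finset.single_le_sum (f := fun i => derivNorm p i f) (fun _ _ => zero_le)
      (Finset.mem_range.2 N.lt_succ_self)⟩

/-- Low frequencies stay low: after localization at level `j`, `N` derivatives cost `2^{jN}` by
Bernstein's inequality, `T` preserves this, and the annular symbol at level `k` gains `2^{-kN}`. -/
theorem exists_mult_comp_mult_le (hpq : p.HolderConjugate q) {T : 𝓢(Eu d, ℂ) → 𝓢(Eu d, ℂ)}
    (hT : IsSobolevBounded p T) (N : ℕ) (m₀ m n₀ n : 𝓢(Eu d, ℂ)) (hm : IsAnnular m) :
    ∃ C : ℝ≥0, ∀ j k f, j ≤ k →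
      eLpNorm (mult (dyadicFamily m₀ m k) (T (mult (dyadicFamily n₀ n j) f)))
        (ENNReal.ofReal p) volume ≤
      C * 2⁻¹ ^ (N * (k - j)) * eLpNorm f (ENNReal.ofReal p) volume := by
  obtain ⟨C₁, h₁⟩ := exists_eLpNorm_mult_dyadicFamily_le hpq N m₀ m hm
  choose B hB using fun i => exists_derivNorm_mult_dyadicFamily_le hpq i n₀ n
  choose A hA using hT
  let S : ℕ → ℝ≥0 := fun M => A M * ∑ i ∈ Finset.range (M + 1), B i
  have hS : ∀ M ≤ N, ∀ j f, derivNorm p M (T (mult (dyadicFamily n₀ n j) f)) ≤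
      S M * (2 ^ (j * N) * eLpNorm f (ENNReal.ofReal p) volume) := fun M hM j f => by
    refine (hA M _).trans ?_
    rw [ENNReal.coe_mul, mul_assoc, ENNReal.ofNNReal_finsetSum, Finset.sum_mul]
    gcongr with i hi
    refine (hB i j f).trans ?_
    rw [mul_assoc]
    gcongr
    · exact one_le_two
    · have := Finset.mem_range.1 hi; omega
  refine ⟨C₁ * (S 0 + S N), fun j k f hjk => (h₁ k _).trans ?_⟩
  have e : (2⁻¹ : ℝ≥0∞) ^ (k * N) * 2 ^ (j * N) = 2⁻¹ ^ (N * (k - j)) := by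
    have : k * N = N * (k - j) + j * N := by
      obtain ⟨l, rfl⟩ := Nat.exists_eq_add_of_le hjk
      simp; ring
    rw [this, pow_add, mul_assoc, ← mul_pow, ENNReal.inv_mul_cancel (by simp) (by simp), one_pow,
      mul_one]
  calc _ ≤ C₁ * 2⁻¹ ^ (k * N) * (S 0 * (2 ^ (j * N) * eLpNorm f (ENNReal.ofReal p) volume) +
        S N * (2 ^ (j * N) * eLpNorm f (ENNReal.ofReal p) volume)) := by
        gcongr
        · exact hS 0 (Nat.zero_le _) j f
        · exact hS N le_rfl j f
    _ = _ := by
        rw [← e]; push_cast; ring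

/-- Read as a distribution, `u` has an `L_p` representative of norm at most `C`, and two locally
integrable functions with the same pairings against test functions agree almost everywhere. -/
theorem eLpNorm_le_of_schwartz_test (hpq : p.HolderConjugate q) (u : 𝓢(Eu d, ℂ)) {C : ℝ≥0∞}
    (hC : C ≠ ⊤)
    (H : ∀ g : 𝓢(Eu d, ℂ), ‖∫ x, u x * g x‖ₑ ≤ C * eLpNorm g (ENNReal.ofReal q) volume) :
    eLpNorm u (ENNReal.ofReal p) volume ≤ C := by
  let w : 𝓢'(Eu d, ℂ) := SchwartzMap.toTemperedDistributionCLM (Eu d) ℂ volume u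
  have hw : ∀ g : 𝓢(Eu d, ℂ), w g = ∫ x, u x * g x := fun g => by
    simp only [w, SchwartzMap.toTemperedDistributionCLM_apply_apply, smul_eq_mul, mul_comm]
  obtain ⟨h, hm, hh, hrep⟩ := exists_rep_of_bound hpq (w := w) hC (fun g => by rw [hw]; exact H g)
  have hmem : MemLp h (ENNReal.ofReal p) volume := ⟨hm.aestronglyMeasurable, hh.trans_lt hC.lt_top⟩
  have hae : ∀ᵐ x, u x = h x := by
    refine ae_eq_of_integral_contDiff_smul_eq u.continuous.locallyIntegrable
      (hmem.locallyIntegrable (fact_one_le_ofReal hpq).out) fun g hg hgc => ?_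
    have hgC : ContDiff ℝ ∞ fun x => (g x : ℂ) := Complex.ofRealCLM.contDiff.comp hg
    have hgs : HasCompactSupport fun x => (g x : ℂ) := hgc.comp_left (g := Complex.ofReal) rfl
    have h1 := hrep (hgs.toSchwartzMap hgC)
    rw [hw] at h1
    simp only [Complex.real_smul]
    calc _ = _ := by
          congr 1; funext x; exact mul_comm _ _
      _ = _ := h1
  rwa [eLpNorm_congr_ae hae]

/-- The operators `T` and `T'` are transposes of each other. -/
def IsTranspose (T T' : 𝓢(Eu d, ℂ) → 𝓢(Eu d, ℂ)) : Prop :=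
  ∀ f g : 𝓢(Eu d, ℂ), ∫ x, T f x * g x = ∫ x, f x * T' g x

/-- The matrix of an operator with respect to dyadic families decays off the diagonal. -/
theorem exists_almost_diagonal (hpq : p.HolderConjugate q) {T T' : 𝓢(Eu d, ℂ) → 𝓢(Eu d, ℂ)}
    (hT : IsSobolevBounded p T) (hT' : IsSobolevBounded q T') (hTT' : IsTranspose T T') (N : ℕ)
    {m₀ m n₀ n : 𝓢(Eu d, ℂ)} (hm : IsAnnular m) (hn : IsAnnular n) :
    ∃ C : ℝ≥0, ∀ j k f,
      eLpNorm (mult (dyadicFamily m₀ m k) (T (mult (dyadicFamily n₀ n j) f)))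
        (ENNReal.ofReal p) volume ≤
      C * 2⁻¹ ^ (N * ((j - k) + (k - j))) * eLpNorm f (ENNReal.ofReal p) volume := by
  obtain ⟨C₁, h₁⟩ := exists_mult_comp_mult_le hpq hT N m₀ m n₀ n hm
  obtain ⟨C₂, h₂⟩ := exists_mult_comp_mult_le hpq.symm hT' N (reflect n₀) (reflect n)
    (reflect m₀) (reflect m) hn.reflect
  refine ⟨max C₁ C₂, fun j k f => ?_⟩
  rcases le_total j k with hjk | hjk
  · rw [Nat.sub_eq_zero_of_le hjk, zero_add]
    refine (h₁ j k f hjk).trans ?_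
    gcongr; exact le_max_left _ _
  -- Below the diagonal the bound comes by duality: transposition exchanges the two multipliers,
  -- replaces `T` by `T'` and `p` by `q`, and so brings back the case of an increasing level.
  · rw [Nat.sub_eq_zero_of_le hjk, add_zero]
    refine le_trans (b := C₂ * 2⁻¹ ^ (N * (j - k)) * eLpNorm f (ENNReal.ofReal p) volume) ?_
      (by gcongr; exact le_max_right _ _)
    refine eLpNorm_le_of_schwartz_test hpq _ (ENNReal.mul_ne_top (ENNReal.mul_ne_top (by simp)
      (ENNReal.pow_ne_top (by simp))) (eLpNorm_schwartz_ne_top f _)) fun g => ?_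
    rw [integral_mult_mul, hTT', integral_mult_mul, reflect_dyadicFamily, reflect_dyadicFamily]
    refine (enorm_integral_mul_le hpq.symm f.continuous.aestronglyMeasurable
      (SchwartzMap.continuous _).aestronglyMeasurable).trans ?_
    refine (mul_le_mul_left (h₂ k j g hjk) _).trans (le_of_eq ?_)
    ring

/-! ### The resolution of unity -/

theorem IsCutoff.hasCompactSupport {β₀ : Eu d → ℂ} (hβ : IsCutoff β₀) : HasCompactSupport β₀ :=
  HasCompactSupport.intro (isCompact_closedBall (0 : Eu d) 2) fun x hx =>
    hβ.eq_zero x (by simpa using (not_le.1 (by simpa using hx)).le)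

/-- The cutoff function as a Schwartz function. -/
noncomputable def IsCutoff.toSchwartz {β₀ : Eu d → ℂ} (hβ : IsCutoff β₀) : 𝓢(Eu d, ℂ) :=
  hβ.hasCompactSupport.toSchwartzMap hβ.smooth

/-- Both terms equal `1` for `b|x| ≤ 1` and vanish for `a|x| ≥ 2`, so the difference is supported
away from the origin and from infinity. -/
theorem exists_annular_sub {β₀ : Eu d → ℂ} (hβ : IsCutoff β₀) {a b : ℝ} (ha : 0 < a) (hab : a ≤ b) :
    ∃ m : 𝓢(Eu d, ℂ), IsAnnular m ∧ ∀ x, m x = β₀ (a • x) - β₀ (b • x) := by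
  have hb := ha.trans_le hab
  let g : Eu d → ℂ := fun x => β₀ (a • x) - β₀ (b • x)
  have hs : ContDiff ℝ ∞ g := (hβ.smooth.comp (contDiff_id.const_smul a)).sub
    (hβ.smooth.comp (contDiff_id.const_smul b))
  have hc : HasCompactSupport g := by
    refine HasCompactSupport.intro (isCompact_closedBall (0 : Eu d) (2 / a)) fun x hx => ?_
    have hx : 2 / a < ‖x‖ := by simpa using hx
    have hx : 2 < a * ‖x‖ := by rwa [div_lt_iff₀' ha] at hx
    have h1 : 2 ≤ ‖a • x‖ := by rw [norm_smul, Real.norm_of_nonneg ha.le]; exact hx.le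
    have h2 : 2 ≤ ‖b • x‖ := by
      rw [norm_smul, Real.norm_of_nonneg hb.le]; refine hx.le.trans ?_; gcongr
    simp [g, hβ.eq_zero _ h1, hβ.eq_zero _ h2]
  refine ⟨hc.toSchwartzMap hs, ⟨hc, ?_⟩, fun x => rfl⟩
  change (0 : Eu d) ∉ tsupport g
  rw [notMem_tsupport_iff_eventuallyEq]
  filter_upwards [Metric.ball_mem_nhds (0 : Eu d) (show (0 : ℝ) < 1 / b by positivity)] with x hx
  have hx : ‖x‖ < 1 / b := by simpa using hx
  have hx : b * ‖x‖ < 1 := by rwa [lt_div_iff₀' hb] at hx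
  have h2 : ‖b • x‖ ≤ 1 := by rw [norm_smul, Real.norm_of_nonneg hb.le]; exact hx.le
  have h1 : ‖a • x‖ ≤ 1 := by
    rw [norm_smul, Real.norm_of_nonneg ha.le]; refine le_trans ?_ hx.le; gcongr
  simp [g, hβ.eq_one _ h1, hβ.eq_one _ h2]

/-- The resolution of unity and a wider family reproducing it, as dyadic families of Schwartz
functions. -/
structure IsResolution (β₀ : Eu d → ℂ) (m₀ m n₀ n : 𝓢(Eu d, ℂ)) : Prop where
  annular : IsAnnular m
  annular_wide : IsAnnular n
  eq_dyadic : ∀ k, ⇑(dyadicFamily m₀ m k) = dyadic β₀ k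
  wide_mul : ∀ k x, dyadicFamily n₀ n k x * dyadicFamily m₀ m k x = dyadicFamily m₀ m k x
  sum : ∀ n, ∑ k ∈ Finset.range (n + 1), dyadicFamily m₀ m k = dil n m₀
  one : ∀ y, ‖y‖ ≤ 1 → m₀ y = 1

theorem exists_isResolution {β₀ : Eu d → ℂ} (hβ : IsCutoff β₀) :
    ∃ m₀ m n₀ n : 𝓢(Eu d, ℂ), IsResolution β₀ m₀ m n₀ n := by
  -- `β_k = m(2^{-k} ·)` for `m(x) = β₀(x) - β₀(2x)`, which vanishes unless `1/2 < |x| < 2`. The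
  -- wide symbol `β₀(x/2) - β₀(4x)` equals `1` there, and `β₀(x/2)` plays the same part at level
  -- `0`.
  obtain ⟨m, hm, hmx⟩ := exists_annular_sub hβ (a := 1) (b := 2) one_pos one_le_two
  obtain ⟨n, hn, hnx⟩ := exists_annular_sub hβ (a := 2⁻¹) (b := 4) (by norm_num) (by norm_num)
  have hd : ∀ k, ⇑(dyadicFamily hβ.toSchwartz m k) = dyadic β₀ k := fun k => by
    cases k with
    | zero => rfl
    | succ k =>
      funext x
      change m (((2 : ℝ) ^ (k + 1))⁻¹ • x) = β₀ _ - β₀ _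
      rw [hmx, one_smul, smul_smul]
      congr 3
      rw [pow_succ]; field_simp
  refine ⟨hβ.toSchwartz, m, dil 1 hβ.toSchwartz, n, hm, hn, hd, fun k x => ?_, fun N => ?_,
    hβ.eq_one⟩
  · have key : ∀ y, n y * m y = m y := fun y => by
      rcases le_or_gt 2 ‖y‖ with h | h
      · have : m y = 0 := by
          rw [hmx, hβ.eq_zero _ (by simpa using h), hβ.eq_zero, sub_zero]
          rw [norm_smul]; norm_num; linarith
        simp [this]
      rcases le_or_gt ‖y‖ 2⁻¹ with h' | h'
      · have : m y = 0 := by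
          rw [hmx, hβ.eq_one _ (by rw [one_smul]; linarith), hβ.eq_one, sub_self]
          rw [norm_smul]; norm_num; linarith
        simp [this]
      have : n y = 1 := by
        rw [hnx, hβ.eq_one, hβ.eq_zero, sub_zero]
        · rw [norm_smul]; norm_num; linarith
        · rw [norm_smul]; norm_num; linarith
      rw [this, one_mul]
    cases k with
    | zero =>
      change β₀ (((2 : ℝ) ^ 1)⁻¹ • x) * β₀ x = β₀ x
      rcases le_or_gt 2 ‖x‖ with h | h
      · simp [hβ.eq_zero x h]
      · rw [hβ.eq_one, one_mul]
        rw [norm_smul]; norm_num; linarith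
    | succ k => exact key _
  · induction N with
    | zero => simp [dyadicFamily, dil_zero]
    | succ N ih =>
      rw [Finset.sum_range_succ, ih]
      ext x
      rw [add_apply, hd]
      change β₀ (((2 : ℝ) ^ N)⁻¹ • x) + (β₀ (((2 : ℝ) ^ (N + 1))⁻¹ • x) - β₀ (((2 : ℝ) ^ N)⁻¹ • x)) =
        β₀ (((2 : ℝ) ^ (N + 1))⁻¹ • x)
      ring

theorem IsResolution.block_apply {β₀ : Eu d → ℂ} {m₀ m n₀ n : 𝓢(Eu d, ℂ)}
    (h : IsResolution β₀ m₀ m n₀ n) (k : ℕ) (w : 𝓢'(Eu d, ℂ)) (f : 𝓢(Eu d, ℂ)) :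
    block β₀ k w f = w (mult (dyadicFamily m₀ m k) f) := by
  rw [mult_apply, smulS, h.eq_dyadic]; rfl

theorem IsResolution.mult_wide {β₀ : Eu d → ℂ} {m₀ m n₀ n : 𝓢(Eu d, ℂ)}
    (h : IsResolution β₀ m₀ m n₀ n) (k : ℕ) (f : 𝓢(Eu d, ℂ)) :
    mult (dyadicFamily m₀ m k) (mult (dyadicFamily n₀ n k) f) = mult (dyadicFamily m₀ m k) f := by
  rw [mult_mult]
  congr 2
  ext x
  rw [smulS_apply, mul_comm, h.wide_mul]

/-- Multiplication by the dilations of a cutoff function tends to the identity. -/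
theorem tendsto_smulS_dil {m₀ : 𝓢(Eu d, ℂ)} (h1 : ∀ y, ‖y‖ ≤ 1 → m₀ y = 1) (f : 𝓢(Eu d, ℂ)) :
    Tendsto (fun n => smulS (dil n m₀) f) atTop (𝓝 f) := by
  rw [(schwartz_withSeminorms ℂ (Eu d) ℂ).tendsto_nhds]
  rintro ⟨k, l⟩ ε hε
  -- The dilation factor is at most one, so the derivatives of the dilated cutoffs are bounded
  -- uniformly in `n`; the added `1` accounts for the constant subtracted at order `0`.
  let B : ℕ → ℝ := fun i => SchwartzMap.seminorm ℂ 0 i m₀ + 1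
  have hB : ∀ i n x, ‖iteratedFDeriv ℝ i (fun y => dil n m₀ y - 1) x‖ ≤ B i := fun i n x => by
    have hc : ContDiff ℝ i (dil n m₀) := (dil n m₀).smooth i
    simp only [sub_eq_add_neg]
    have hadd := iteratedFDeriv_add_apply (x := x) (f := dil n m₀) (g := fun _ => -1) hc.contDiffAt
      contDiffAt_const
    change ‖iteratedFDeriv ℝ i (⇑(dil n m₀) + fun _ => -1) x‖ ≤ _
    rw [hadd]
    refine (norm_add_le _ _).trans (add_le_add ?_ ?_)
    · have := congrFun (iteratedFDeriv_comp_const_smul (i := i) (((2 : ℝ) ^ n)⁻¹)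
        (f := m₀) (m₀.smooth i)) x
      change ‖iteratedFDeriv ℝ i (fun z => m₀ (((2 : ℝ) ^ n)⁻¹ • z)) x‖ ≤ _
      rw [this, norm_smul, norm_pow, norm_inv, norm_pow, Real.norm_ofNat]
      refine (mul_le_of_le_one_left (norm_nonneg _) (pow_le_one₀ (by positivity)
        (inv_le_one_of_one_le₀ (one_le_pow₀ one_le_two)))).trans ?_
      exact SchwartzMap.norm_iteratedFDeriv_le_seminorm ℂ m₀ i _
    · rcases i with _ | i
      · simp
      · simp [iteratedFDeriv_const_of_ne (Nat.succ_ne_zero i)]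
  let M : ℝ := ∑ i ∈ Finset.range (l + 1),
    (l.choose i) * B i * SchwartzMap.seminorm ℂ (k + 1) (l - i) f
  have hM0 : 0 ≤ M := Finset.sum_nonneg fun i _ => by positivity
  have key : ∀ n, SchwartzMap.seminorm ℂ k l (smulS (dil n m₀) f - f) ≤ M * (2⁻¹) ^ n := fun n => by
    refine SchwartzMap.seminorm_le_bound ℂ k l _ (by positivity) fun x => ?_
    have hfun : ⇑(smulS (dil n m₀) f - f) = fun y => (dil n m₀ y - 1) * f y := by
      funext y
      rw [sub_apply, smulS_apply]; ring
    rw [hfun]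
    -- Inside the ball of radius `2^n` the difference vanishes identically; outside it one extra
    -- power of `|x|` is worth at least `2^n`, which gives the rate `2^{-n}`.
    rcases lt_or_ge ‖x‖ (2 ^ n) with hx | hx
    · have : (fun y => (dil n m₀ y - 1) * f y) =ᶠ[𝓝 x] fun _ => 0 := by
        filter_upwards [(isOpen_lt continuous_norm continuous_const).mem_nhds hx] with y hy
        have : dil n m₀ y = 1 := h1 (((2 : ℝ) ^ n)⁻¹ • y) (by
          rw [norm_smul, norm_inv, norm_pow, Real.norm_ofNat, inv_mul_le_iff₀ (by positivity),
            mul_one]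
          exact le_of_lt hy)
        rw [this, sub_self, zero_mul]
      rw [(this.iteratedFDeriv ℝ l).eq_of_nhds]
      simp only [iteratedFDeriv_fun_zero]
      simp
      positivity
    · have h2 := norm_iteratedFDeriv_mul_le (𝕜 := ℝ) (n := l) (N := ∞)
        (f := fun y => dil n m₀ y - 1) (g := f)
        (((dil n m₀).smooth ⊤).sub contDiff_const) (f.smooth ⊤) x (mod_cast le_top)
      have h3 : ‖x‖ ^ k ≤ (2⁻¹) ^ n * ‖x‖ ^ (k + 1) := by
        rw [pow_succ, inv_pow, inv_mul_eq_div, le_div_iff₀ (by positivity)]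
        gcongr
      calc _ ≤ ((2⁻¹) ^ n * ‖x‖ ^ (k + 1)) * ∑ i ∈ Finset.range (l + 1), (l.choose i) *
            ‖iteratedFDeriv ℝ i (fun y => dil n m₀ y - 1) x‖ * ‖iteratedFDeriv ℝ (l - i) f x‖ := by
            gcongr
        _ ≤ (2⁻¹) ^ n * ∑ i ∈ Finset.range (l + 1), (l.choose i) * B i *
            (‖x‖ ^ (k + 1) * ‖iteratedFDeriv ℝ (l - i) f x‖) := by
            rw [mul_assoc, Finset.mul_sum]
            gcongr (2⁻¹) ^ n * ?_
            refine Finset.sum_le_sum fun i _ => ?_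
            have := hB i n x
            calc _ = (l.choose i) * ‖iteratedFDeriv ℝ i (fun y => dil n m₀ y - 1) x‖ *
                (‖x‖ ^ (k + 1) * ‖iteratedFDeriv ℝ (l - i) f x‖) := by ring
              _ ≤ _ := by gcongr
        _ ≤ (2⁻¹) ^ n * M := by
            gcongr (2⁻¹) ^ n * ?_
            refine Finset.sum_le_sum fun i _ => ?_
            have : 0 ≤ B i := by positivity
            gcongr
            exact SchwartzMap.le_seminorm ℂ (k + 1) (l - i) f x
        _ = _ := mul_comm _ _
  have hlim : Tendsto (fun n : ℕ => M * (2⁻¹ : ℝ) ^ n) atTop (𝓝 0) := by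
    simpa using (tendsto_pow_atTop_nhds_zero_of_lt_one (r := (2⁻¹ : ℝ)) (by norm_num)
      (by norm_num)).const_mul M
  filter_upwards [hlim.eventually_lt_const hε] with n hn
  exact (key n).trans_lt hn

/-- The symbols telescope to the dilated cutoff, and multiplication by the latter tends to the
identity in the Schwartz topology. Hence every tempered distribution is the sum of its blocks. -/
theorem IsResolution.tendsto_sum {β₀ : Eu d → ℂ} {m₀ m n₀ n : 𝓢(Eu d, ℂ)}
    (h : IsResolution β₀ m₀ m n₀ n) (w : 𝓢'(Eu d, ℂ)) (f : 𝓢(Eu d, ℂ)) :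
    Tendsto (fun N => ∑ k ∈ Finset.range N, w (mult (dyadicFamily m₀ m k) f)) atTop (𝓝 (w f)) := by
  rw [← tendsto_add_atTop_iff_nat 1]
  have h1 : ∀ N, ∑ k ∈ Finset.range (N + 1), w (mult (dyadicFamily m₀ m k) f) =
      w (FourierTransform.fourierCLM ℂ 𝓢(Eu d, ℂ) (smulS (dil N m₀) (𝓕⁻ f))) := fun N => by
    rw [← map_sum, ← mult_sum, h.sum]; rfl
  simp only [h1]
  have h2 : w f = w (FourierTransform.fourierCLM ℂ 𝓢(Eu d, ℂ) (𝓕⁻ f)) := by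
    have h3 : 𝓕 (𝓕⁻ f : 𝓢(Eu d, ℂ)) = f := FourierTransform.fourier_fourierInv_eq f
    exact congrArg w h3.symm
  rw [h2]
  have hc : Continuous w := ContinuousLinearMap.continuous (w : 𝓢(Eu d, ℂ) →L[ℂ] ℂ)
  exact ((hc.comp (FourierTransform.fourierCLM ℂ 𝓢(Eu d, ℂ)).continuous).tendsto _).comp
    (tendsto_smulS_dil h.one _)

theorem enorm_le_tsum_of_tendsto {a : ℕ → ℂ} {b : ℂ}
    (h : Tendsto (fun N => ∑ k ∈ Finset.range N, a k) atTop (𝓝 b)) : ‖b‖ₑ ≤ ∑' k, ‖a k‖ₑ :=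
  le_of_tendsto h.enorm (Eventually.of_forall fun _ => (enorm_sum_le _ _).trans
    (ENNReal.sum_le_tsum _))

/-- The transpose of an operator that is bounded, together with its transpose, in the Sobolev norms
acts in the Besov spaces. -/
theorem exists_besovENorm_precomp_le {β₀ : Eu d → ℂ} (hβ : IsCutoff β₀) (hpq : p.HolderConjugate q)
    (s : ℝ) {φ : ℝ → ℝ} (hφ : IsUpsilon φ) (T : 𝓢(Eu d, ℂ) →L[ℂ] 𝓢(Eu d, ℂ))
    {T' : 𝓢(Eu d, ℂ) → 𝓢(Eu d, ℂ)} (hT : IsSobolevBounded q T) (hT' : IsSobolevBounded p T')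
    (hTT' : IsTranspose T T') :
    ∃ C : ℝ≥0, ∀ w : 𝓢'(Eu d, ℂ), besovENorm β₀ s φ p (PointwiseConvergenceCLM.precomp ℂ T w) ≤
      C * besovENorm β₀ s φ p w := by
  obtain ⟨m₀, m, n₀, n, hr⟩ := exists_isResolution hβ
  obtain ⟨D, hD⟩ := exists_isSlowWeight hφ s
  obtain ⟨N, hN⟩ := pow_unbounded_of_one_lt (2 * D) (one_lt_two (α := ℝ))
  -- The estimate is used on test functions, in `L_q`. The wide family stands on the left because it
  -- is what remains after the block of `w` is split off, and the resolution on the right.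
  obtain ⟨C, hC⟩ := exists_almost_diagonal hpq.symm hT hT' hTT' N (m₀ := n₀) (n₀ := m₀)
    hr.annular_wide hr.annular
  refine ⟨4 * C, fun w => ?_⟩
  rw [besovENorm_eq, besovENorm_eq]
  refine (seqENorm_le_of_almost_diagonal hpq hD hN.le (C := C) fun j =>
    lpENorm_le_of_bound hpq fun f => ?_).trans (by push_cast; rfl)
  rw [hr.block_apply]
  change ‖w (T _)‖ₑ ≤ _
  -- Expand `w` into its blocks and insert the wide multiplier at each level `k`. Each term is then
  -- the block `w_k` tested on a function of small `L_q` norm.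
  refine (enorm_le_tsum_of_tendsto (hr.tendsto_sum w _)).trans ?_
  rw [← ENNReal.tsum_mul_right]
  refine ENNReal.tsum_le_tsum fun k => ?_
  rw [← hr.mult_wide, ← hr.block_apply]
  refine (enorm_apply_le_lpENorm hpq _ _).trans ?_
  refine (mul_le_mul_right (hC j k f) _).trans (le_of_eq ?_)
  ring

end DyadicFamilies

end RefinedBesov

namespace RefinedBesov

/-! ### Admissible functions with values in weighted `L_p` spaces -/

section ExponentialFamilies

variable {Y : Type*} [MeasurableSpace Y] {ν : Measure Y} {p : ℝ}

theorem norm_mul_cexp (g z : ℂ) (K : ℝ) : ‖g * Complex.exp (z * K)‖ = ‖g‖ * Real.exp (z.re * K) := by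
  rw [norm_mul, Complex.norm_exp, Complex.re_mul_ofReal]

theorem norm_mul_cexp_le {K : ℝ} (hK : K ≤ 0) {z : ℂ} (hz : 0 ≤ z.re) (g : ℂ) :
    ‖g * Complex.exp (z * K)‖ ≤ ‖g‖ := by
  rw [norm_mul_cexp]
  exact mul_le_of_le_one_right (norm_nonneg _)
    (Real.exp_le_one_iff.2 (mul_nonpos_of_nonneg_of_nonpos hz hK))

/-- From `x ≤ e^x`. The exponent `K` may be unbounded below, and this bound keeps the derivative in
`z` under control away from the line `Re z = 0`. -/
theorem abs_mul_exp_le {K δ : ℝ} (hK : K ≤ 0) (hδ : 0 < δ) {r : ℝ} (hr : δ ≤ r) :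
    |K| * Real.exp (r * K) ≤ δ⁻¹ := by
  have h1 : δ * |K| ≤ Real.exp (δ * |K|) := (lt_add_one _).le.trans (Real.add_one_le_exp _)
  have h2 : Real.exp (r * K) ≤ Real.exp (-(δ * |K|)) := by
    rw [Real.exp_le_exp, abs_of_nonpos hK]; nlinarith
  have h3 : Real.exp (δ * |K|) * Real.exp (-(δ * |K|)) = 1 := by rw [← Real.exp_add]; simp
  calc _ ≤ |K| * Real.exp (-(δ * |K|)) := by gcongr
    _ = δ⁻¹ * ((δ * |K|) * Real.exp (-(δ * |K|))) := by field_simp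
    _ ≤ δ⁻¹ * (Real.exp (δ * |K|) * Real.exp (-(δ * |K|))) := by gcongr
    _ = δ⁻¹ := by rw [h3, mul_one]

theorem norm_cexp_sub_le {K δ : ℝ} (hK : K ≤ 0) (hδ : 0 < δ) {z w : ℂ} (hz : δ ≤ z.re)
    (hw : δ ≤ w.re) : ‖Complex.exp (w * K) - Complex.exp (z * K)‖ ≤ δ⁻¹ * ‖w - z‖ := by
  have hconv : Convex ℝ {ζ : ℂ | δ ≤ ζ.re} := convex_halfSpace_re_ge δ
  refine hconv.norm_image_sub_le_of_norm_hasDerivWithin_le (f := fun ζ : ℂ => Complex.exp (ζ * K))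
    (f' := fun ζ => Complex.exp (ζ * K) * (1 * K)) (fun ζ _ => ?_) (fun ζ hζ => ?_) hz hw
  · exact (((hasDerivAt_id ζ).mul_const (K : ℂ)).cexp).hasDerivWithinAt
  · rw [one_mul, mul_comm, norm_mul_cexp, Complex.norm_real, Real.norm_eq_abs]
    exact abs_mul_exp_le hK hδ hζ

theorem memLp_ofReal_norm {g : Y → ℂ} (hg : MemLp g (ENNReal.ofReal p) ν) (c : ℝ) :
    MemLp (fun y => c * ‖g y‖) (ENNReal.ofReal p) ν := hg.norm.const_mul c

variable {g : Y → ℂ} {K : Y → ℝ}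

theorem measurable_mul_cexp (hg : Measurable g) (hK : Measurable K) (z : ℂ) :
    Measurable fun y => g y * Complex.exp (z * K y) :=
  hg.mul (Complex.measurable_exp.comp ((Complex.measurable_ofReal.comp hK).const_mul z))

theorem tendsto_mul_cexp (hp : 0 < p) (hg : Measurable g) (hK : Measurable K)
    (hgL : MemLp g (ENNReal.ofReal p) ν) {s : Set ℂ} (z : ℂ) (hz : z ∈ s)
    (hs : ∀ w ∈ s, ∀ y, ‖g y * Complex.exp (w * K y)‖ ≤ ‖g y‖) :
    Tendsto (fun w => eLpNorm (fun y => g y * Complex.exp (w * K y) - g y * Complex.exp (z * K y))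
      (ENNReal.ofReal p) ν) (𝓝[s] z) (𝓝 0) := by
  refine tendsto_eLpNorm_zero hp (G := fun y => 2 * ‖g y‖)
    (Eventually.of_forall fun w => (measurable_mul_cexp hg hK w).sub (measurable_mul_cexp hg hK z))
    (memLp_ofReal_norm hgL 2) ?_ fun y => ?_
  · filter_upwards [self_mem_nhdsWithin] with w hw y
    refine (norm_sub_le _ _).trans ?_
    rw [two_mul]
    exact add_le_add (hs w hw y) (hs z hz y)
  · have hc : Continuous fun w : ℂ => g y * Complex.exp (w * K y) - g y * Complex.exp (z * K y) := by
      fun_prop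
    have := hc.tendsto z
    rw [sub_self] at this
    exact this.mono_left nhdsWithin_le_nhds

theorem eLpNorm_deriv_mul_cexp_lt_top (hg : Measurable g) (hK : Measurable K)
    (hK0 : ∀ y, K y ≤ 0) (hgL : MemLp g (ENNReal.ofReal p) ν) {z : ℂ} (hz : 0 < z.re) :
    eLpNorm (fun y => K y * (g y * Complex.exp (z * K y))) (ENNReal.ofReal p) ν < ⊤ := by
  refine ((memLp_ofReal_norm hgL z.re⁻¹).mono'
    ((Complex.measurable_ofReal.comp hK).mul
      (measurable_mul_cexp hg hK z)).aestronglyMeasurable (ae_of_all _ fun y => ?_)).2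
  change ‖(K y : ℂ) * (g y * Complex.exp (z * K y))‖ ≤ _
  rw [norm_mul, norm_mul_cexp, Complex.norm_real, Real.norm_eq_abs]
  calc _ = |K y| * Real.exp (z.re * K y) * ‖g y‖ := by ring
    _ ≤ _ := by gcongr; exact abs_mul_exp_le (hK0 y) hz le_rfl

/-- Dominated convergence: the difference quotient and the derivative are each at most `δ⁻¹ |g|`. -/
theorem tendsto_slope_mul_cexp (hp : 0 < p) (hg : Measurable g) (hK : Measurable K)
    (hK0 : ∀ y, K y ≤ 0) (hgL : MemLp g (ENNReal.ofReal p) ν) {z : ℂ} (hz : 0 < z.re) :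
    Tendsto (fun w => eLpNorm (fun y => (w - z)⁻¹ * (g y * Complex.exp (w * K y) -
      g y * Complex.exp (z * K y)) - K y * (g y * Complex.exp (z * K y)))
      (ENNReal.ofReal p) ν) (𝓝[≠] z) (𝓝 0) := by
  -- Half the distance to the imaginary axis: for `w` near `z` both points lie in the convex
  -- half-plane `Re ≥ δ`, where the mean value inequality applies.
  set δ := z.re / 2 with hδ
  have hδ0 : 0 < δ := by positivity
  refine tendsto_eLpNorm_zero hp (G := fun y => (2 * δ⁻¹) * ‖g y‖) (Eventually.of_forall fun w => ?_)
    (memLp_ofReal_norm hgL _) ?_ fun y => ?_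
  · exact (((measurable_mul_cexp hg hK w).sub (measurable_mul_cexp hg hK z)).const_mul _).sub
      ((Complex.measurable_ofReal.comp hK).mul (measurable_mul_cexp hg hK z))
  · have hev : ∀ᶠ w in 𝓝[≠] z, δ < w.re := nhdsWithin_le_nhds
      ((isOpen_lt continuous_const Complex.continuous_re).mem_nhds (by
        change δ < z.re; linarith))
    filter_upwards [hev, self_mem_nhdsWithin] with w hw hwz y
    have hwz' : ‖w - z‖ ≠ 0 := norm_ne_zero_iff.2 (sub_ne_zero.2 hwz)
    refine (norm_sub_le _ _).trans ?_
    rw [two_mul, add_mul]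
    refine add_le_add ?_ ?_
    · rw [← mul_sub, norm_mul, norm_mul, norm_inv]
      calc _ ≤ ‖w - z‖⁻¹ * (‖g y‖ * (δ⁻¹ * ‖w - z‖)) := by
            gcongr
            exact norm_cexp_sub_le (hK0 y) hδ0 (by linarith) hw.le
        _ = _ := by field_simp
    · rw [norm_mul, norm_mul_cexp, Complex.norm_real, Real.norm_eq_abs]
      calc _ = |K y| * Real.exp (z.re * K y) * ‖g y‖ := by ring
        _ ≤ _ := by gcongr; exact abs_mul_exp_le (hK0 y) hδ0 (by linarith)
  · have hd : HasDerivAt (fun w : ℂ => g y * Complex.exp (w * K y))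
        (K y * (g y * Complex.exp (z * K y))) z := by
      have := (((hasDerivAt_id z).mul_const (K y : ℂ)).cexp).const_mul (g y)
      refine this.congr_deriv ?_
      simp only [id]; ring
    have := (hasDerivAt_iff_tendsto_slope.1 hd).sub_const (K y * (g y * Complex.exp (z * K y)))
    rw [sub_self] at this
    refine this.congr fun w => ?_
    rw [slope_def_module, smul_eq_mul]

end ExponentialFamilies

/-! ### Exponential families in couples of weighted `L_p` spaces -/

section ExponentialInterpolation

variable {Y : Type*} [MeasurableSpace Y] {ν : Measure Y} {p₀ p₁ : ℝ}

/-- The norm of the space `L_p` with a weight. -/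
noncomputable def weightedENorm (ν : Measure Y) (p : ℝ) (V : Y → ℝ) (c : Y → ℂ) : ℝ≥0∞ :=
  eLpNorm (fun y => V y * c y) (ENNReal.ofReal p) ν

theorem weightedENorm_mono {p : ℝ} {V : Y → ℝ} {c c' : Y → ℂ} (h : ∀ y, ‖c y‖ ≤ ‖c' y‖) :
    weightedENorm ν p V c ≤ weightedENorm ν p V c' :=
  eLpNorm_mono fun y => by
    rw [norm_mul, norm_mul]
    gcongr
    exact h y

/-- The functions `z ↦ G exp (z L)` are admissible for the couple of weighted `L_p` spaces. -/
theorem exists_isAdmissible_cexp (hp₀ : 0 < p₀) (hp₁ : 0 < p₁) (X : Submodule ℂ (Y → ℂ))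
    {V₀ V₁ : Y → ℝ} (hV₀ : Measurable V₀) (hV₁ : Measurable V₁)
    (hX₀ : ∀ c : Y → ℂ, Measurable c → weightedENorm ν p₀ V₀ c < ⊤ → c ∈ X)
    (hX₁ : ∀ c : Y → ℂ, Measurable c → weightedENorm ν p₁ V₁ c < ⊤ → c ∈ X)
    {G : Y → ℂ} (hG : Measurable G) {L : Y → ℝ} (hL : Measurable L)
    (hG₀ : weightedENorm ν p₀ V₀ G < ⊤)
    (hG₁ : weightedENorm ν p₁ V₁ (fun y => G y * Complex.exp (L y)) < ⊤) :
    ∃ f : ℂ → X, IsAdmissible (fun c : X => weightedENorm ν p₀ V₀ c)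
        (fun c : X => weightedENorm ν p₁ V₁ c) f ∧
      admissibleENorm (fun c : X => weightedENorm ν p₀ V₀ c)
        (fun c : X => weightedENorm ν p₁ V₁ c) f ≤
          max (weightedENorm ν p₀ V₀ G) (weightedENorm ν p₁ V₁ fun y => G y * Complex.exp (L y)) ∧
      ∀ z ∈ closedStrip, (f z : Y → ℂ) = fun y => G y * Complex.exp (z * L y) := by
  set G₁ : Y → ℂ := fun y => G y * Complex.exp (L y) with hG₁def
  have hG₁m : Measurable G₁ := by simpa [hG₁def] using measurable_mul_cexp hG hL 1
  have hE : MeasurableSet {y | L y ≤ 0} := measurableSet_le hL measurable_const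
  -- Where `L ≤ 0` the family is dominated by its values on the line `Re z = 0` and belongs to the
  -- first space. Elsewhere it is dominated by its values on `Re z = 1` and belongs to the second.
  -- This is the splitting in the sum of the two spaces.
  set g₀ : Y → ℂ := {y | L y ≤ 0}.indicator G with hg₀
  set g₁ : Y → ℂ := {y | L y ≤ 0}ᶜ.indicator G₁ with hg₁
  set K₀ : Y → ℝ := fun y => min (L y) 0
  set K₁ : Y → ℝ := fun y => min (-L y) 0
  have hg₀m : Measurable g₀ := hG.indicator hE
  have hg₁m : Measurable g₁ := hG₁m.indicator hE.compl
  have hK₀m : Measurable K₀ := hL.min measurable_const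
  have hK₁m : Measurable K₁ := hL.neg.min measurable_const
  have hK₀ : ∀ y, K₀ y ≤ 0 := fun y => min_le_right _ _
  have hK₁ : ∀ y, K₁ y ≤ 0 := fun y => min_le_right _ _
  have hVm : ∀ {V : Y → ℝ}, Measurable V → Measurable fun y => (V y : ℂ) := fun h =>
    Complex.measurable_ofReal.comp h
  have hVmul : ∀ {V : Y → ℝ} {H : Y → ℂ}, Measurable V → Measurable H →
      Measurable fun y => (V y : ℂ) * H y := fun hV hH => (hVm hV).mul hH
  have hsymm : ∀ w ∈ closedStrip, 1 - w ∈ closedStrip := fun w hw => by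
    have h1 : (1 - w).re = 1 - w.re := by simp
    exact ⟨by rw [h1]; linarith [hw.2], by rw [h1]; linarith [hw.1]⟩
  have hn₀ : weightedENorm ν p₀ V₀ g₀ ≤ weightedENorm ν p₀ V₀ G :=
    weightedENorm_mono fun y => norm_indicator_le_norm_self _ _
  have hn₁ : weightedENorm ν p₁ V₁ g₁ ≤ weightedENorm ν p₁ V₁ G₁ :=
    weightedENorm_mono fun y => norm_indicator_le_norm_self _ _
  have hM₀ : MemLp (fun y => V₀ y * g₀ y) (ENNReal.ofReal p₀) ν :=
    ⟨(hVmul hV₀ hg₀m).aestronglyMeasurable, hn₀.trans_lt hG₀⟩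
  have hM₁ : MemLp (fun y => V₁ y * g₁ y) (ENNReal.ofReal p₁) ν :=
    ⟨(hVmul hV₁ hg₁m).aestronglyMeasurable, hn₁.trans_lt hG₁⟩
  let P₀ : ℂ → Y → ℂ := fun z y => g₀ y * Complex.exp (z * K₀ y)
  -- With `1 - z` in place of `z` and `-L` in place of `L` the second part has again a nonpositive
  -- exponent, so the same lemmas serve both parts.
  let P₁ : ℂ → Y → ℂ := fun z y => g₁ y * Complex.exp ((1 - z) * K₁ y)
  have hP₀ : ∀ z, 0 ≤ z.re → P₀ z ∈ X := fun z hz => hX₀ _ (measurable_mul_cexp hg₀m hK₀m z)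
    ((weightedENorm_mono fun y => norm_mul_cexp_le (hK₀ y) hz _).trans_lt (hn₀.trans_lt hG₀))
  have hre : ∀ z : ℂ, z.re ≤ 1 → 0 ≤ (1 - z).re := fun z hz => by
    rw [Complex.sub_re, Complex.one_re]; linarith
  have hP₁ : ∀ z, z.re ≤ 1 → P₁ z ∈ X := fun z hz => hX₁ _ (measurable_mul_cexp hg₁m hK₁m (1 - z))
    ((weightedENorm_mono fun y => norm_mul_cexp_le (hK₁ y) (hre z hz) _).trans_lt
      (hn₁.trans_lt hG₁))
  have hsum : ∀ z y, P₀ z y + P₁ z y = G y * Complex.exp (z * L y) := fun z y => by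
    by_cases hy : L y ≤ 0
    · have h1 : y ∉ {y | L y ≤ 0}ᶜ := fun h => h hy
      simp only [P₀, P₁, K₀, hg₀, hg₁, indicator_of_notMem h1, min_eq_left hy]
      rw [indicator_of_mem (show y ∈ {y | L y ≤ 0} from hy)]
      simp
    · have h1 : y ∈ {y | L y ≤ 0}ᶜ := hy
      have h2 : -L y ≤ 0 := by linarith [not_le.1 hy]
      simp only [P₀, P₁, K₁, hg₀, hg₁, indicator_of_mem h1, min_eq_left h2]
      rw [indicator_of_notMem (show y ∉ {y | L y ≤ 0} from hy), hG₁def]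
      simp only [zero_mul, zero_add]
      rw [mul_assoc, ← Complex.exp_add]
      congr 2
      push_cast; ring
  -- Membership in `X` is known only in a half-plane for each part; the value `0` beyond it is
  -- irrelevant, as only the closed strip matters.
  let p0 : ℂ → X := fun z => if h : 0 ≤ z.re then ⟨P₀ z, hP₀ z h⟩ else 0
  let p1 : ℂ → X := fun z => if h : z.re ≤ 1 then ⟨P₁ z, hP₁ z h⟩ else 0
  have hp0 : ∀ z, 0 ≤ z.re → (p0 z : Y → ℂ) = P₀ z := fun z hz => by simp [p0, hz]
  have hp1 : ∀ z, z.re ≤ 1 → (p1 z : Y → ℂ) = P₁ z := fun z hz => by simp [p1, hz]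
  have hf : ∀ z ∈ closedStrip, ((p0 z + p1 z : X) : Y → ℂ) = fun y => G y * Complex.exp (z * L y) :=
    fun z hz => by
      funext y
      rw [Submodule.coe_add, hp0 z hz.1, hp1 z hz.2]
      exact hsum z y
  have hitm : ∀ t : ℝ, (t * Complex.I : ℂ) ∈ closedStrip := fun t => by simp [closedStrip]
  have h1itm : ∀ t : ℝ, (1 + t * Complex.I : ℂ) ∈ closedStrip := fun t => by simp [closedStrip]
  have hleft : ∀ t : ℝ, ∀ y, ‖G y * Complex.exp ((t * Complex.I : ℂ) * L y)‖ = ‖G y‖ := fun t y => by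
    rw [norm_mul_cexp]; simp
  have hright : ∀ t : ℝ, ∀ y, G y * Complex.exp ((1 + t * Complex.I : ℂ) * L y) =
      G₁ y * Complex.exp ((t * Complex.I : ℂ) * L y) := fun t y => by
    rw [hG₁def, add_mul, one_mul, Complex.exp_add]; ring
  have hright' : ∀ t : ℝ, ∀ y, ‖G₁ y * Complex.exp ((t * Complex.I : ℂ) * L y)‖ = ‖G₁ y‖ :=
    fun t y => by rw [norm_mul_cexp]; simp
  have hN₀ : ∀ t : ℝ, weightedENorm ν p₀ V₀ (p0 (t * Complex.I) + p1 (t * Complex.I) : X) ≤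
      weightedENorm ν p₀ V₀ G := fun t => by
    rw [hf _ (hitm t)]
    exact weightedENorm_mono fun y => (hleft t y).le
  have hN₁ : ∀ t : ℝ, weightedENorm ν p₁ V₁ (p0 (1 + t * Complex.I) + p1 (1 + t * Complex.I) : X) ≤
      weightedENorm ν p₁ V₁ G₁ := fun t => by
    rw [hf _ (h1itm t)]
    exact weightedENorm_mono fun y => by rw [hright, hright']
  have hdiff : ∀ {V : Y → ℝ} {a b : Y → ℂ}, (fun y => (V y : ℂ) * (a - b) y) =
      fun y => V y * a y - V y * b y := by
    intro V a b; funext y; rw [Pi.sub_apply, mul_sub]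
  -- On a vertical line the exponential factor has constant modulus, so continuity in the endpoint
  -- norm holds without splitting, however large `L` is.
  have haxis : ∀ {p : ℝ} {V : Y → ℝ} {H : Y → ℂ}, 0 < p → Measurable V → Measurable H →
      weightedENorm ν p V H < ⊤ → ∀ t : ℝ, Tendsto (fun r : ℝ => weightedENorm ν p V
        ((fun y => H y * Complex.exp ((r * Complex.I : ℂ) * L y)) -
          fun y => H y * Complex.exp ((t * Complex.I : ℂ) * L y))) (𝓝 t) (𝓝 0) := by
    intro p V H hp hV hH hfin t
    have hMem : MemLp (fun y => V y * H y) (ENNReal.ofReal p) ν :=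
      ⟨(hVmul hV hH).aestronglyMeasurable, hfin⟩
    have h1 := tendsto_mul_cexp (s := {w : ℂ | w.re = 0}) hp (hVmul hV hH) hL hMem
      (t * Complex.I) (by simp) (fun w hw y => by
        have hw0 : w.re = 0 := hw
        rw [norm_mul_cexp, hw0]; simp)
    have h2 : Tendsto (fun r : ℝ => (r * Complex.I : ℂ)) (𝓝 t)
        (𝓝[{w : ℂ | w.re = 0}] (t * Complex.I)) := by
      refine tendsto_nhdsWithin_iff.2 ⟨?_, Eventually.of_forall fun r => by simp⟩
      exact (by fun_prop : Continuous fun r : ℝ => (r * Complex.I : ℂ)).tendsto t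
    refine (h1.comp h2).congr fun r => ?_
    simp only [Function.comp, weightedENorm, hdiff, mul_assoc]
  refine ⟨fun z => p0 z + p1 z, ⟨?_, fun z hz => ?_, fun z hz => ?_, fun t => (hN₀ t).trans_lt hG₀,
    fun t => (hN₁ t).trans_lt hG₁, fun t => ?_, fun t => ?_⟩, ?_, hf⟩
  · refine ⟨(weightedENorm ν p₀ V₀ G + weightedENorm ν p₁ V₁ G₁).toNNReal, fun z hz => ?_⟩
    rw [ENNReal.coe_toNNReal (ENNReal.add_ne_top.2 ⟨hG₀.ne, hG₁.ne⟩)]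
    refine (sumENorm_le _ _ rfl).trans (add_le_add ?_ ?_)
    · simp only [hp0 z hz.1]
      exact (weightedENorm_mono fun y => norm_mul_cexp_le (hK₀ y) hz.1 _).trans hn₀
    · simp only [hp1 z hz.2]
      exact (weightedENorm_mono fun y => norm_mul_cexp_le (hK₁ y) (hre z hz.2) _).trans hn₁
  · have h0 := tendsto_mul_cexp (s := closedStrip) hp₀ (hVmul hV₀ hg₀m) hK₀m hM₀ z hz
      (fun w hw y => norm_mul_cexp_le (hK₀ y) hw.1 _)
    have h1 := tendsto_mul_cexp (s := closedStrip) hp₁ (hVmul hV₁ hg₁m) hK₁m hM₁ (1 - z)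
      (hsymm z hz)
      (fun w hw y => norm_mul_cexp_le (hK₁ y) hw.1 _)
    have h1' : Tendsto (fun w : ℂ => 1 - w) (𝓝[closedStrip] z) (𝓝[closedStrip] (1 - z)) := by
      refine tendsto_nhdsWithin_iff.2 ⟨((by fun_prop : Continuous fun w : ℂ => 1 - w).tendsto
        z).mono_left nhdsWithin_le_nhds, ?_⟩
      filter_upwards [self_mem_nhdsWithin] with w hw
      exact hsymm w hw
    have hadd := h0.add (h1.comp h1')
    rw [add_zero] at hadd
    refine tendsto_of_tendsto_of_tendsto_of_le_of_le' tendsto_const_nhds hadd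
      (Eventually.of_forall fun _ => zero_le) ?_
    filter_upwards [self_mem_nhdsWithin] with w hw
    refine (sumENorm_le _ _ (a := p0 w - p0 z) (b := p1 w - p1 z) (by abel)).trans
      (le_of_eq ?_)
    simp only [AddSubgroupClass.coe_sub, hp0 w hw.1, hp0 z hz.1, hp1 w hw.2, hp1 z hz.2,
      weightedENorm, hdiff, P₀, P₁, Function.comp, mul_assoc]
  · have hz0 : 0 < z.re := hz.1
    have hz1 : 0 < (1 - z).re := by
      have := hz.2; rw [Complex.sub_re, Complex.one_re]; linarith
    have h0 := tendsto_slope_mul_cexp hp₀ (hVmul hV₀ hg₀m) hK₀m hK₀ hM₀ hz0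
    have h1 := tendsto_slope_mul_cexp hp₁ (hVmul hV₁ hg₁m) hK₁m hK₁ hM₁ hz1
    have hd0 := eLpNorm_deriv_mul_cexp_lt_top (hVmul hV₀ hg₀m) hK₀m hK₀ hM₀ hz0
    have hd1 := eLpNorm_deriv_mul_cexp_lt_top (hVmul hV₁ hg₁m) hK₁m hK₁ hM₁ hz1
    let D₀ : Y → ℂ := fun y => K₀ y * P₀ z y
    let D₁ : Y → ℂ := fun y => -(K₁ y * P₁ z y)
    have hD₀ : weightedENorm ν p₀ V₀ D₀ < ⊤ := by
      refine lt_of_eq_of_lt ?_ hd0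
      simp only [weightedENorm, D₀, P₀]
      congr 1; funext y; ring
    have hD₁ : weightedENorm ν p₁ V₁ D₁ < ⊤ := by
      refine lt_of_eq_of_lt ?_ hd1
      refine eLpNorm_congr_norm_ae (ae_of_all _ fun y => ?_)
      simp only [D₁, P₁, norm_mul, norm_neg]; ring
    have hD₀m : Measurable D₀ := (hVm hK₀m).mul (measurable_mul_cexp hg₀m hK₀m z)
    have hD₁m : Measurable D₁ := ((hVm hK₁m).mul (measurable_mul_cexp hg₁m hK₁m (1 - z))).neg
    let d0 : X := ⟨D₀, hX₀ _ hD₀m hD₀⟩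
    let d1 : X := ⟨D₁, hX₁ _ hD₁m hD₁⟩
    refine ⟨d0 + d1, (sumENorm_le _ _ rfl).trans_lt (ENNReal.add_lt_top.2 ⟨hD₀, hD₁⟩), ?_⟩
    have h1' : Tendsto (fun w : ℂ => 1 - w) (𝓝[≠] z) (𝓝[≠] (1 - z)) := by
      refine tendsto_nhdsWithin_iff.2 ⟨((by fun_prop : Continuous fun w : ℂ => 1 - w).tendsto
        z).mono_left nhdsWithin_le_nhds, ?_⟩
      filter_upwards [self_mem_nhdsWithin] with w hw h
      exact hw (sub_right_injective h)
    have hadd := h0.add (h1.comp h1')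
    rw [add_zero] at hadd
    refine tendsto_of_tendsto_of_tendsto_of_le_of_le' tendsto_const_nhds hadd
      (Eventually.of_forall fun _ => zero_le) ?_
    have hopen : ∀ᶠ w in 𝓝[≠] z, 0 < w.re ∧ w.re < 1 := nhdsWithin_le_nhds
      (((isOpen_lt continuous_const Complex.continuous_re).inter
        (isOpen_lt Complex.continuous_re continuous_const)).mem_nhds hz)
    filter_upwards [hopen] with w hw
    refine (sumENorm_le _ _ (a := (w - z)⁻¹ • (p0 w - p0 z) - d0)
      (b := (w - z)⁻¹ • (p1 w - p1 z) - d1) ?_).trans (le_of_eq ?_)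
    · rw [show p0 w + p1 w - (p0 z + p1 z) = (p0 w - p0 z) + (p1 w - p1 z) by abel, smul_add]
      abel
    · congr 1
      · simp only [AddSubgroupClass.coe_sub, Submodule.coe_smul, hp0 w hw.1.le, hp0 z hz.1.le,
          weightedENorm, d0, D₀, P₀]
        congr 1; funext y
        simp only [Pi.sub_apply, Pi.smul_apply, smul_eq_mul]; ring
      · simp only [AddSubgroupClass.coe_sub, Submodule.coe_smul, hp1 w hw.2.le, hp1 z hz.2.le,
          weightedENorm, d1, D₁, P₁, Function.comp]
        refine eLpNorm_congr_norm_ae (ae_of_all _ fun y => ?_)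
        rw [← norm_neg]
        congr 1
        have hi : (1 - w - (1 - z))⁻¹ = -(w - z)⁻¹ := by
          rw [← inv_neg]; congr 1; ring
        rw [hi]
        simp only [Pi.sub_apply, Pi.smul_apply, smul_eq_mul]; ring
  · refine (haxis hp₀ hV₀ hG hG₀ t).congr fun r => ?_
    simp only [AddSubgroupClass.coe_sub, hf _ (hitm _)]
  · refine (haxis hp₁ hV₁ hG₁m hG₁ t).congr fun r => ?_
    simp only [AddSubgroupClass.coe_sub, hf _ (h1itm _), hright]
  · exact max_le_max (iSup_le hN₀) (iSup_le hN₁)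

end ExponentialInterpolation

end RefinedBesov

namespace RefinedBesov

open scoped FourierTransform LineDeriv

/-! ### Synthesis of distributions from their dyadic blocks -/

section Synthesis

variable {d : ℕ} {p q : ℝ}

/-- Schwartz functions embed continuously in `L_p`, and each further order of differentiation is a
finite sum of continuous operators. This makes synthesized functionals tempered. -/
theorem exists_seminorm_derivNorm_le (hpq : p.HolderConjugate q) (N : ℕ) :
    ∃ Q : Seminorm ℂ 𝓢(Eu d, ℂ), Continuous Q ∧
      ∀ f, derivNorm p N f ≤ ENNReal.ofReal (Q f) := by
  induction N with
  | zero =>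
    have := fact_one_le_ofReal hpq
    let T := SchwartzMap.toLpCLM ℂ ℂ (ENNReal.ofReal p) (volume : Measure (Eu d))
    refine ⟨(normSeminorm ℂ _).comp T.toLinearMap, continuous_norm.comp T.continuous, fun f => ?_⟩
    change _ ≤ ENNReal.ofReal ‖f.toLp (ENNReal.ofReal p) volume‖
    rw [derivNorm_zero, SchwartzMap.norm_toLp, ENNReal.ofReal_toReal (eLpNorm_schwartz_ne_top f _)]
  | succ N ih =>
    obtain ⟨Q, hQ, hle⟩ := ih
    let D : Fin d → 𝓢(Eu d, ℂ) →L[ℂ] 𝓢(Eu d, ℂ) := fun a =>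
      LineDeriv.lineDerivOpCLM ℂ 𝓢(Eu d, ℂ) (EuclideanSpace.single a (1 : ℝ))
    refine ⟨∑ a, Q.comp (D a).toLinearMap, ?_, fun f => ?_⟩
    · have : ⇑(∑ a, Q.comp (D a).toLinearMap) = fun f => ∑ a, Q (D a f) := by
        funext f; rw [sum_apply]; rfl
      rw [this]
      exact continuous_finsetSum _ fun a _ => hQ.comp (D a).continuous
    · refine (derivNorm_succ_le hpq N f).trans ?_
      rw [sum_apply, ENNReal.ofReal_sum_of_nonneg fun a _ => apply_nonneg _ _]
      exact Finset.sum_le_sum fun a _ => hle (D a f)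

/-- The measurable sequences of functions that can be synthesized. -/
def tame (n₀ n : 𝓢(Eu d, ℂ)) : Submodule ℂ (ℕ × Eu d → ℂ) where
  -- The factor `(1/2)^k` makes the synthesis series converge to a continuous functional. The
  -- condition mentions neither weight nor exponent, so both endpoint spaces lie in this one
  -- submodule.
  carrier := {c | Measurable c ∧ (∀ k (f : 𝓢(Eu d, ℂ)), Integrable fun x => f x * c (k, x)) ∧
    ∃ Q : Seminorm ℂ 𝓢(Eu d, ℂ), Continuous Q ∧
      ∀ k f, ‖∫ x, mult (dyadicFamily n₀ n k) f x * c (k, x)‖ ≤ (1 / 2) ^ k * Q f}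
  add_mem' := by
    rintro a b ⟨ha, ha', Q, hQ, hQa⟩ ⟨hb, hb', R, hR, hRb⟩
    refine ⟨ha.add hb, fun k f => ?_, Q + R, hQ.add hR, fun k f => ?_⟩
    · simp only [Pi.add_apply, mul_add]
      exact (ha' k f).add (hb' k f)
    · simp only [Pi.add_apply, mul_add]
      rw [integral_add (ha' k _) (hb' k _)]
      refine (norm_add_le _ _).trans ?_
      rw [add_apply, mul_add]
      exact add_le_add (hQa k f) (hRb k f)
  zero_mem' := ⟨measurable_const, fun k f => by simp, 0, continuous_const, fun k f => by simp⟩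
  smul_mem' := by
    rintro r a ⟨ha, ha', Q, hQ, hQa⟩
    have e : ∀ (f : 𝓢(Eu d, ℂ)) k x, f x * (r • a) (k, x) = r * (f x * a (k, x)) := fun f k x => by
      simp only [Pi.smul_apply, smul_eq_mul]; ring
    refine ⟨ha.const_smul r, fun k f => ?_, ‖r‖₊ • Q, hQ.const_smul ‖r‖₊, fun k f => ?_⟩
    · simp only [e]; exact (ha' k f).const_mul r
    · simp only [e]
      rw [integral_const_mul, norm_mul, smul_apply, NNReal.smul_def, coe_nnnorm,
        smul_eq_mul, mul_left_comm]
      gcongr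
      exact hQa k f

variable {n₀ n : 𝓢(Eu d, ℂ)}

theorem summable_tame (c : tame n₀ n) (f : 𝓢(Eu d, ℂ)) :
    Summable fun k => ∫ x, mult (dyadicFamily n₀ n k) f x * c.1 (k, x) := by
  obtain ⟨-, -, Q, -, hQc⟩ := c.2
  exact Summable.of_norm_bounded (summable_geometric_two.mul_right (Q f)) fun k => hQc k f

/-- The distribution `∑ 𝓕⁻¹ [n_k 𝓕 c_k]`. -/
noncomputable def synthCLM (c : tame n₀ n) : 𝓢(Eu d, ℂ) →L[ℂ] ℂ :=
  let l : 𝓢(Eu d, ℂ) →ₗ[ℂ] ℂ :=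
    { toFun := fun f => ∑' k, ∫ x, mult (dyadicFamily n₀ n k) f x * c.1 (k, x)
      map_add' := fun f g => by
        rw [← (summable_tame c f).tsum_add (summable_tame c g)]
        congr 1; funext k
        rw [← integral_add (c.2.2.1 k _) (c.2.2.1 k _)]
        simp only [map_add, add_apply, add_mul]
      map_smul' := fun r f => by
        rw [RingHom.id_apply, smul_eq_mul, ← tsum_mul_left]
        congr 1; funext k
        rw [← integral_const_mul]
        simp only [map_smul, smul_apply, smul_eq_mul, mul_assoc] }
  ⟨l, by
    obtain ⟨-, -, Q, hQ, hQc⟩ := c.2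
    refine continuous_of_continuousAt_zero l ?_
    have hb : ∀ f, ‖l f‖ ≤ 2 * Q f := fun f => by
      have h1 : Summable fun k : ℕ => (1 / 2 : ℝ) ^ k * Q f := summable_geometric_two.mul_right _
      refine (tsum_of_norm_bounded h1.hasSum fun k => hQc k f).trans (le_of_eq ?_)
      rw [tsum_mul_right, tsum_geometric_two]
    have h0 : Tendsto (fun f => 2 * Q f) (𝓝 0) (𝓝 0) := by
      have := (hQ.const_mul 2).tendsto (0 : 𝓢(Eu d, ℂ))
      rwa [map_zero, mul_zero] at this
    rw [ContinuousAt, map_zero]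
    exact squeeze_zero_norm hb h0⟩

/-- The synthesis operator. -/
noncomputable def synth (n₀ n : 𝓢(Eu d, ℂ)) : tame n₀ n →ₗ[ℂ] 𝓢'(Eu d, ℂ) where
  toFun c := synthCLM c
  map_add' a b := by
    refine DFunLike.ext _ _ fun f => ?_
    refine Eq.trans ?_ ((summable_tame a f).tsum_add (summable_tame b f))
    refine tsum_congr fun k => ?_
    rw [← integral_add (a.2.2.1 k _) (b.2.2.1 k _)]
    exact integral_congr_ae (ae_of_all _ fun x => mul_add _ _ _)
  map_smul' r a := by
    refine DFunLike.ext _ _ fun f => ?_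
    refine Eq.trans ?_ (tsum_mul_left (a := r)
      (f := fun k => ∫ x, mult (dyadicFamily n₀ n k) f x * a.1 (k, x)))
    refine tsum_congr fun k => ?_
    rw [← integral_const_mul]
    exact integral_congr_ae (ae_of_all _ fun x => mul_left_comm _ _ _)

theorem synth_apply (c : tame n₀ n) (f : 𝓢(Eu d, ℂ)) :
    synth n₀ n c f = ∑' k, ∫ x, mult (dyadicFamily n₀ n k) f x * c.1 (k, x) := rfl

/-- Summation and integration carry the same exponent, so by Tonelli the sequence norm is a weighted
`L_p` norm over the product `ℕ × ℝ^d`. -/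
theorem weightedENorm_eq_seqENorm (hp : 0 < p) {W : ℕ → ℝ} (hW : ∀ k, 0 < W k)
    {c : ℕ × Eu d → ℂ} (hc : Measurable c) :
    weightedENorm ((Measure.count : Measure ℕ).prod volume) p (fun y => W y.1) c =
      seqENorm p W fun k => eLpNorm (fun x => c (k, x)) (ENNReal.ofReal p) volume := by
  have hm : Measurable fun y : ℕ × Eu d => ‖(W y.1 : ℂ) * c y‖ₑ ^ p :=
    (((Complex.measurable_ofReal.comp (Measurable.of_discrete.comp measurable_fst)).mul
      hc).enorm).pow_const p
  rw [weightedENorm, eLpNorm_ofReal hp, seqENorm, lintegral_prod _ hm.aemeasurable, lintegral_count]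
  congr 2; funext k
  have e : ∀ x, ‖(W k : ℂ) * c (k, x)‖ₑ ^ p = ENNReal.ofReal (W k) ^ p * ‖c (k, x)‖ₑ ^ p := fun x => by
    rw [enorm_mul, ENNReal.mul_rpow_of_nonneg _ _ hp.le]
    congr 2
    rw [← ofReal_norm, Complex.norm_real, Real.norm_of_nonneg (hW k).le]
  simp only [e]
  rw [lintegral_const_mul' _ _ (ENNReal.rpow_ne_top_of_nonneg hp.le ENNReal.ofReal_ne_top),
    ENNReal.mul_rpow_of_nonneg _ _ hp.le, eLpNorm_ofReal hp, ← ENNReal.rpow_mul,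
    one_div_mul_cancel hp.ne', ENNReal.rpow_one]

/-- The size of the `k`th entry may grow like `1 / W_k ≤ D^k / W_0`, which the decay of annular
multipliers on Schwartz functions outweighs. -/
theorem mem_tame (hpq : p.HolderConjugate q) {W : ℕ → ℝ} {D : ℝ} (hW : IsSlowWeight W D)
    (hn : IsAnnular n) {c : ℕ × Eu d → ℂ} (hc : Measurable c)
    (hfin : weightedENorm ((Measure.count : Measure ℕ).prod volume) p (fun y => W y.1) c < ⊤) :
    c ∈ tame n₀ n := by
  have hp := hpq.pos
  rw [weightedENorm_eq_seqENorm hp hW.pos hc] at hfin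
  set S := seqENorm p W fun k => eLpNorm (fun x => c (k, x)) (ENNReal.ofReal p) volume
  have hck : ∀ k, Measurable fun x => c (k, x) := fun k => hc.comp measurable_prodMk_left
  have hle : ∀ k, eLpNorm (fun x => c (k, x)) (ENNReal.ofReal p) volume ≤
      ENNReal.ofReal (W k)⁻¹ * S := fun k => by
    have h := weight_mul_le_seqENorm hp W
      (fun k => eLpNorm (fun x => c (k, x)) (ENNReal.ofReal p) volume) k
    calc _ = ENNReal.ofReal (W k)⁻¹ * (ENNReal.ofReal (W k) *
          eLpNorm (fun x => c (k, x)) (ENNReal.ofReal p) volume) := by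
          rw [← mul_assoc, ← ENNReal.ofReal_mul (inv_nonneg.2 (hW.pos k).le),
            inv_mul_cancel₀ (hW.pos k).ne', ENNReal.ofReal_one, one_mul]
      _ ≤ _ := by gcongr
  have hmem : ∀ k, MemLp (fun x => c (k, x)) (ENNReal.ofReal p) volume := fun k =>
    ⟨(hck k).aestronglyMeasurable,
      (hle k).trans_lt (ENNReal.mul_lt_top ENNReal.ofReal_lt_top hfin)⟩
  have hconj := hpq.symm.ennrealOfReal
  refine ⟨hc, fun k f => (f.memLp (ENNReal.ofReal q) volume).integrable_mul (hmem k), ?_⟩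
  -- With `2 D < 2^N` the product of `D^k` and `2^{-kN}` is at most `2^{-k}`.
  obtain ⟨N, hN⟩ := pow_unbounded_of_one_lt (2 * D) (one_lt_two (α := ℝ))
  obtain ⟨C, hC⟩ := exists_eLpNorm_mult_dyadicFamily_le hpq.symm N n₀ n hn
  obtain ⟨Q₀, hQ₀, hQ₀'⟩ := exists_seminorm_derivNorm_le (d := d) hpq.symm 0
  obtain ⟨Q₁, hQ₁, hQ₁'⟩ := exists_seminorm_derivNorm_le (d := d) hpq.symm N
  let B : ℝ≥0 := (W 0)⁻¹.toNNReal * S.toNNReal * C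
  refine ⟨B • (Q₀ + Q₁), (hQ₀.add hQ₁).const_smul B, fun k f => ?_⟩
  have hQ0 : 0 ≤ (Q₀ + Q₁) f := apply_nonneg _ _
  rw [← ENNReal.ofReal_le_ofReal_iff (mul_nonneg (by positivity) (apply_nonneg _ _)), ofReal_norm]
  refine (enorm_integral_mul_le hpq (SchwartzMap.continuous _).aestronglyMeasurable
    (hck k).aestronglyMeasurable).trans ?_
  have hWk : (W k)⁻¹ ≤ D ^ k * (W 0)⁻¹ := by
    have := hW.le_pow 0 k
    rw [Nat.zero_sub, Nat.sub_zero, zero_add] at this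
    have h0 := hW.pos 0
    have hk := hW.pos k
    rw [← div_eq_mul_inv, le_div_iff₀ h0, inv_mul_le_iff₀ hk]
    linarith
  have hD0 : 0 ≤ D := zero_le_one.trans hW.one_le
  have hpow : D ^ k * (2⁻¹ : ℝ) ^ (k * N) ≤ (1 / 2) ^ k := by
    rw [mul_comm k N, pow_mul, ← mul_pow]
    gcongr
    rw [inv_pow, ← div_eq_mul_inv, div_le_div_iff₀ (by positivity) two_pos]
    linarith
  have e2 : (2⁻¹ : ℝ≥0∞) ^ (k * N) = ENNReal.ofReal (2⁻¹ ^ (k * N)) := by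
    rw [ENNReal.ofReal_pow (by norm_num), ENNReal.ofReal_inv_of_pos two_pos, ENNReal.ofReal_ofNat]
  calc _ ≤ (ENNReal.ofReal (D ^ k * (W 0)⁻¹) * S) * (C * ENNReal.ofReal (2⁻¹ ^ (k * N)) *
        (ENNReal.ofReal (Q₀ f) + ENNReal.ofReal (Q₁ f))) := by
        refine mul_le_mul' ((hle k).trans ?_) ((hC k f).trans ?_)
        · gcongr
        · rw [e2]
          gcongr
          · exact hQ₀' f
          · exact hQ₁' f
    _ = ENNReal.ofReal (D ^ k * (2⁻¹ : ℝ) ^ (k * N)) * (ENNReal.ofReal ((W 0)⁻¹) * S * C *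
        ENNReal.ofReal ((Q₀ + Q₁) f)) := by
        rw [add_apply, ENNReal.ofReal_add (apply_nonneg _ _) (apply_nonneg _ _),
          ENNReal.ofReal_mul (by positivity), ENNReal.ofReal_mul (by positivity)]
        ring
    _ ≤ ENNReal.ofReal ((1 / 2) ^ k) * (ENNReal.ofReal ((W 0)⁻¹) * S * C *
        ENNReal.ofReal ((Q₀ + Q₁) f)) := by gcongr
    _ = _ := by
        rw [ENNReal.ofReal_mul (by positivity)]
        congr 1
        rw [smul_apply, NNReal.smul_def, smul_eq_mul, ENNReal.ofReal_mul (by positivity)]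
        congr 1
        rw [ENNReal.ofReal_coe_nnreal]
        simp only [B, ENNReal.coe_mul]
        rw [ENNReal.coe_toNNReal hfin.ne]
        rfl

/-- The almost diagonal estimate for the identity operator, with the wide family acting on the
entries and the resolution extracting the blocks. -/
theorem exists_besovENorm_synth_le {β₀ : Eu d → ℂ} {m₀ m : 𝓢(Eu d, ℂ)}
    (hr : IsResolution β₀ m₀ m n₀ n) (hpq : p.HolderConjugate q) (s : ℝ) {φ : ℝ → ℝ}
    (hφ : IsUpsilon φ) :
    ∃ C : ℝ≥0, ∀ c : tame n₀ n, besovENorm β₀ s φ p (synth n₀ n c) ≤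
      C * weightedENorm ((Measure.count : Measure ℕ).prod volume) p (fun y => weight s φ y.1) c.1 := by
  obtain ⟨D, hD⟩ := exists_isSlowWeight hφ s
  obtain ⟨N, hN⟩ := pow_unbounded_of_one_lt (2 * D) (one_lt_two (α := ℝ))
  obtain ⟨C, hC⟩ := exists_almost_diagonal (d := d) hpq.symm (T := id) (T' := id)
    (isSobolevBounded_id q) (isSobolevBounded_id p) (fun f g => rfl) N (m₀ := n₀) (n₀ := m₀)
    hr.annular_wide hr.annular
  refine ⟨4 * C, fun c => ?_⟩
  rw [weightedENorm_eq_seqENorm hpq.pos (weight_pos hφ s) c.2.1, besovENorm_eq]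
  refine (seqENorm_le_of_almost_diagonal hpq hD hN.le (C := C) fun j =>
    lpENorm_le_of_bound hpq fun f => ?_).trans (by push_cast; rfl)
  rw [hr.block_apply, synth_apply]
  refine (enorm_tsum_le_tsum_enorm).trans ?_
  rw [← ENNReal.tsum_mul_right]
  refine ENNReal.tsum_le_tsum fun k => ?_
  refine (enorm_integral_mul_le hpq (SchwartzMap.continuous _).aestronglyMeasurable
    (c.2.1.comp measurable_prodMk_left).aestronglyMeasurable).trans ?_
  refine (mul_le_mul_right (hC j k f) _).trans (le_of_eq ?_)
  simp only [Function.comp_def]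
  ring

/-- A distribution from a Besov space is synthesized from its blocks. -/
theorem exists_synth_eq {β₀ : Eu d → ℂ} {m₀ m : 𝓢(Eu d, ℂ)}
    (hr : IsResolution β₀ m₀ m n₀ n) (hpq : p.HolderConjugate q) (s : ℝ) {φ : ℝ → ℝ}
    (hφ : IsUpsilon φ) {w : 𝓢'(Eu d, ℂ)} (hw : besovENorm β₀ s φ p w ≠ ⊤) :
    ∃ h : ℕ × Eu d → ℂ, Measurable h ∧
      weightedENorm ((Measure.count : Measure ℕ).prod volume) p (fun y => weight s φ y.1) h =
        besovENorm β₀ s φ p w ∧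
      ∀ c : tame n₀ n, (c : ℕ × Eu d → ℂ) = h → synth n₀ n c = w := by
  have hfin : ∀ k, lpENorm p (block β₀ k w) ≠ ⊤ := fun k htop => by
    have h := weight_mul_le_seqENorm hpq.pos (weight s φ) (fun k => lpENorm p (block β₀ k w)) k
    simp only [htop] at h
    rw [ENNReal.mul_top (by simpa using weight_pos hφ s k), top_le_iff] at h
    exact hw h
  choose h hm hn _ hrep using fun k => exists_rep hpq (hfin k)
  have hm' : Measurable fun y : ℕ × Eu d => h y.1 y.2 := measurable_from_prod_countable_right hm
  refine ⟨fun y => h y.1 y.2, hm', ?_, fun c hc => DFunLike.ext _ _ fun f => ?_⟩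
  · rw [weightedENorm_eq_seqENorm hpq.pos (weight_pos hφ s) hm', besovENorm_eq]
    simp only [hn]
  · have h1 := (summable_tame c f).hasSum.tendsto_sum_nat
    -- The wide multiplier is absorbed by the block symbol, so the synthesis series is the series of
    -- the blocks of `w`.
    have h2 : ∀ k, ∫ x, mult (dyadicFamily n₀ n k) f x * c.1 (k, x) =
        w (mult (dyadicFamily m₀ m k) f) := fun k => by
      rw [hc, ← hrep k, hr.block_apply, hr.mult_wide]
    simp only [h2] at h1
    have h3 := tendsto_nhds_unique h1 (hr.tendsto_sum w f)
    rw [synth_apply, ← h3]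
    simp only [h2]

end Synthesis

end RefinedBesov

namespace RefinedBesov

/-! ### The Besov space is embedded in the interpolation space -/

section UpperBound

variable {d : ℕ} {p q p₀ p₁ q₀ q₁ : ℝ}

/-- The factor `M^{1 - p/p₀}` is chosen so that passing from `L_p` to `L_{p₀}` by a power of the
modulus preserves the norm `M`. It is used once for the blocks and once for the dual test functions.
-/
theorem eLpNorm_rpow_normalized {Y : Type*} [MeasurableSpace Y] {ν : Measure Y} (hp : 0 < p)
    (hr : 0 < p₀) {u : Y → ℂ} {M : ℝ} (hM : 0 < M)
    (hu : eLpNorm u (ENNReal.ofReal p) ν = ENNReal.ofReal M) {v : Y → ℂ}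
    (hv : ∀ y, ‖v y‖ = M ^ (1 - p / p₀) * ‖u y‖ ^ (p / p₀)) :
    eLpNorm v (ENNReal.ofReal p₀) ν = ENNReal.ofReal M := by
  rw [eLpNorm_ofReal hp] at hu
  rw [eLpNorm_ofReal hr]
  have h1 : ∫⁻ y, ‖u y‖ₑ ^ p ∂ν = ENNReal.ofReal (M ^ p) := by
    rw [← ENNReal.ofReal_rpow_of_pos hM, ← hu, ← ENNReal.rpow_mul, one_div_mul_cancel hp.ne',
      ENNReal.rpow_one]
  have h2 : ∀ y, ‖v y‖ₑ ^ p₀ = ENNReal.ofReal (M ^ (p₀ - p)) * ‖u y‖ₑ ^ p := fun y => by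
    rw [← ofReal_norm, ← ofReal_norm, ENNReal.ofReal_rpow_of_nonneg (norm_nonneg _) hr.le,
      ENNReal.ofReal_rpow_of_nonneg (norm_nonneg _) hp.le, ← ENNReal.ofReal_mul (by positivity), hv,
      Real.mul_rpow (by positivity) (by positivity), ← Real.rpow_mul hM.le,
      ← Real.rpow_mul (norm_nonneg _)]
    congr 3 <;> field_simp
  simp only [h2]
  rw [lintegral_const_mul' _ _ ENNReal.ofReal_ne_top, h1, ← ENNReal.ofReal_mul (by positivity),
    ← Real.rpow_add hM, ENNReal.ofReal_rpow_of_pos (by positivity), ← Real.rpow_mul hM.le]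
  congr 1
  rw [sub_add_cancel, mul_one_div_cancel hr.ne', Real.rpow_one]

theorem log_weight_geomMean {s₀ s₁ s θ : ℝ} {φ₀ φ₁ φ : ℝ → ℝ} (h₀ : IsUpsilon φ₀)
    (h₁ : IsUpsilon φ₁) (hs : s = (1 - θ) * s₀ + θ * s₁)
    (hφ : ∀ t : ℝ, 1 ≤ t → φ t = φ₀ t ^ (1 - θ) * φ₁ t ^ θ) (k : ℕ) :
    Real.log (weight s φ k) =
      (1 - θ) * Real.log (weight s₀ φ₀ k) + θ * Real.log (weight s₁ φ₁ k) := by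
  have ht : (1 : ℝ) ≤ 2 ^ k := one_le_pow₀ one_le_two
  have hp0 := h₀.pos _ ht
  have hp1 := h₁.pos _ ht
  have h2 : ∀ a : ℝ, (2 : ℝ) ^ a ≠ 0 := fun a => (Real.rpow_pos_of_pos two_pos a).ne'
  simp only [weight]
  rw [hφ _ ht, Real.log_mul (h2 _) (by positivity), Real.log_mul (h2 _) hp0.ne',
    Real.log_mul (h2 _) hp1.ne', Real.log_mul (by positivity) (by positivity), Real.log_rpow two_pos,
    Real.log_rpow two_pos, Real.log_rpow two_pos, Real.log_rpow hp0, Real.log_rpow hp1, hs]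
  ring

theorem exists_interpENorm_le {β₀ : Eu d → ℂ} (hβ : IsCutoff β₀) (hpq₀ : p₀.HolderConjugate q₀)
    (hpq₁ : p₁.HolderConjugate q₁) (hpq : p.HolderConjugate q) {s₀ s₁ s θ : ℝ} {φ₀ φ₁ φ : ℝ → ℝ}
    (hφ₀ : IsUpsilon φ₀) (hφ₁ : IsUpsilon φ₁) (hφU : IsUpsilon φ) (hθ₀ : 0 < θ) (hθ₁ : θ < 1)
    (hs : s = (1 - θ) * s₀ + θ * s₁) (hp : 1 / p = (1 - θ) / p₀ + θ / p₁)
    (hφ : ∀ t : ℝ, 1 ≤ t → φ t = φ₀ t ^ (1 - θ) * φ₁ t ^ θ) :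
    ∃ C : ℝ≥0, 0 < C ∧ ∀ w, interpENorm (besovENorm β₀ s₀ φ₀ p₀) (besovENorm β₀ s₁ φ₁ p₁) θ w ≤
      C * besovENorm β₀ s φ p w := by
  obtain ⟨m₀, m, n₀, n, hr⟩ := exists_isResolution hβ
  obtain ⟨C₀, hC₀⟩ := exists_besovENorm_synth_le hr hpq₀ s₀ hφ₀
  obtain ⟨C₁, hC₁⟩ := exists_besovENorm_synth_le hr hpq₁ s₁ hφ₁
  obtain ⟨D₀, hD₀⟩ := exists_isSlowWeight hφ₀ s₀
  obtain ⟨D₁, hD₁⟩ := exists_isSlowWeight hφ₁ s₁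
  have hp' := hpq.pos
  have hp0' := hpq₀.pos
  have hp1' := hpq₁.pos
  set C : ℝ≥0 := C₀ + C₁ + 1 with hC
  have hCpos : 0 < C := by positivity
  have hC₀' : C₀ ≤ C := by rw [hC, add_assoc]; exact le_self_add
  have hC₁' : C₁ ≤ C := by rw [hC, add_right_comm]; exact le_add_self
  refine ⟨C, hCpos, fun w => ?_⟩
  rcases eq_or_ne (besovENorm β₀ s φ p w) ⊤ with htop | hfin
  · rw [htop, ENNReal.mul_top (by simpa using hCpos.ne')]; exact le_top
  obtain ⟨h, hm, hN, hsyn⟩ := exists_synth_eq hr hpq s hφU hfin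
  -- The construction below uses real powers and the logarithm of `M`; a vanishing norm is treated
  -- apart and forces all blocks, hence `w`, to vanish.
  rcases eq_or_ne (besovENorm β₀ s φ p w) 0 with hzero | hne
  · have hw0 : w = 0 := by
      refine DFunLike.ext _ _ fun f => ?_
      have hz : ∀ k, w (mult (dyadicFamily m₀ m k) f) = 0 := fun k => by
        have h1 := weight_mul_le_seqENorm hp' (weight s φ) (fun k => lpENorm p (block β₀ k w)) k
        rw [← besovENorm_eq, hzero, nonpos_iff_eq_zero, mul_eq_zero] at h1
        have h2 : lpENorm p (block β₀ k w) = 0 := h1.resolve_left (by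
          simpa using weight_pos hφU s k)
        have h3 := enorm_apply_le_lpENorm hpq (block β₀ k w) f
        rw [h2, zero_mul, nonpos_iff_eq_zero, enorm_eq_zero, hr.block_apply] at h3
        exact h3
      have := hr.tendsto_sum w f
      simp only [hz, Finset.sum_const_zero] at this
      exact tendsto_nhds_unique this tendsto_const_nhds
    rw [hw0, (interpENorm_isSubadditive (besovENorm_isSubadditive hpq₀ β₀ s₀ φ₀)
      (besovENorm_isSubadditive hpq₁ β₀ s₁ φ₁) θ).zero]
    exact zero_le
  set M : ℝ := (besovENorm β₀ s φ p w).toReal with hM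
  have hM0 : 0 < M := ENNReal.toReal_pos hne hfin
  have hMe : ENNReal.ofReal M = besovENorm β₀ s φ p w := ENNReal.ofReal_toReal hfin
  set W : ℕ → ℝ := weight s φ
  set W₀ : ℕ → ℝ := weight s₀ φ₀
  set W₁ : ℕ → ℝ := weight s₁ φ₁
  have hW : ∀ k, 0 < W k := weight_pos hφU s
  have hW₀ : ∀ k, 0 < W₀ k := weight_pos hφ₀ s₀
  have hW₁ : ∀ k, 0 < W₁ k := weight_pos hφ₁ s₁
  set A : ℕ × Eu d → ℝ := fun y => W y.1 * ‖h y‖ with hA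
  have hA0 : ∀ y, 0 ≤ A y := fun y => mul_nonneg (hW _).le (norm_nonneg _)
  have hAn : ∀ y, ‖(W y.1 : ℂ) * h y‖ = A y := fun y => by
    rw [norm_mul, Complex.norm_real, Real.norm_of_nonneg (hW _).le]
  -- `B₀` and `B₁` are the moduli of the family on the two boundary lines, chosen so that `W₀ B₀`
  -- and `W₁ B₁` have norm `M` in `L_{p₀}` and `L_{p₁}`. `σ` is the phase of `h`, and `exp L` is the
  -- ratio `B₁ / B₀` wherever `h` does not vanish.
  let b : ℝ → ℕ × Eu d → ℝ := fun r y => M ^ (1 - p / r) * A y ^ (p / r)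
  let B₀ : ℕ × Eu d → ℝ := fun y => b p₀ y / W₀ y.1
  let B₁ : ℕ × Eu d → ℝ := fun y => b p₁ y / W₁ y.1
  let σ : ℕ × Eu d → ℂ := fun y => h y / (‖h y‖ : ℂ)
  let G : ℕ × Eu d → ℂ := fun y => σ y * B₀ y
  let L : ℕ × Eu d → ℝ := fun y => Real.log (B₁ y) - Real.log (B₀ y)
  have hfst : ∀ V : ℕ → ℝ, Measurable fun y : ℕ × Eu d => V y.1 := fun V =>
    Measurable.of_discrete.comp measurable_fst
  have hAm : Measurable A := (hfst W).mul hm.norm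
  have hbm : ∀ r, Measurable (b r) := fun r => (hAm.pow_const _).const_mul _
  have hB₀m : Measurable B₀ := (hbm p₀).div (hfst W₀)
  have hB₁m : Measurable B₁ := (hbm p₁).div (hfst W₁)
  have hσm : Measurable σ := hm.div (Complex.measurable_ofReal.comp hm.norm)
  have hGm : Measurable G := hσm.mul (Complex.measurable_ofReal.comp hB₀m)
  have hLm : Measurable L := hB₁m.log.sub hB₀m.log
  have hσ0 : ∀ y, h y = 0 → σ y = 0 := fun y hy => by simp [σ, hy]
  have hσ1 : ∀ y, h y ≠ 0 → ‖σ y‖ = 1 := fun y hy => by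
    have := norm_ne_zero_iff.2 hy
    simp [σ, this]
  have hAp : ∀ y, h y ≠ 0 → 0 < A y := fun y hy => mul_pos (hW _) (norm_pos_iff.2 hy)
  have hbp : ∀ r y, h y ≠ 0 → 0 < b r y := fun r y hy =>
    mul_pos (Real.rpow_pos_of_pos hM0 _) (Real.rpow_pos_of_pos (hAp y hy) _)
  have hB₀p : ∀ y, h y ≠ 0 → 0 < B₀ y := fun y hy => div_pos (hbp _ y hy) (hW₀ _)
  have hB₁p : ∀ y, h y ≠ 0 → 0 < B₁ y := fun y hy => div_pos (hbp _ y hy) (hW₁ _)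
  have hG₁ : ∀ y, G y * Complex.exp (L y) = σ y * B₁ y := fun y => by
    by_cases hy : h y = 0
    · simp [G, hσ0 y hy]
    · have h0 := hB₀p y hy
      have h1 := hB₁p y hy
      simp only [G, mul_assoc]
      rw [← Complex.ofReal_exp, ← Complex.ofReal_mul]
      congr 2
      simp only [L]
      rw [Real.exp_sub, Real.exp_log h1, Real.exp_log h0, mul_div_cancel₀ _ h0.ne']
  have hnorm : ∀ {r : ℝ} {V : ℕ → ℝ} {B : ℕ × Eu d → ℝ}, 0 < r → (∀ k, 0 < V k) →
      (∀ y, B y = b r y / V y.1) →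
      weightedENorm ((Measure.count : Measure ℕ).prod volume) r (fun y => V y.1)
        (fun y => σ y * B y) = ENNReal.ofReal M := by
    intro r V B hr0 hV hB
    refine eLpNorm_rpow_normalized hp' hr0 hM0 (u := fun y => (W y.1 : ℂ) * h y)
      (by rw [hMe, ← hN]; rfl) fun y => ?_
    rw [hAn]
    change ‖(V y.1 : ℂ) * (σ y * B y)‖ = _
    by_cases hy : h y = 0
    · have : A y = 0 := by simp [hA, hy]
      rw [hσ0 y hy, this, Real.zero_rpow (by positivity)]; simp
    · have hb := hbp r y hy
      rw [norm_mul, norm_mul, hσ1 y hy, one_mul, hB, Complex.norm_real, Complex.norm_real,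
        Real.norm_of_nonneg (hV _).le, Real.norm_of_nonneg (div_pos hb (hV _)).le,
        mul_div_cancel₀ _ (hV _).ne']
  have hnG : weightedENorm ((Measure.count : Measure ℕ).prod volume) p₀ (fun y => W₀ y.1) G =
      ENNReal.ofReal M := hnorm hp0' hW₀ fun y => rfl
  have hnG₁ : weightedENorm ((Measure.count : Measure ℕ).prod volume) p₁ (fun y => W₁ y.1)
      (fun y => G y * Complex.exp (L y)) = ENNReal.ofReal M := by
    simp only [hG₁]
    exact hnorm hp1' hW₁ fun y => rfl
  obtain ⟨f, hf, hfn, hfz⟩ := exists_isAdmissible_cexp hp0' hp1' (tame n₀ n) (hfst W₀) (hfst W₁)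
    (fun c hc hc' => mem_tame hpq₀ hD₀ hr.annular_wide hc hc')
    (fun c hc hc' => mem_tame hpq₁ hD₁ hr.annular_wide hc hc') hGm hLm
    (hnG ▸ ENNReal.ofReal_lt_top) (hnG₁ ▸ ENNReal.ofReal_lt_top)
  have hfθ : (f θ : ℕ × Eu d → ℂ) = h := by
    rw [hfz θ ⟨by simpa using hθ₀.le, by simpa using hθ₁.le⟩]
    funext y
    by_cases hy : h y = 0
    · simp [G, hσ0 y hy, hy]
    · have h0 := hB₀p y hy
      have hny := norm_pos_iff.2 hy
      have hlogb : ∀ r, Real.log (b r y) = (1 - p / r) * Real.log M + (p / r) * Real.log (A y) :=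
        fun r => by
          simp only [b]
          rw [Real.log_mul (Real.rpow_pos_of_pos hM0 _).ne'
            (Real.rpow_pos_of_pos (hAp y hy) _).ne', Real.log_rpow hM0, Real.log_rpow (hAp y hy)]
      have hlogA : Real.log (A y) = Real.log (W y.1) + Real.log ‖h y‖ :=
        Real.log_mul (hW _).ne' hny.ne'
      have hlogB₀ : Real.log (B₀ y) = Real.log (b p₀ y) - Real.log (W₀ y.1) :=
        Real.log_div (hbp _ y hy).ne' (hW₀ _).ne'
      have hlogB₁ : Real.log (B₁ y) = Real.log (b p₁ y) - Real.log (W₁ y.1) :=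
        Real.log_div (hbp _ y hy).ne' (hW₁ _).ne'
      have hlogW : Real.log (W y.1) = _ := log_weight_geomMean hφ₀ hφ₁ hs hφ y.1
      have hpp : (1 - θ) * (p / p₀) + θ * (p / p₁) = 1 := by
        have : p * (1 / p) = 1 := mul_one_div_cancel hp'.ne'
        rw [hp] at this
        linear_combination this
      -- At `z = θ` the powers of `M` cancel and the exponent of `A` becomes `1`, both because
      -- `(1-θ) p/p₀ + θ p/p₁ = 1`; the weights cancel because their logarithms are affine in `θ`.
      have key : Real.log (B₀ y) + θ * L y = Real.log ‖h y‖ := by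
        simp only [L]
        rw [hlogB₁, hlogB₀, hlogb, hlogb]
        have e : Real.log (A y) - Real.log (W y.1) = Real.log ‖h y‖ := by rw [hlogA]; ring
        rw [← e, hlogW]
        linear_combination (Real.log (A y) - Real.log M) * hpp
      have h2 : B₀ y * Real.exp (θ * L y) = ‖h y‖ := by
        rw [← Real.exp_log hny, ← key, Real.exp_add, Real.exp_log h0]
      simp only [G, mul_assoc]
      rw [← Complex.ofReal_mul, ← Complex.ofReal_exp, ← Complex.ofReal_mul, h2]
      simp only [σ]
      rw [div_mul_cancel₀]
      exact_mod_cast hny.ne'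
  rw [← hsyn (f θ) hfθ]
  refine (interpENorm_map_le (synth n₀ n) hCpos.ne'
    (N₀ := fun c : tame n₀ n => weightedENorm ((Measure.count : Measure ℕ).prod volume) p₀
      (fun y => W₀ y.1) c.1)
    (N₁ := fun c : tame n₀ n => weightedENorm ((Measure.count : Measure ℕ).prod volume) p₁
      (fun y => W₁ y.1) c.1) (fun c => ?_) (fun c => ?_) θ (f θ)).trans ?_
  · refine (hC₀ c).trans ?_
    gcongr
  · refine (hC₁ c).trans ?_
    gcongr
  · gcongr
    refine (interpENorm_le hf).trans (hfn.trans ?_)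
    rw [hnG, hnG₁, max_self, hMe, hsyn (f θ) hfθ]

end UpperBound

end RefinedBesov

namespace RefinedBesov

/-! ### Functionals of admissible functions -/

section Functionals

variable {X : Type*} [AddCommGroup X] [Module ℂ X] {N₀ N₁ : X → ℝ≥0∞} {V : Submodule ℂ X}

theorem mem_of_sumENorm_lt_top (hV₀ : ∀ x, N₀ x < ⊤ → x ∈ V) (hV₁ : ∀ x, N₁ x < ⊤ → x ∈ V) {x : X}
    (hx : sumENorm N₀ N₁ x < ⊤) : x ∈ V := by
  simp only [sumENorm, iInf_lt_iff] at hx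
  obtain ⟨a, b, rfl, hab⟩ := hx
  obtain ⟨ha, hb⟩ := ENNReal.add_lt_top.1 hab
  exact V.add_mem (hV₀ a ha) (hV₁ b hb)

/-- The functional lives on `V` only, so a decomposition of `v` is usable when both parts have
finite norm and thus lie in `V`; otherwise the bound is infinite. -/
theorem enorm_le_sumENorm (hV₀ : ∀ x, N₀ x < ⊤ → x ∈ V) (hV₁ : ∀ x, N₁ x < ⊤ → x ∈ V)
    (J : V →ₗ[ℂ] ℂ) {B : ℝ≥0} (hB : B ≠ 0) (hJ₀ : ∀ v : V, ‖J v‖ₑ ≤ B * N₀ v)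
    (hJ₁ : ∀ v : V, ‖J v‖ₑ ≤ B * N₁ v) (v : V) : ‖J v‖ₑ ≤ B * sumENorm N₀ N₁ (v : X) := by
  have hB' : (B : ℝ≥0∞) ≠ 0 := by simpa using hB
  rw [← ENNReal.div_le_iff' hB' ENNReal.coe_ne_top]
  refine le_sumENorm fun a b hab => ?_
  rcases eq_or_ne (N₀ a) ⊤ with h0 | h0
  · simp [h0]
  rcases eq_or_ne (N₁ b) ⊤ with h1 | h1
  · simp [h1]
  rw [ENNReal.div_le_iff' hB' ENNReal.coe_ne_top, mul_add]
  have hv : v = ⟨a, hV₀ a h0.lt_top⟩ + ⟨b, hV₁ b h1.lt_top⟩ := Subtype.ext hab.symm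
  rw [hv, map_add]
  exact (enorm_add_le _ _).trans (add_le_add (hJ₀ _) (hJ₁ _))

theorem tendsto_of_enorm_sub_le {α : Type*} {l : Filter α} {u : α → ℂ} {c : ℂ} {v : α → ℝ≥0∞}
    (B : ℝ≥0) (hv : Tendsto v l (𝓝 0)) (h : ∀ᶠ a in l, ‖u a - c‖ₑ ≤ B * v a) :
    Tendsto u l (𝓝 c) := by
  rw [tendsto_iff_edist_tendsto_0]
  simp only [edist_eq_enorm_sub]
  exact tendsto_zero_of_le_const_mul B hv h

variable {f : ℂ → X}

theorem closure_verticalStrip : closure (Complex.HadamardThreeLines.verticalStrip 0 1) =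
    closedStrip := by
  rw [Complex.HadamardThreeLines.verticalStrip, Complex.closure_preimage_re,
    closure_Ioo zero_ne_one]
  rfl

/-- A functional bounded in the norm of the sum turns the vector-valued limits in the definition of
admissibility into scalar ones. -/
theorem IsAdmissible.diffContOnCl (hf : IsAdmissible N₀ N₁ f) (hV₀ : ∀ x, N₀ x < ⊤ → x ∈ V)
    (hV₁ : ∀ x, N₁ x < ⊤ → x ∈ V) (J : V →ₗ[ℂ] ℂ) {B : ℝ≥0}
    (hJ : ∀ v : V, ‖J v‖ₑ ≤ B * sumENorm N₀ N₁ (v : X)) {g : ℂ → V}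
    (hg : ∀ z ∈ closedStrip, (g z : X) = f z) :
    DiffContOnCl ℂ (fun z => J (g z)) (Complex.HadamardThreeLines.verticalStrip 0 1) ∧
      ∃ C : ℝ, ∀ z ∈ closedStrip, ‖J (g z)‖ ≤ C := by
  refine ⟨⟨fun z hz => ?_, ?_⟩, ?_⟩
  · have hz' : z ∈ openStrip := hz
    have hzc : z ∈ closedStrip := ⟨hz'.1.le, hz'.2.le⟩
    obtain ⟨f', hf', hlim⟩ := hf.holomorphic z hz'
    let g' : V := ⟨f', mem_of_sumENorm_lt_top hV₀ hV₁ hf'⟩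
    have hd : HasDerivAt (fun z => J (g z)) (J g') z := by
      rw [hasDerivAt_iff_tendsto_slope]
      refine tendsto_of_enorm_sub_le B hlim ?_
      have hopen : ∀ᶠ w in 𝓝[≠] z, 0 < w.re ∧ w.re < 1 := nhdsWithin_le_nhds
        (((isOpen_lt continuous_const Complex.continuous_re).inter
          (isOpen_lt Complex.continuous_re continuous_const)).mem_nhds hz')
      filter_upwards [hopen] with w hw
      have hwc : w ∈ closedStrip := ⟨hw.1.le, hw.2.le⟩
      rw [slope_def_module, ← map_sub, ← map_smul, ← map_sub]
      refine (hJ _).trans (le_of_eq ?_)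
      simp only [AddSubgroupClass.coe_sub, Submodule.coe_smul, hg w hwc, hg z hzc, g']
    exact hd.differentiableAt.differentiableWithinAt
  · rw [closure_verticalStrip]
    intro z hz
    refine tendsto_of_enorm_sub_le B (hf.continuous z hz) ?_
    filter_upwards [self_mem_nhdsWithin] with w hw
    rw [← map_sub]
    refine (hJ _).trans (le_of_eq ?_)
    rw [AddSubgroupClass.coe_sub, hg w hw, hg z hz]
  · obtain ⟨C, hC⟩ := hf.bounded
    refine ⟨(B * C : ℝ≥0), fun z hz => ?_⟩
    have h1 : ‖J (g z)‖ₑ ≤ ((B * C : ℝ≥0) : ℝ≥0∞) := by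
      refine (hJ _).trans ?_
      rw [ENNReal.coe_mul, hg z hz]
      gcongr
      exact hC z hz
    rw [enorm_eq_nnnorm, ENNReal.coe_le_coe] at h1
    exact_mod_cast h1

/-- The three lines theorem for finite combinations of functionals of an admissible function. -/
theorem IsAdmissible.norm_sum_le (hf : IsAdmissible N₀ N₁ f) (hV₀ : ∀ x, N₀ x < ⊤ → x ∈ V)
    (hV₁ : ∀ x, N₁ x < ⊤ → x ∈ V) {ι : Type*} (s : Finset ι) (J : ι → V →ₗ[ℂ] ℂ) (B : ι → ℝ≥0)
    (hJ : ∀ i ∈ s, ∀ v : V, ‖J i v‖ₑ ≤ B i * sumENorm N₀ N₁ (v : X)) {g : ℂ → V}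
    (hg : ∀ z ∈ closedStrip, (g z : X) = f z) (σ : ι → ℂ) (L : ι → ℝ) {K : ℝ} (hK : 0 ≤ K)
    (h0 : ∀ t : ℝ, ‖∑ i ∈ s, σ i * Complex.exp ((t * Complex.I : ℂ) * L i) *
      J i (g (t * Complex.I))‖ ≤ K)
    (h1 : ∀ t : ℝ, ‖∑ i ∈ s, σ i * Complex.exp ((1 + t * Complex.I : ℂ) * L i) *
      J i (g (1 + t * Complex.I))‖ ≤ K) {θ : ℝ} (hθ₀ : 0 < θ) (hθ₁ : θ < 1) :
    ‖∑ i ∈ s, σ i * Complex.exp (θ * L i) * J i (g θ)‖ ≤ K := by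
  let F : ℂ → ℂ := fun z => ∑ i ∈ s, σ i * Complex.exp (z * L i) * J i (g z)
  have hterm := fun i (hi : i ∈ s) => hf.diffContOnCl hV₀ hV₁ (J i) (hJ i hi) hg
  have hd : DiffContOnCl ℂ F (Complex.HadamardThreeLines.verticalStrip 0 1) := by
    have hexp : ∀ i, Differentiable ℂ fun z : ℂ => σ i * Complex.exp (z * L i) := fun i => by
      fun_prop
    refine ⟨DifferentiableOn.fun_sum fun i hi =>
      ((hexp i).differentiableOn).mul (hterm i hi).1.differentiableOn,
      continuousOn_finsetSum _ fun i hi =>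
        ((hexp i).continuous.continuousOn).mul (hterm i hi).1.continuousOn⟩
  have hb : BddAbove ((norm ∘ F) '' Complex.HadamardThreeLines.verticalClosedStrip 0 1) := by
    have : ∀ i ∈ s, ∃ C : ℝ, ∀ z ∈ closedStrip,
        ‖σ i * Complex.exp (z * L i) * J i (g z)‖ ≤ C := fun i hi => by
      obtain ⟨C, hC⟩ := (hterm i hi).2
      refine ⟨‖σ i‖ * Real.exp |L i| * C, fun z hz => ?_⟩
      rw [norm_mul, norm_mul_cexp]
      have hC' := hC z hz
      gcongr
      have := abs_nonneg (L i)
      calc z.re * L i ≤ |z.re * L i| := le_abs_self _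
        _ = z.re * |L i| := by rw [abs_mul, abs_of_nonneg hz.1]
        _ ≤ |L i| := mul_le_of_le_one_left this hz.2
    choose! C hC using this
    refine ⟨∑ i ∈ s, C i, ?_⟩
    rintro _ ⟨z, hz, rfl⟩
    exact (_root_.norm_sum_le _ _).trans (Finset.sum_le_sum fun i hi => hC i hi z hz)
  -- The boundary bounds are both `K`, so the interpolated bound is `K^{1-θ} K^θ = K`.
  have key := Complex.HadamardThreeLines.norm_le_interp_of_mem_verticalClosedStrip₀₁' F (z := θ)
    (a := K) (b := K) ⟨by simpa using hθ₀.le, by simpa using hθ₁.le⟩ hd hb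
    (fun z hz => by
      have hz0 : z.re = 0 := hz
      have : z = z.im * Complex.I := Complex.ext (by simp [hz0]) (by simp)
      rw [this]; exact h0 z.im)
    (fun z hz => by
      have hz0 : z.re = 1 := hz
      have : z = 1 + z.im * Complex.I := Complex.ext (by simp [hz0]) (by simp)
      rw [this]; exact h1 z.im)
  refine key.trans (le_of_eq ?_)
  rw [Complex.ofReal_re]
  rcases hK.eq_or_lt with h | h
  · rw [← h, Real.zero_rpow hθ₀.ne', mul_zero]
  · rw [← Real.rpow_add h, sub_add_cancel, Real.rpow_one]

end Functionals

/-! ### Representation of the blocks by functions -/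

section Representation

variable {d : ℕ} {p q : ℝ}

/-- The distribution `w` is given by the function `u`. -/
structure IsRep (w : 𝓢'(Eu d, ℂ)) (u : Eu d → ℂ) : Prop where
  measurable : Measurable u
  locallyIntegrable : LocallyIntegrable u
  integrable : ∀ f : 𝓢(Eu d, ℂ), Integrable fun x => f x * u x
  apply_eq : ∀ f : 𝓢(Eu d, ℂ), w f = ∫ x, f x * u x

theorem IsRep.add {w w' : 𝓢'(Eu d, ℂ)} {u u' : Eu d → ℂ} (h : IsRep w u) (h' : IsRep w' u') :
    IsRep (w + w') (u + u') := by
  refine ⟨h.measurable.add h'.measurable, h.locallyIntegrable.add h'.locallyIntegrable,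
    fun f => ?_, fun f => ?_⟩
  · simp only [Pi.add_apply, mul_add]
    exact (h.integrable f).add (h'.integrable f)
  · simp only [Pi.add_apply, mul_add]
    rw [integral_add (h.integrable f) (h'.integrable f), ← h.apply_eq, ← h'.apply_eq]
    rfl

theorem IsRep.smul (c : ℂ) {w : 𝓢'(Eu d, ℂ)} {u : Eu d → ℂ} (h : IsRep w u) :
    IsRep (c • w) (c • u) := by
  refine ⟨h.measurable.const_smul c, h.locallyIntegrable.smul c, fun f => ?_, fun f => ?_⟩
  · simp only [Pi.smul_apply, smul_eq_mul, mul_left_comm _ c]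
    exact (h.integrable f).const_mul c
  · simp only [Pi.smul_apply, smul_eq_mul, mul_left_comm _ c]
    rw [integral_const_mul, ← h.apply_eq]
    rfl

theorem IsRep.ae_eq {w : 𝓢'(Eu d, ℂ)} {u u' : Eu d → ℂ} (h : IsRep w u) (h' : IsRep w u') :
    u =ᵐ[volume] u' := by
  refine ae_eq_of_integral_contDiff_smul_eq h.locallyIntegrable h'.locallyIntegrable
    fun g hg hgc => ?_
  have hgC : ContDiff ℝ ∞ fun x => (g x : ℂ) := Complex.ofRealCLM.contDiff.comp hg
  have hgs : HasCompactSupport fun x => (g x : ℂ) := hgc.comp_left (g := Complex.ofReal) rfl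
  simp only [Complex.real_smul]
  exact (h.apply_eq (hgs.toSchwartzMap hgC)).symm.trans (h'.apply_eq (hgs.toSchwartzMap hgC))

theorem exists_isRep (hpq : p.HolderConjugate q) {w : 𝓢'(Eu d, ℂ)} (hw : lpENorm p w ≠ ⊤) :
    ∃ u, IsRep w u ∧ eLpNorm u (ENNReal.ofReal p) volume = lpENorm p w := by
  obtain ⟨h, hm, hn, hmem, hrep⟩ := exists_rep hpq hw
  have hconj := hpq.symm.ennrealOfReal
  exact ⟨h, ⟨hm, hmem.locallyIntegrable (fact_one_le_ofReal hpq).out,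
    fun f => (f.memLp (ENNReal.ofReal q) volume).integrable_mul hmem, hrep⟩, hn⟩

/-- The distributions whose dyadic blocks are functions. -/
def blockwiseFunctions (β₀ : Eu d → ℂ) : Submodule ℂ 𝓢'(Eu d, ℂ) where
  carrier := {w | ∀ k, ∃ u, IsRep (block β₀ k w) u}
  add_mem' := fun ha hb k => by
    obtain ⟨u, hu⟩ := ha k
    obtain ⟨v, hv⟩ := hb k
    exact ⟨u + v, by rw [map_add]; exact hu.add hv⟩
  zero_mem' := fun k => ⟨0, measurable_const, locallyIntegrable_zero, fun f => by simp,
    fun f => by rw [map_zero]; simp⟩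
  smul_mem' := fun c w hw k => by
    obtain ⟨u, hu⟩ := hw k
    exact ⟨c • u, by rw [map_smul]; exact hu.smul c⟩

variable {β₀ : Eu d → ℂ}

/-- The functions representing the dyadic blocks. -/
noncomputable def blockFun (v : blockwiseFunctions β₀) (y : ℕ × Eu d) : ℂ := (v.2 y.1).choose y.2

theorem isRep_blockFun (v : blockwiseFunctions β₀) (k : ℕ) :
    IsRep (block β₀ k v.1) fun x => blockFun v (k, x) := (v.2 k).choose_spec

theorem measurable_blockFun (v : blockwiseFunctions β₀) : Measurable (blockFun v) :=
  measurable_from_prod_countable_right fun k => (isRep_blockFun v k).measurable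

theorem ae_eq_of_forall_ae_eq {u v : ℕ × Eu d → ℂ} (hu : Measurable u) (hv : Measurable v)
    (h : ∀ k, (fun x => u (k, x)) =ᵐ[volume] fun x => v (k, x)) :
    u =ᵐ[(Measure.count : Measure ℕ).prod volume] v :=
  (Measure.ae_prod_iff_ae_ae (measurableSet_eq_fun hu hv)).2 (ae_of_all _ h)

/-- The representatives are chosen, so they are additive only up to null sets; this is enough for
functionals defined by integrals. -/
theorem blockFun_add (v w : blockwiseFunctions β₀) :
    blockFun (v + w) =ᵐ[(Measure.count : Measure ℕ).prod volume] blockFun v + blockFun w := by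
  refine ae_eq_of_forall_ae_eq (measurable_blockFun _)
    ((measurable_blockFun _).add (measurable_blockFun _)) fun k => ?_
  refine (isRep_blockFun (v + w) k).ae_eq ?_
  have h := (isRep_blockFun v k).add (isRep_blockFun w k)
  rw [← map_add] at h
  exact h

theorem blockFun_smul (c : ℂ) (v : blockwiseFunctions β₀) :
    blockFun (c • v) =ᵐ[(Measure.count : Measure ℕ).prod volume] c • blockFun v := by
  refine ae_eq_of_forall_ae_eq (measurable_blockFun _)
    ((measurable_blockFun _).const_smul c) fun k => ?_
  refine (isRep_blockFun (c • v) k).ae_eq ?_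
  have h := (isRep_blockFun v k).smul c
  rw [← map_smul] at h
  exact h

theorem mem_blockwiseFunctions (hpq : p.HolderConjugate q) {s : ℝ} {φ : ℝ → ℝ} (hφ : IsUpsilon φ)
    {w : 𝓢'(Eu d, ℂ)} (hw : besovENorm β₀ s φ p w < ⊤) : w ∈ blockwiseFunctions β₀ := fun k => by
  have hfin : lpENorm p (block β₀ k w) ≠ ⊤ := fun htop => by
    have h := weight_mul_le_seqENorm hpq.pos (weight s φ) (fun k => lpENorm p (block β₀ k w)) k
    simp only [htop] at h
    rw [ENNReal.mul_top (by simpa using weight_pos hφ s k), top_le_iff] at h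
    exact hw.ne h
  obtain ⟨u, hu, -⟩ := exists_isRep hpq hfin
  exact ⟨u, hu⟩

theorem lpENorm_le_of_isRep (hpq : p.HolderConjugate q) {w : 𝓢'(Eu d, ℂ)} {u : Eu d → ℂ}
    (h : IsRep w u) : lpENorm p w ≤ eLpNorm u (ENNReal.ofReal p) volume :=
  lpENorm_le_of_bound hpq fun f => by
    rw [h.apply_eq]
    exact enorm_integral_mul_le hpq f.continuous.aestronglyMeasurable
      h.measurable.aestronglyMeasurable

/-- Representatives are unique almost everywhere, so the arbitrary choice in `blockFun` does not
affect any `L_p` norm. -/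
theorem eLpNorm_isRep (hpq : p.HolderConjugate q) {w : 𝓢'(Eu d, ℂ)} {u : Eu d → ℂ}
    (h : IsRep w u) : eLpNorm u (ENNReal.ofReal p) volume = lpENorm p w := by
  refine le_antisymm ?_ (lpENorm_le_of_isRep hpq h)
  rcases eq_or_ne (lpENorm p w) ⊤ with htop | hw
  · rw [htop]; exact le_top
  · obtain ⟨v, hv, hvn⟩ := exists_isRep hpq hw
    rw [eLpNorm_congr_ae (h.ae_eq hv), hvn]

theorem weightedENorm_blockFun (hpq : p.HolderConjugate q) {s : ℝ} {φ : ℝ → ℝ} (hφ : IsUpsilon φ)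
    (v : blockwiseFunctions β₀) :
    weightedENorm ((Measure.count : Measure ℕ).prod volume) p (fun y => weight s φ y.1)
      (blockFun v) = besovENorm β₀ s φ p v.1 := by
  rw [weightedENorm_eq_seqENorm hpq.pos (weight_pos hφ s) (measurable_blockFun v), besovENorm_eq]
  simp only [eLpNorm_isRep hpq (isRep_blockFun v _)]

/-- The bounded sets exhausting `ℕ × ℝ^d`. -/
def exhaust (d n : ℕ) : Set (ℕ × Eu d) := (Finset.range n : Set ℕ) ×ˢ Metric.ball (0 : Eu d) n

theorem measurableSet_exhaust (d n : ℕ) : MeasurableSet (exhaust d n) :=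
  (Finset.range n).measurableSet.prod measurableSet_ball

theorem monotone_exhaust (d : ℕ) : Monotone (exhaust d) := fun m n h =>
  prod_mono (by simpa using h) (Metric.ball_subset_ball (by exact_mod_cast h))

theorem iUnion_exhaust (d : ℕ) : ⋃ n, exhaust d n = univ := by
  refine eq_univ_of_forall fun y => mem_iUnion.2 ?_
  obtain ⟨n, hn⟩ := exists_nat_gt (max (y.1 : ℝ) ‖y.2‖)
  have h1 : (y.1 : ℝ) < n := (le_max_left _ _).trans_lt hn
  refine ⟨n, ⟨by simpa using (by exact_mod_cast h1 : y.1 < n), ?_⟩⟩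
  simpa using (le_max_right _ _).trans_lt hn

theorem measure_exhaust_lt_top (d n : ℕ) :
    ((Measure.count : Measure ℕ).prod (volume : Measure (Eu d))) (exhaust d n) < ⊤ := by
  rw [exhaust, Measure.prod_prod]
  exact ENNReal.mul_lt_top (by simp) measure_ball_lt_top

theorem integrableOn_blockFun (v : blockwiseFunctions β₀) (n : ℕ) :
    IntegrableOn (blockFun v) (exhaust d n) ((Measure.count : Measure ℕ).prod volume) := by
  refine ⟨(measurable_blockFun v).aestronglyMeasurable, ?_⟩
  have hloc : ∀ k, ∫⁻ x in Metric.ball (0 : Eu d) n, ‖blockFun v (k, x)‖ₑ < ⊤ := fun k =>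
    (((isRep_blockFun v k).locallyIntegrable.integrableOn_isCompact
      (isCompact_closedBall (0 : Eu d) n)).mono_set Metric.ball_subset_closedBall).2
  rw [HasFiniteIntegral, exhaust, ← Measure.prod_restrict,
    lintegral_prod _ (measurable_blockFun v).enorm.aemeasurable]
  rw [lintegral_finset]
  exact ENNReal.sum_lt_top.2 fun k _ => ENNReal.mul_lt_top (hloc k) (by simp)

/-- The functional `v ↦ ∫_E v` on a bounded set. -/
noncomputable def setFunctional {n : ℕ} {E : Set (ℕ × Eu d)} (hE : E ⊆ exhaust d n) :
    blockwiseFunctions β₀ →ₗ[ℂ] ℂ where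
  toFun v := ∫ y in E, blockFun v y ∂(Measure.count : Measure ℕ).prod volume
  map_add' v w := by
    rw [← integral_add ((integrableOn_blockFun v n).mono_set hE)
      ((integrableOn_blockFun w n).mono_set hE)]
    exact integral_congr_ae (ae_restrict_of_ae (blockFun_add v w))
  map_smul' c v := by
    rw [RingHom.id_apply, ← integral_smul]
    exact integral_congr_ae (ae_restrict_of_ae (blockFun_smul c v))

/-- Hölder's inequality against `1_E / W`, which lies in `L_q` since `E` has finite measure and
meets finitely many levels. -/
theorem exists_enorm_setFunctional_le (hpq : p.HolderConjugate q) {s : ℝ} {φ : ℝ → ℝ}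
    (hφ : IsUpsilon φ) {n : ℕ} {E : Set (ℕ × Eu d)} (hE : E ⊆ exhaust d n) (hEm : MeasurableSet E) :
    ∃ B : ℝ≥0, ∀ v : blockwiseFunctions β₀,
      ‖setFunctional hE v‖ₑ ≤ B * besovENorm β₀ s φ p v.1 := by
  set ν := (Measure.count : Measure ℕ).prod (volume : Measure (Eu d))
  let W : ℕ → ℝ := weight s φ
  have hW : ∀ k, 0 < W k := weight_pos hφ s
  have hWm' : Measurable fun y : ℕ × Eu d => W y.1 :=
    (Measurable.of_discrete (f := W)).comp measurable_fst
  have hWm : Measurable fun y : ℕ × Eu d => (W y.1 : ℂ) := Complex.measurable_ofReal.comp hWm'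
  let u : ℕ × Eu d → ℂ := E.indicator fun y => (W y.1 : ℂ)⁻¹
  have hum : Measurable u := hWm.inv.indicator hEm
  have hu : eLpNorm u (ENNReal.ofReal q) ν ≠ ⊤ := by
    let c : ℝ := ∑ k ∈ Finset.range n, (W k)⁻¹
    have hle : ∀ y, ‖u y‖ ≤ ‖E.indicator (fun _ => c) y‖ := fun y => by
      by_cases hy : y ∈ E
      · simp only [u, indicator_of_mem hy]
        rw [norm_inv, Complex.norm_real, Real.norm_of_nonneg (hW _).le]
        exact (Finset.single_le_sum (f := fun k => (W k)⁻¹) (fun k _ => (inv_pos.2 (hW k)).le)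
          (hE hy).1).trans (Real.le_norm_self c)
      · simp only [u, indicator_of_notMem hy, norm_zero, le_refl]
    refine ((eLpNorm_mono hle).trans_lt ?_).ne
    exact (memLp_indicator_const _ hEm c (Or.inr
      ((measure_mono hE).trans_lt (measure_exhaust_lt_top d n)).ne)).2
  refine ⟨(eLpNorm u (ENNReal.ofReal q) ν).toNNReal, fun v => ?_⟩
  rw [ENNReal.coe_toNNReal hu, mul_comm, ← weightedENorm_blockFun hpq hφ]
  have h1 : setFunctional hE v = ∫ y, u y * ((W y.1 : ℂ) * blockFun v y) ∂ν := by
    change ∫ y in E, blockFun v y ∂ν = _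
    rw [← integral_indicator hEm]
    congr 1; funext y
    by_cases hy : y ∈ E
    · have : (W y.1 : ℂ) ≠ 0 := by exact_mod_cast (hW y.1).ne'
      simp only [u, indicator_of_mem hy]
      rw [inv_mul_cancel_left₀ this]
    · simp only [u, indicator_of_notMem hy, zero_mul]
  rw [h1]
  exact enorm_integral_mul_le hpq hum.aestronglyMeasurable
    (hWm.mul (measurable_blockFun v)).aestronglyMeasurable

end Representation

end RefinedBesov

namespace RefinedBesov

/-! ### The interpolation space is embedded in the Besov space -/

section LowerBound

variable {d : ℕ} {p q p₀ p₁ q₀ q₁ : ℝ}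

/-- The integral against a function of `(k, s (k, x))`, with `s` simple, is a finite sum. -/
theorem integral_simpleFunc_comp {β₀ : Eu d → ℂ} {n : ℕ} (s : SimpleFunc (ℕ × Eu d) ℂ)
    (hs : ∀ y ∉ exhaust d n, s y = 0) (a : ℕ × ℂ → ℂ) (ha : ∀ k, a (k, 0) = 0)
    (hE : ∀ i : ℕ × ℂ, {y : ℕ × Eu d | y.1 = i.1 ∧ s y = i.2} ∩ exhaust d n ⊆ exhaust d n)
    (v : blockwiseFunctions β₀) :
    ∫ y, a (y.1, s y) * blockFun v y ∂(Measure.count : Measure ℕ).prod volume =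
      ∑ i ∈ Finset.range n ×ˢ s.range, a i * setFunctional (hE i) v := by
  set ν := (Measure.count : Measure ℕ).prod (volume : Measure (Eu d))
  have hEm : ∀ i : ℕ × ℂ,
      MeasurableSet ({y : ℕ × Eu d | y.1 = i.1 ∧ s y = i.2} ∩ exhaust d n) := fun i =>
    ((measurableSet_eq_fun measurable_fst measurable_const).inter
      (measurableSet_eq_fun s.measurable measurable_const)).inter (measurableSet_exhaust d n)
  -- On each set where the level and the value of `s` are both fixed the coefficient is constant.
  -- Off the exhausting set `s = 0`, and the coefficient vanishes there by `ha`.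
  have hfun : (fun y => a (y.1, s y) * blockFun v y) = fun y =>
      ∑ i ∈ Finset.range n ×ˢ s.range, a i * ({y : ℕ × Eu d | y.1 = i.1 ∧ s y = i.2} ∩
        exhaust d n).indicator (blockFun v) y := by
    funext y
    by_cases hy : y ∈ exhaust d n
    · rw [Finset.sum_eq_single (y.1, s y)]
      · rw [indicator_of_mem (show y ∈ {z : ℕ × Eu d | z.1 = y.1 ∧ s z = s y} ∩ exhaust d n from
          ⟨⟨rfl, rfl⟩, hy⟩)]
      · intro i _ hi
        rw [indicator_of_notMem, mul_zero]
        rintro ⟨⟨h1, h2⟩, -⟩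
        exact hi (Prod.ext h1.symm h2.symm)
      · intro hi
        exact absurd (Finset.mem_product.2 ⟨by simpa using hy.1, s.mem_range_self y⟩) hi
    · rw [hs y hy, ha, zero_mul, Finset.sum_eq_zero]
      intro i _
      rw [indicator_of_notMem fun h => hy h.2, mul_zero]
  rw [hfun, integral_finsetSum]
  · refine Finset.sum_congr rfl fun i _ => ?_
    rw [integral_const_mul, integral_indicator (hEm i)]
    rfl
  · intro i _
    exact (((integrableOn_blockFun v n).mono_set (hE i)).integrable_indicator (hEm i)).const_mul _

/-- By duality it suffices to bound the integral of `W · blockFun (f θ) · σ` for simple `σ`. The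
factor `W σ` is the value at `θ` of an analytic family of simple coefficients whose norms in the
dual weighted spaces on the boundary lines equal the `L_q` norm of `σ`; the three lines theorem then
gives the constant `1`. -/
theorem besovENorm_le_interpENorm {β₀ : Eu d → ℂ} (hpq₀ : p₀.HolderConjugate q₀)
    (hpq₁ : p₁.HolderConjugate q₁) (hpq : p.HolderConjugate q) {s₀ s₁ s θ : ℝ} {φ₀ φ₁ φ : ℝ → ℝ}
    (hφ₀ : IsUpsilon φ₀) (hφ₁ : IsUpsilon φ₁) (hφU : IsUpsilon φ) (hθ₀ : 0 < θ) (hθ₁ : θ < 1)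
    (hs : s = (1 - θ) * s₀ + θ * s₁) (hp : 1 / p = (1 - θ) / p₀ + θ / p₁)
    (hφ : ∀ t : ℝ, 1 ≤ t → φ t = φ₀ t ^ (1 - θ) * φ₁ t ^ θ) (x : 𝓢'(Eu d, ℂ)) :
    besovENorm β₀ s φ p x ≤
      interpENorm (besovENorm β₀ s₀ φ₀ p₀) (besovENorm β₀ s₁ φ₁ p₁) θ x := by
  refine le_interpENorm fun f hf hfθ => ?_
  set N := admissibleENorm (besovENorm β₀ s₀ φ₀ p₀) (besovENorm β₀ s₁ φ₁ p₁) f with hN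
  rcases eq_or_ne N ⊤ with htop | hfin
  · rw [htop]; exact le_top
  have hq : 0 < q := hpq.symm.pos
  have hq₀ : 0 < q₀ := hpq₀.symm.pos
  have hq₁ : 0 < q₁ := hpq₁.symm.pos
  -- The conjugate exponents satisfy the same interpolation relation, by subtracting the one for `p`
  -- from `1`.
  have hqq : (1 - θ) * (q / q₀) + θ * (q / q₁) = 1 := by
    have e := hpq.inv_add_inv_eq_one
    have e₀ := hpq₀.inv_add_inv_eq_one
    have e₁ := hpq₁.inv_add_inv_eq_one
    simp only [div_eq_mul_inv, one_mul] at hp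
    have h1 : (1 - θ) * q₀⁻¹ + θ * q₁⁻¹ = q⁻¹ := by
      linear_combination (1 - θ) * e₀ + θ * e₁ - e + hp
    have h2 : q * q⁻¹ = 1 := mul_inv_cancel₀ hq.ne'
    rw [← h1] at h2
    simp only [div_eq_mul_inv]
    linear_combination h2
  set ν := (Measure.count : Measure ℕ).prod (volume : Measure (Eu d)) with hν
  set V := blockwiseFunctions β₀
  have hV₀ : ∀ w, besovENorm β₀ s₀ φ₀ p₀ w < ⊤ → w ∈ V := fun w hw =>
    mem_blockwiseFunctions hpq₀ hφ₀ hw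
  have hV₁ : ∀ w, besovENorm β₀ s₁ φ₁ p₁ w < ⊤ → w ∈ V := fun w hw =>
    mem_blockwiseFunctions hpq₁ hφ₁ hw
  have hstrip : ∀ z ∈ closedStrip, f z ∈ V := fun z hz => by
    obtain ⟨C, hC⟩ := hf.bounded
    exact mem_of_sumENorm_lt_top hV₀ hV₁ ((hC z hz).trans_lt ENNReal.coe_lt_top)
  classical
  let g : ℂ → V := fun z => if hz : z ∈ closedStrip then ⟨f z, hstrip z hz⟩ else 0
  have hg : ∀ z ∈ closedStrip, (g z : 𝓢'(Eu d, ℂ)) = f z := fun z hz => by simp [g, hz]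
  have hθm : (θ : ℂ) ∈ closedStrip := ⟨by simpa using hθ₀.le, by simpa using hθ₁.le⟩
  have hitm : ∀ t : ℝ, (t * Complex.I : ℂ) ∈ closedStrip := fun t => by simp [closedStrip]
  have h1itm : ∀ t : ℝ, (1 + t * Complex.I : ℂ) ∈ closedStrip := fun t => by simp [closedStrip]
  set W : ℕ → ℝ := weight s φ
  set W₀ : ℕ → ℝ := weight s₀ φ₀
  set W₁ : ℕ → ℝ := weight s₁ φ₁
  have hW : ∀ k, 0 < W k := weight_pos hφU s
  have hW₀ : ∀ k, 0 < W₀ k := weight_pos hφ₀ s₀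
  have hW₁ : ∀ k, 0 < W₁ k := weight_pos hφ₁ s₁
  have hfst : ∀ U : ℕ → ℝ, Measurable fun y : ℕ × Eu d => (U y.1 : ℂ) := fun U =>
    Complex.measurable_ofReal.comp ((Measurable.of_discrete (f := U)).comp measurable_fst)
  rw [← hfθ, ← hg θ hθm, ← weightedENorm_blockFun hpq hφU]
  refine eLpNorm_le_of_simpleFunc_test hpq (S := exhaust d) (ρ := fun _ => 1)
    (measurableSet_exhaust d) (monotone_exhaust d) (iUnion_exhaust d) (measure_exhaust_lt_top d)
    measurable_const (fun n => ⟨1, one_pos, fun y _ => le_rfl⟩)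
    ((hfst W).mul (measurable_blockFun _)) (fun n => ?_) fun n σ hσ => ?_
  · obtain ⟨c, hc⟩ : ∃ c : ℝ, ∀ k ∈ Finset.range n, W k ≤ c :=
      ⟨∑ k ∈ Finset.range n, W k, fun k hk => Finset.single_le_sum (fun k _ => (hW k).le) hk⟩
    refine (integrableOn_blockFun (g θ) n).bdd_mul (c := c) (hfst W).aestronglyMeasurable ?_
    refine (ae_restrict_iff' (measurableSet_exhaust d n)).2 (ae_of_all _ fun y hy => ?_)
    rw [Complex.norm_real, Real.norm_of_nonneg (hW _).le]
    exact hc _ hy.1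
  simp only [Complex.ofReal_one, mul_one]
  change ‖∫ y, (W y.1 : ℂ) * blockFun (g θ) y * σ y ∂ν‖ₑ ≤ N * eLpNorm σ (ENNReal.ofReal q) ν
  set T : ℝ := (eLpNorm σ (ENNReal.ofReal q) ν).toReal with hT
  have hσfin : eLpNorm σ (ENNReal.ofReal q) ν ≠ ⊤ := by
    obtain ⟨c, hc⟩ := σ.exists_forall_norm_le
    have hle : ∀ y, ‖σ y‖ ≤ ‖(exhaust d n).indicator (fun _ => c) y‖ := fun y => by
      by_cases hy : y ∈ exhaust d n
      · rw [indicator_of_mem hy]; exact (hc y).trans (Real.le_norm_self c)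
      · rw [hσ y hy, indicator_of_notMem hy, norm_zero, norm_zero]
    exact ((eLpNorm_mono hle).trans_lt (memLp_indicator_const _ (measurableSet_exhaust d n) c
      (Or.inr (measure_exhaust_lt_top d n).ne)).2).ne
  have hTe : ENNReal.ofReal T = eLpNorm σ (ENNReal.ofReal q) ν := ENNReal.ofReal_toReal hσfin
  rcases eq_or_ne (eLpNorm σ (ENNReal.ofReal q) ν) 0 with hzero | hne
  · have hae : σ =ᵐ[ν] 0 := (eLpNorm_eq_zero_iff σ.measurable.aestronglyMeasurable
      (ofReal_ne_zero_of_conj hpq.symm)).1 hzero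
    have : ∫ y, (W y.1 : ℂ) * blockFun (g θ) y * σ y ∂ν = 0 := by
      rw [integral_eq_zero_of_ae]
      filter_upwards [hae] with y hy
      simp [hy]
    rw [this]; simp
  have hT0 : 0 < T := ENNReal.toReal_pos hne hσfin
  -- the analytic family through `W σ`
  let l : (ℕ → ℝ) → ℝ → ℕ × ℂ → ℝ := fun U r i =>
    Real.log (U i.1) + (1 - q / r) * Real.log T + (q / r) * Real.log ‖i.2‖
  let G : ℕ × ℂ → ℂ := fun i => i.2 / (‖i.2‖ : ℂ) * (Real.exp (l W₀ q₀ i) : ℂ)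
  let L : ℕ × ℂ → ℝ := fun i => l W₁ q₁ i - l W₀ q₀ i
  let a : ℂ → ℕ × ℂ → ℂ := fun z i => G i * Complex.exp (z * L i)
  have ha0 : ∀ z k, a z (k, 0) = 0 := fun z k => by simp [a, G]
  have hexpl : ∀ {U : ℕ → ℝ} {r : ℝ}, (∀ k, 0 < U k) → ∀ i : ℕ × ℂ, i.2 ≠ 0 →
      Real.exp (l U r i) = U i.1 * (T ^ (1 - q / r) * ‖i.2‖ ^ (q / r)) := by
    intro U r hU i hi
    have hi' := norm_pos_iff.2 hi
    simp only [l]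
    rw [Real.exp_add, Real.exp_add, Real.exp_log (hU _), Real.rpow_def_of_pos hT0,
      Real.rpow_def_of_pos hi', mul_comm (1 - q / r), mul_comm (q / r), mul_assoc]
  have hsgn : ∀ c : ℂ, c ≠ 0 → ‖c / (‖c‖ : ℂ)‖ = 1 := fun c hc => by
    have := norm_ne_zero_iff.2 hc
    simp [this]
  have hE : ∀ i : ℕ × ℂ, {y : ℕ × Eu d | y.1 = i.1 ∧ σ y = i.2} ∩ exhaust d n ⊆ exhaust d n :=
    fun i => inter_subset_right
  have hsum := fun z v => integral_simpleFunc_comp (β₀ := β₀) σ hσ (a z) (ha0 z) hE v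
  -- the bounds on the boundary lines
  have hedge : ∀ {U : ℕ → ℝ} {r r' : ℝ} {z : ℂ} (v : V), r.HolderConjugate r' → (∀ k, 0 < U k) →
      weightedENorm ν r (fun y => U y.1) (blockFun v) ≤ N →
      (∀ i : ℕ × ℂ, i.2 ≠ 0 → ‖a z i‖ = Real.exp (l U r' i)) →
      ‖∑ i ∈ Finset.range n ×ˢ σ.range, a z i * setFunctional (hE i) v‖ ≤ N.toReal * T := by
    intro U r r' z v hr hU hv haz
    rw [← hsum]
    have h1 : ∫ y, a z (y.1, σ y) * blockFun v y ∂ν =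
        ∫ y, (a z (y.1, σ y) / (U y.1 : ℂ)) * ((U y.1 : ℂ) * blockFun v y) ∂ν := by
      congr 1; funext y
      have : (U y.1 : ℂ) ≠ 0 := by exact_mod_cast (hU y.1).ne'
      field_simp
    have hnorm : eLpNorm (fun y => a z (y.1, σ y) / (U y.1 : ℂ)) (ENNReal.ofReal r') ν =
        ENNReal.ofReal T := by
      refine eLpNorm_rpow_normalized hq hr.symm.pos hT0 (u := σ) hTe.symm fun y => ?_
      have hUy := hU y.1
      by_cases hy : σ y = 0
      · have hr' := hr.symm.pos
        rw [hy, ha0, norm_zero, Real.zero_rpow (by positivity)]; simp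
      · rw [norm_div, haz _ hy, hexpl hU _ hy, Complex.norm_real, Real.norm_of_nonneg hUy.le,
          mul_div_cancel_left₀ _ hUy.ne']
    have ham : AEStronglyMeasurable (fun y => a z (y.1, σ y) / (U y.1 : ℂ)) ν := by
      have : Measurable fun i : ℕ × ℂ => a z i := by
        have hl : ∀ U r, Measurable (l U r) := fun U r =>
          ((((Measurable.of_discrete (f := U)).comp measurable_fst).log).add_const _).add
            ((measurable_snd.norm.log).const_mul _)
        exact measurable_mul_cexp ((measurable_snd.div
          (Complex.measurable_ofReal.comp measurable_snd.norm)).mul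
          (Complex.measurable_ofReal.comp (hl _ _).exp)) ((hl _ _).sub (hl _ _)) z
      exact ((this.comp (measurable_fst.prodMk σ.measurable)).div (hfst U)).aestronglyMeasurable
    rw [h1, ← toReal_enorm]
    have h2 := enorm_integral_mul_le hr ham ((hfst U).mul (measurable_blockFun v)).aestronglyMeasurable
    rw [hnorm] at h2
    have h3 : N.toReal * T = (N * ENNReal.ofReal T).toReal := by
      rw [ENNReal.toReal_mul, ENNReal.toReal_ofReal hT0.le]
    rw [h3]
    exact ENNReal.toReal_mono (ENNReal.mul_ne_top hfin ENNReal.ofReal_ne_top)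
      (h2.trans (mul_le_mul_left hv _))
  have hGn : ∀ i : ℕ × ℂ, i.2 ≠ 0 → ‖G i‖ = Real.exp (l W₀ q₀ i) := fun i hi => by
    simp only [G]
    rw [norm_mul, hsgn _ hi, one_mul, Complex.norm_real, Real.norm_of_nonneg (Real.exp_pos _).le]
  have hB : ∀ i : ℕ × ℂ, ∃ B : ℝ≥0, ∀ v : V, ‖setFunctional (hE i) v‖ₑ ≤
      B * sumENorm (besovENorm β₀ s₀ φ₀ p₀) (besovENorm β₀ s₁ φ₁ p₁) (v : 𝓢'(Eu d, ℂ)) := fun i => by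
    have hEm : MeasurableSet ({y : ℕ × Eu d | y.1 = i.1 ∧ σ y = i.2} ∩ exhaust d n) :=
      ((measurableSet_eq_fun measurable_fst measurable_const).inter
        (measurableSet_eq_fun σ.measurable measurable_const)).inter (measurableSet_exhaust d n)
    obtain ⟨B₀, hB₀⟩ := exists_enorm_setFunctional_le (β₀ := β₀) hpq₀ (s := s₀) hφ₀ (hE i) hEm
    obtain ⟨B₁, hB₁⟩ := exists_enorm_setFunctional_le (β₀ := β₀) hpq₁ (s := s₁) hφ₁ (hE i) hEm
    -- A common nonzero constant for both endpoint spaces.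
    refine ⟨B₀ + B₁ + 1, enorm_le_sumENorm hV₀ hV₁ _ (by positivity) (fun v => ?_) fun v => ?_⟩
    · refine (hB₀ v).trans ?_
      gcongr
      rw [add_assoc]; exact le_self_add
    · refine (hB₁ v).trans ?_
      gcongr
      rw [add_right_comm]; exact le_add_self
  choose B hB using hB
  have key := hf.norm_sum_le hV₀ hV₁ (Finset.range n ×ˢ σ.range)
    (fun i => setFunctional (hE i)) B (fun i _ => hB i) hg G L (K := N.toReal * T) (by positivity)
    (fun t => hedge (U := W₀) (r' := q₀) _ hpq₀ hW₀ (by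
        rw [weightedENorm_blockFun hpq₀ hφ₀, hg _ (hitm t)]
        exact (le_iSup (fun t : ℝ => besovENorm β₀ s₀ φ₀ p₀ (f (t * Complex.I))) t).trans
          (le_max_left _ _))
      fun i hi => by
        simp only [a]
        rw [norm_mul_cexp, hGn i hi]; simp)
    (fun t => hedge (U := W₁) (r' := q₁) _ hpq₁ hW₁ (by
        rw [weightedENorm_blockFun hpq₁ hφ₁, hg _ (h1itm t)]
        exact (le_iSup (fun t : ℝ => besovENorm β₀ s₁ φ₁ p₁ (f (1 + t * Complex.I))) t).trans
          (le_max_right _ _))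
      fun i hi => by
        simp only [a]
        rw [norm_mul_cexp, hGn i hi, ← Real.exp_add]
        congr 1
        simp [L]) hθ₀ hθ₁
  -- At `z = θ` the powers of `T` cancel, the exponent of `|σ|` becomes `1`, and the weights combine
  -- to `W`.
  have hθa : ∀ y : ℕ × Eu d, a θ (y.1, σ y) = W y.1 * σ y := fun y => by
    by_cases hy : σ y = 0
    · rw [hy, ha0, mul_zero]
    · have hny := norm_pos_iff.2 hy
      have hl : l W₀ q₀ (y.1, σ y) + θ * L (y.1, σ y) = Real.log (W y.1) + Real.log ‖σ y‖ := by
        have hlogW : Real.log (W y.1) = _ := log_weight_geomMean hφ₀ hφ₁ hs hφ y.1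
        rw [hlogW]
        simp only [L, l]
        linear_combination (Real.log ‖σ y‖ - Real.log T) * hqq
      simp only [a, G]
      rw [mul_assoc, ← Complex.ofReal_mul, ← Complex.ofReal_exp, ← Complex.ofReal_mul,
        ← Real.exp_add, hl, Real.exp_add, Real.exp_log (hW _), Real.exp_log hny]
      have : (‖σ y‖ : ℂ) ≠ 0 := by exact_mod_cast hny.ne'
      push_cast
      field_simp
  have hfinal := hsum θ (g θ)
  simp only [hθa] at hfinal
  have hint : ∫ y, (W y.1 : ℂ) * blockFun (g θ) y * σ y ∂ν =
      ∑ i ∈ Finset.range n ×ˢ σ.range, a θ i * setFunctional (hE i) (g θ) := by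
    rw [← hfinal]
    congr 1; funext y; ring
  rw [hint, ← hTe, ← ofReal_norm, ← ENNReal.ofReal_toReal hfin, ← ENNReal.ofReal_mul (by positivity)]
  exact ENNReal.ofReal_le_ofReal key

end LowerBound

end RefinedBesov

namespace RefinedBesov

/-! ### Products and compositions with smooth functions -/

section PointwiseBounds

variable {E F : Type*} [NormedAddCommGroup E] [NormedSpace ℝ E] [NormedAddCommGroup F]
  [NormedSpace ℝ F]

/-- The bound is taken at least `1` so that it is dominated by its own positive powers, as the
estimate for derivatives of a composition requires. -/
theorem exists_norm_iteratedFDeriv_le {U K : Set E} (hU : IsOpen U) (hK : IsCompact K)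
    (hKU : K ⊆ U) {f : E → F} (hf : ContDiffOn ℝ ∞ f U) (n : ℕ) :
    ∃ C : ℝ, 1 ≤ C ∧ ∀ i ≤ n, ∀ x ∈ K, ‖iteratedFDerivWithin ℝ i f U x‖ ≤ C := by
  have h : ∀ i : ℕ, ∃ C : ℝ, ∀ x ∈ K, ‖iteratedFDerivWithin ℝ i f U x‖ ≤ C := fun i =>
    hK.exists_bound_of_continuousOn ((hf.continuousOn_iteratedFDerivWithin
      (mod_cast le_top) hU.uniqueDiffOn).mono hKU)
  choose C hC using h
  refine ⟨1 + ∑ i ∈ Finset.range (n + 1), |C i|, le_add_of_nonneg_right (by positivity),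
    fun i hi x hx => ?_⟩
  calc _ ≤ |C i| := (hC i x hx).trans (le_abs_self _)
    _ ≤ ∑ i ∈ Finset.range (n + 1), |C i| :=
      Finset.single_le_sum (f := fun i => |C i|) (fun _ _ => abs_nonneg _)
        (Finset.mem_range.2 (by omega))
    _ ≤ _ := by linarith

/-- The Leibniz and chain rules; what matters is that the constant depends on `a`, `ψ`, `K` and `n`
but not on `f`. -/
theorem exists_norm_iteratedFDeriv_mul_comp_le {U K : Set E} {W : Set F} (hU : IsOpen U)
    (hW : IsOpen W) (hK : IsCompact K) (hKU : K ⊆ U) {a : E → ℂ} (ha : ContDiffOn ℝ ∞ a U)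
    {ψ : E → F} (hψ : ContDiffOn ℝ ∞ ψ U) (hψW : MapsTo ψ U W) (n : ℕ) :
    ∃ C : ℝ≥0, ∀ f : F → ℂ, ContDiffOn ℝ ∞ f W → ∀ x ∈ K,
      ‖iteratedFDeriv ℝ n (fun x => a x * f (ψ x)) x‖ ≤
        C * ∑ i ∈ Finset.range (n + 1), ‖iteratedFDeriv ℝ i f (ψ x)‖ := by
  obtain ⟨A, hA1, hA⟩ := exists_norm_iteratedFDeriv_le hU hK hKU ha n
  obtain ⟨D, hD1, hD⟩ := exists_norm_iteratedFDeriv_le hU hK hKU hψ n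
  have hA0 : 0 ≤ A := by linarith
  have hD0 : 0 ≤ D := by linarith
  refine ⟨Real.toNNReal (∑ i ∈ Finset.range (n + 1), n.choose i * A *
    ((n - i).factorial * D ^ (n - i))), fun f hf x hx => ?_⟩
  set S := ∑ i ∈ Finset.range (n + 1), ‖iteratedFDeriv ℝ i f (ψ x)‖ with hS
  have hcomp : ∀ m ≤ n, ‖iteratedFDerivWithin ℝ m (fun x => f (ψ x)) U x‖ ≤
      m.factorial * S * D ^ m := by
    intro m hm
    refine norm_iteratedFDerivWithin_comp_le hf hψ (mod_cast le_top) hW.uniqueDiffOn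
      hU.uniqueDiffOn hψW (hKU hx) (fun i hi => ?_) (fun i hi him => ?_)
    · rw [iteratedFDerivWithin_of_isOpen i hW (hψW (hKU hx))]
      exact Finset.single_le_sum (f := fun i => ‖iteratedFDeriv ℝ i f (ψ x)‖)
        (fun _ _ => norm_nonneg _) (Finset.mem_range.2 (by omega))
    · exact (hD i (him.trans hm) x hx).trans (le_self_pow₀ hD1 (by omega))
  rw [← iteratedFDerivWithin_of_isOpen n hU (hKU hx), Real.coe_toNNReal _ (by positivity),
    Finset.sum_mul]
  refine (norm_iteratedFDerivWithin_mul_le ha (hf.comp hψ hψW) hU.uniqueDiffOn (hKU hx)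
    (mod_cast le_top)).trans (Finset.sum_le_sum fun i hi => ?_)
  have hi : i ≤ n := by simpa [Nat.lt_succ_iff] using hi
  calc _ ≤ (n.choose i : ℝ) * A * ((n - i).factorial * S * D ^ (n - i)) := by
        gcongr
        · exact hA i hi x hx
        · exact hcomp _ (Nat.sub_le _ _)
    _ = _ := by ring

theorem contDiff_det [FiniteDimensional ℝ E] :
    ContDiff ℝ ∞ (ContinuousLinearMap.det : (E →L[ℝ] E) → ℝ) := by
  classical
  have h : (ContinuousLinearMap.det : (E →L[ℝ] E) → ℝ) = fun L =>
      ∑ σ : Equiv.Perm (Fin (Module.finrank ℝ E)), (Equiv.Perm.sign σ : ℤ) • ∏ i,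
        (Module.finBasis ℝ E).repr (L (Module.finBasis ℝ E i)) (σ i) := by
    funext L
    rw [ContinuousLinearMap.det, ← LinearMap.det_toMatrix (Module.finBasis ℝ E), Matrix.det_apply]
    simp [LinearMap.toMatrix_apply, Units.smul_def]
  rw [h]
  refine ContDiff.sum fun σ _ => ?_
  have hp : ContDiff ℝ ∞ fun L : E →L[ℝ] E => ∏ i,
      (Module.finBasis ℝ E).repr (L (Module.finBasis ℝ E i)) (σ i) := by
    refine contDiff_prod fun i _ => ?_
    let l : (E →L[ℝ] E) →ₗ[ℝ] ℝ :=
      { toFun := fun L => (Module.finBasis ℝ E).repr (L (Module.finBasis ℝ E i)) (σ i)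
        map_add' := by simp
        map_smul' := by simp }
    exact (LinearMap.toContinuousLinearMap l).contDiff
  exact hp.const_smul _

theorem exists_contDiff_eq_one [FiniteDimensional ℝ E] {K U : Set E} (hK : IsCompact K)
    (hU : IsOpen U) (hKU : K ⊆ U) : ∃ η : E → ℝ, ContDiff ℝ ∞ η ∧ HasCompactSupport η ∧
      tsupport η ⊆ U ∧ ∀ x ∈ K, η x = 1 := by
  obtain ⟨L, hL, hKL, hLU⟩ := exists_compact_between hK hU hKU
  obtain ⟨η, h1, h0, -⟩ := exists_contMDiffMap_one_nhds_of_subset_interior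
    (modelWithCornersSelf ℝ E) (n := ⊤) hK.isClosed hKL
  have hs : tsupport η ⊆ L := closure_minimal
    (fun x hx => by_contra fun h => hx (h0 x h)) hL.isClosed
  exact ⟨η, η.contMDiff.contDiff, hL.of_isClosed_subset (isClosed_tsupport _) hs, hs.trans hLU,
    fun x hx => h1.self_of_nhdsSet x hx⟩

theorem contDiff_of_tsupport {f : E → F} {U : Set E} (hU : IsOpen U) (hf : ContDiffOn ℝ ∞ f U)
    (h : tsupport f ⊆ U) : ContDiff ℝ ∞ f := by
  refine contDiff_iff_contDiffAt.2 fun x => ?_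
  by_cases hx : x ∈ tsupport f
  · exact hf.contDiffAt (hU.mem_nhds (h hx))
  · exact contDiffAt_const.congr_of_eventuallyEq (notMem_tsupport_iff_eventuallyEq.1 hx)

end PointwiseBounds

/-! ### Cut off changes of variables -/

section CutComp

variable {d : ℕ}

/-- A smooth change of variables `ψ` and a smooth compactly supported function `a` that vanishes
off the domain of `ψ`. -/
structure IsCutDiffeo (ψ : OpenPartialHomeomorph (Eu d) (Eu d)) (a : Eu d → ℂ) : Prop where
  smooth : ContDiffOn ℝ ∞ ψ ψ.source
  smooth_symm : ContDiffOn ℝ ∞ ψ.symm ψ.target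
  smooth_cut : ContDiff ℝ ∞ a
  compact : HasCompactSupport a
  supp : tsupport a ⊆ ψ.source

namespace IsCutDiffeo

variable {ψ : OpenPartialHomeomorph (Eu d) (Eu d)} {a : Eu d → ℂ}

theorem contDiff_mul_comp (h : IsCutDiffeo ψ a) {f : Eu d → ℂ} (hf : ContDiff ℝ ∞ f) :
    ContDiff ℝ ∞ fun x => a x * f (ψ x) :=
  contDiff_of_tsupport ψ.open_source (h.smooth_cut.contDiffOn.mul (hf.comp_contDiffOn h.smooth))
    ((closure_mono (Function.support_mul_subset_left _ _)).trans h.supp)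

theorem iteratedFDeriv_eq_zero {f : Eu d → ℂ} (n : ℕ) {x : Eu d} (hx : x ∉ tsupport a) :
    iteratedFDeriv ℝ n (fun x => a x * f (ψ x)) x = 0 := by
  have : x ∉ tsupport fun x => a x * f (ψ x) :=
    fun h' => hx (closure_mono (Function.support_mul_subset_left _ _) h')
  exact Function.notMem_support.1 fun h' => this (support_iteratedFDeriv_subset n h')

theorem exists_norm_iteratedFDeriv_le (h : IsCutDiffeo ψ a) (n : ℕ) :
    ∃ C : ℝ≥0, ∀ (f : 𝓢(Eu d, ℂ)) x, ‖iteratedFDeriv ℝ n (fun x => a x * f (ψ x)) x‖ ≤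
      C * ∑ i ∈ Finset.range (n + 1),
        (tsupport a).indicator (fun x => ‖iteratedFDeriv ℝ i f (ψ x)‖) x := by
  obtain ⟨C, hC⟩ := exists_norm_iteratedFDeriv_mul_comp_le ψ.open_source isOpen_univ h.compact
    h.supp h.smooth_cut.contDiffOn h.smooth (mapsTo_univ _ _) n
  refine ⟨C, fun f x => ?_⟩
  by_cases hx : x ∈ tsupport a
  · simpa [hx] using hC f (f.smooth _).contDiffOn x hx
  · simp [hx, iteratedFDeriv_eq_zero]

theorem exists_seminorm_bound (h : IsCutDiffeo ψ a) (n : ℕ × ℕ) :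
    ∃ (s : Finset (ℕ × ℕ)) (C : ℝ), 0 ≤ C ∧
    ∀ (f : 𝓢(Eu d, ℂ)) (x : Eu d), ‖x‖ ^ n.1 * ‖iteratedFDeriv ℝ n.2 (fun x => a x * f (ψ x)) x‖ ≤
      C * (s.sup (schwartzSeminormFamily ℂ (Eu d) ℂ)) f := by
  obtain ⟨C, hC⟩ := h.exists_norm_iteratedFDeriv_le n.2
  obtain ⟨R, hR⟩ := h.compact.isCompact.isBounded.exists_norm_le
  refine ⟨(Finset.range (n.2 + 1)).image fun i => (0, i), |R| ^ n.1 * (C * (n.2 + 1)),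
    by positivity, fun f x => ?_⟩
  by_cases hx : x ∈ tsupport a
  · rw [mul_assoc, mul_assoc]
    gcongr
    · exact (hR x hx).trans (le_abs_self R)
    · refine (hC f x).trans ?_
      gcongr
      calc _ ≤ ∑ i ∈ Finset.range (n.2 + 1), (((Finset.range (n.2 + 1)).image fun i => (0, i)).sup
            (schwartzSeminormFamily ℂ (Eu d) ℂ)) f := by
            refine Finset.sum_le_sum fun i hi => ?_
            rw [indicator_of_mem hx]
            refine le_trans ?_ (Seminorm.le_finset_sup_apply (x := f)
              (Finset.mem_image_of_mem (fun i => (0, i)) hi))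
            simpa using SchwartzMap.le_seminorm ℂ 0 i f (ψ x)
        _ = _ := by simp
  · rw [iteratedFDeriv_eq_zero _ hx]
    simp only [norm_zero, mul_zero]
    positivity

/-- The operator `f ↦ a · (f ∘ ψ)` on the Schwartz space. -/
noncomputable def cutComp (h : IsCutDiffeo ψ a) : 𝓢(Eu d, ℂ) →L[ℂ] 𝓢(Eu d, ℂ) :=
  SchwartzMap.mkCLM (fun f x => a x * f (ψ x)) (fun f g x => by simp [mul_add])
    (fun c f x => by simp [mul_left_comm]) (fun f => h.contDiff_mul_comp (f.smooth ⊤))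
    h.exists_seminorm_bound

theorem cutComp_apply (h : IsCutDiffeo ψ a) (f : 𝓢(Eu d, ℂ)) (x : Eu d) :
    h.cutComp f x = a x * f (ψ x) := rfl

theorem hasFDerivAt (h : IsCutDiffeo ψ a) {x : Eu d} (hx : x ∈ ψ.source) :
    HasFDerivAt ψ (fderiv ℝ ψ x) x :=
  ((h.smooth.contDiffAt (ψ.open_source.mem_nhds hx)).differentiableAt (by simp)).hasFDerivAt

theorem hasFDerivAt_symm (h : IsCutDiffeo ψ a) {y : Eu d} (hy : y ∈ ψ.target) :
    HasFDerivAt ψ.symm (fderiv ℝ ψ.symm y) y :=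
  ((h.smooth_symm.contDiffAt (ψ.open_target.mem_nhds hy)).differentiableAt (by simp)).hasFDerivAt

theorem det_mul_det (h : IsCutDiffeo ψ a) {x : Eu d} (hx : x ∈ ψ.source) :
    (fderiv ℝ ψ.symm (ψ x)).det * (fderiv ℝ ψ x).det = 1 := by
  have h1 := (h.hasFDerivAt_symm (ψ.map_source hx)).comp x (h.hasFDerivAt hx)
  have h2 : HasFDerivAt (ψ.symm ∘ ψ) (ContinuousLinearMap.id ℝ (Eu d)) x :=
    (hasFDerivAt_id x).congr_of_eventuallyEq (ψ.eventually_left_inverse hx)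
  have h3 := congrArg ContinuousLinearMap.det (h1.unique h2)
  rw [ContinuousLinearMap.det, ContinuousLinearMap.toLinearMap_comp, LinearMap.det_comp] at h3
  simpa [ContinuousLinearMap.det] using h3

/-- The Jacobian of a diffeomorphism never vanishes, so its absolute value is as smooth as the
Jacobian. -/
theorem contDiffOn_det_symm (h : IsCutDiffeo ψ a) :
    ContDiffOn ℝ ∞ (fun y => |(fderiv ℝ ψ.symm y).det|) ψ.target := by
  have h1 : ContDiffOn ℝ ∞ (fun y => (fderiv ℝ ψ.symm y).det) ψ.target :=
    contDiff_det.comp_contDiffOn (h.smooth_symm.fderiv_of_isOpen ψ.open_target (by simp))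
  refine h1.abs fun y hy h0 => ?_
  have h2 := h.det_mul_det (ψ.map_target hy)
  rw [ψ.right_inv hy, h0, zero_mul] at h2
  exact zero_ne_one h2

theorem continuousOn_det (h : IsCutDiffeo ψ a) :
    ContinuousOn (fun y => (fderiv ℝ ψ.symm (ψ y)).det) ψ.source :=
  (contDiff_det.continuous.comp_continuousOn
    (h.smooth_symm.fderiv_of_isOpen ψ.open_target (m := ∞) (by simp)).continuousOn).comp
    ψ.continuousOn ψ.mapsTo

/-- Change of variables, with the Jacobian of the inverse map bounded on the compact support of `a`.
-/
theorem exists_lintegral_comp_le (h : IsCutDiffeo ψ a) : ∃ C : ℝ≥0, ∀ g : Eu d → ℝ≥0∞,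
    ∫⁻ x in tsupport a, g (ψ x) ≤ C * ∫⁻ x, g x := by
  obtain ⟨M, hM⟩ := h.compact.isCompact.exists_bound_of_continuousOn
    (h.continuousOn_det.mono h.supp)
  have hK : MeasurableSet (tsupport a) := (isClosed_tsupport a).measurableSet
  refine ⟨M.toNNReal, fun g => ?_⟩
  calc ∫⁻ x in tsupport a, g (ψ x)
      ≤ ∫⁻ x in tsupport a, M.toNNReal * (ENNReal.ofReal |(fderiv ℝ ψ x).det| * g (ψ x)) := by
        refine setLIntegral_mono' hK fun x hx => ?_
        have h1 : ENNReal.ofReal |(fderiv ℝ ψ.symm (ψ x)).det| *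
            ENNReal.ofReal |(fderiv ℝ ψ x).det| = 1 := by
          rw [← ENNReal.ofReal_mul (abs_nonneg _), ← abs_mul, h.det_mul_det (h.supp hx)]
          simp
        calc g (ψ x) = ENNReal.ofReal |(fderiv ℝ ψ.symm (ψ x)).det| *
            (ENNReal.ofReal |(fderiv ℝ ψ x).det| * g (ψ x)) := by rw [← mul_assoc, h1, one_mul]
          _ ≤ _ := by
            gcongr
            exact ENNReal.ofReal_le_ofReal (by simpa using hM x hx)
    _ = M.toNNReal * ∫⁻ x in tsupport a, ENNReal.ofReal |(fderiv ℝ ψ x).det| * g (ψ x) :=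
        lintegral_const_mul' _ _ ENNReal.coe_ne_top
    _ = M.toNNReal * ∫⁻ x in ψ '' tsupport a, g x := by
        rw [lintegral_image_eq_lintegral_abs_det_fderiv_mul volume hK
          (fun x hx => (h.hasFDerivAt (h.supp hx)).hasFDerivWithinAt) (ψ.injOn.mono h.supp)]
    _ ≤ _ := by
        gcongr
        exact Measure.restrict_le_self

theorem isSobolevBounded {p : ℝ} (h : IsCutDiffeo ψ a) (hp : 1 ≤ p) :
    IsSobolevBounded p h.cutComp := by
  intro N
  obtain ⟨C, hC⟩ := h.exists_norm_iteratedFDeriv_le N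
  obtain ⟨B, hB⟩ := h.exists_lintegral_comp_le
  have hp0 : 0 < p := by linarith
  have hK : MeasurableSet (tsupport a) := (isClosed_tsupport a).measurableSet
  refine ⟨C * B ^ (1 / p), fun f => ?_⟩
  have hcont : ∀ i : ℕ, ContinuousOn (fun x => ‖iteratedFDeriv ℝ i f (ψ x)‖) (tsupport a) :=
    fun i => ((continuous_iteratedFDeriv_schwartz i f).norm.comp_continuousOn
      (ψ.continuousOn.mono h.supp))
  calc derivNorm p N (h.cutComp f)
      ≤ eLpNorm (fun x => (C : ℝ) * ∑ i ∈ Finset.range (N + 1),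
          (tsupport a).indicator (fun x => ‖iteratedFDeriv ℝ i f (ψ x)‖) x)
          (ENNReal.ofReal p) volume := eLpNorm_mono_real (hC f)
    _ = C * eLpNorm (∑ i ∈ Finset.range (N + 1),
          (tsupport a).indicator (fun x => ‖iteratedFDeriv ℝ i f (ψ x)‖))
          (ENNReal.ofReal p) volume := by
        have := eLpNorm_const_smul (C : ℝ) (∑ i ∈ Finset.range (N + 1),
          (tsupport a).indicator (fun x => ‖iteratedFDeriv ℝ i f (ψ x)‖))
          (ENNReal.ofReal p) (volume : Measure (Eu d))
        have hCC : ‖(C : ℝ)‖ₑ = C := by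
          rw [Real.enorm_eq_ofReal C.coe_nonneg, ENNReal.ofReal_coe_nnreal]
        rw [← hCC, ← this]
        congr 1
        funext x
        simp
    _ ≤ C * ∑ i ∈ Finset.range (N + 1), eLpNorm
          ((tsupport a).indicator (fun x => ‖iteratedFDeriv ℝ i f (ψ x)‖))
          (ENNReal.ofReal p) volume := by
        gcongr
        refine eLpNorm_sum_le (fun i _ => ?_) (by simpa using hp)
        exact (aestronglyMeasurable_indicator_iff hK).2 ((hcont i).aestronglyMeasurable hK)
    _ ≤ C * ∑ i ∈ Finset.range (N + 1), (B : ℝ≥0∞) ^ (1 / p) * derivNorm p i f := by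
        gcongr with i hi
        rw [eLpNorm_indicator_eq_eLpNorm_restrict hK, derivNorm, eLpNorm_norm,
          eLpNorm_ofReal hp0, eLpNorm_ofReal hp0, ← ENNReal.mul_rpow_of_nonneg _ _ (by positivity)]
        gcongr
        exact hB fun y => ‖iteratedFDeriv ℝ i f y‖ₑ ^ p
    _ = _ := by
        rw [← Finset.mul_sum, ENNReal.coe_mul, ENNReal.coe_rpow_of_nonneg _ (by positivity),
          mul_assoc]

/-- The cut off function of the transposed operator. -/
noncomputable def transposeCut (ψ : OpenPartialHomeomorph (Eu d) (Eu d)) (a : Eu d → ℂ) :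
    Eu d → ℂ :=
  ψ.target.indicator fun y => a (ψ.symm y) * (|(fderiv ℝ ψ.symm y).det| : ℝ)

theorem tsupport_transposeCut_subset (h : IsCutDiffeo ψ a) :
    tsupport (transposeCut ψ a) ⊆ ψ '' tsupport a := by
  refine closure_minimal (fun y hy => ?_)
    (h.compact.isCompact.image_of_continuousOn (ψ.continuousOn.mono h.supp)).isClosed
  have hyt : y ∈ ψ.target := mem_of_indicator_ne_zero hy
  refine ⟨ψ.symm y, subset_tsupport a fun h0 => hy ?_, ψ.right_inv hyt⟩
  simp [transposeCut, h0]

/-- The class of cut off changes of variables is closed under transposition, so one Sobolev estimate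
serves both an operator and its transpose. -/
theorem transpose (h : IsCutDiffeo ψ a) : IsCutDiffeo ψ.symm (transposeCut ψ a) where
  smooth := h.smooth_symm
  smooth_symm := by simpa using h.smooth
  smooth_cut := by
    refine contDiff_of_tsupport ψ.open_target ?_ (h.tsupport_transposeCut_subset.trans
      ((image_mono h.supp).trans ψ.mapsTo.image_subset))
    refine ((h.smooth_cut.comp_contDiffOn h.smooth_symm).mul
      (Complex.ofRealCLM.contDiff.comp_contDiffOn h.contDiffOn_det_symm)).congr fun y hy => ?_
    simp [transposeCut, hy]
  compact := (h.compact.isCompact.image_of_continuousOn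
    (ψ.continuousOn.mono h.supp)).of_isClosed_subset (isClosed_tsupport _)
      h.tsupport_transposeCut_subset
  supp := h.tsupport_transposeCut_subset.trans
    ((image_mono h.supp).trans ψ.mapsTo.image_subset)

theorem isTranspose (h : IsCutDiffeo ψ a) : IsTranspose h.cutComp h.transpose.cutComp := by
  intro f g
  simp only [cutComp_apply]
  have h1 : ∫ x, a x * f (ψ x) * g x = ∫ x in ψ.source, a x * f (ψ x) * g x := by
    refine (setIntegral_eq_integral_of_forall_compl_eq_zero fun x hx => ?_).symm
    rw [image_eq_zero_of_notMem_tsupport fun h' => hx (h.supp h'), zero_mul, zero_mul]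
  have h2 : ∫ y, f y * (transposeCut ψ a y * g (ψ.symm y)) =
      ∫ y in ψ.target, f y * (transposeCut ψ a y * g (ψ.symm y)) := by
    refine (setIntegral_eq_integral_of_forall_compl_eq_zero fun x hx => ?_).symm
    rw [transposeCut, indicator_of_notMem hx, zero_mul, mul_zero]
  rw [h1, h2, ← ψ.image_source_eq_target, integral_image_eq_integral_abs_det_fderiv_smul volume
    ψ.open_source.measurableSet (fun x hx => (h.hasFDerivAt hx).hasFDerivWithinAt) ψ.injOn]
  refine setIntegral_congr_fun ψ.open_source.measurableSet fun x hx => ?_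
  have h3 : (|(fderiv ℝ ψ.symm (ψ x)).det| : ℝ) * |(fderiv ℝ ψ x).det| = (1 : ℝ) := by
    rw [← abs_mul, h.det_mul_det hx, abs_one]
  have h4 : ((|(fderiv ℝ ψ.symm (ψ x)).det| : ℝ) : ℂ) * (|(fderiv ℝ ψ x).det| : ℝ) = 1 := by
    exact_mod_cast h3
  simp only [transposeCut, indicator_of_mem (ψ.map_source hx), ψ.left_inv hx,
    Complex.real_smul]
  linear_combination (-(a x * f (ψ x) * g x)) * h4

end IsCutDiffeo

theorem IsCutDiffeo.exists_besovENorm_precomp_le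
    {ψ : OpenPartialHomeomorph (Eu d) (Eu d)} {a : Eu d → ℂ} (h : IsCutDiffeo ψ a)
    {β₀ : Eu d → ℂ} (hβ : IsCutoff β₀) {p q : ℝ} (hpq : p.HolderConjugate q) (s : ℝ) {φ : ℝ → ℝ}
    (hφ : IsUpsilon φ) : ∃ C : ℝ≥0, ∀ w, besovENorm β₀ s φ p
      (PointwiseConvergenceCLM.precomp ℂ h.cutComp w) ≤ C * besovENorm β₀ s φ p w :=
  RefinedBesov.exists_besovENorm_precomp_le hβ hpq s hφ h.cutComp
    (h.isSobolevBounded hpq.symm.lt.le) (h.transpose.isSobolevBounded hpq.lt.le) h.isTranspose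

end CutComp

end RefinedBesov

namespace RefinedBesov

/-! ### Charts of a hypersurface -/

namespace SmoothChart

variable {d : ℕ} {Γ : Set (Eu (d + 1))}

theorem contDiffAt (e : SmoothChart Γ) {x : Eu d} (hx : x ∈ e.π.source) :
    ContDiffAt ℝ ∞ (fun x => (e.π x : Eu (d + 1))) x :=
  e.smooth.contDiffAt (e.π.open_source.mem_nhds hx)

/-- A linear left inverse `L` of the injective differential makes `L ∘ π` a map of `ℝ^d` with
identity derivative at `x`; the inverse function theorem inverts it, and the composite with `L` is a
smooth left inverse of `π`. -/
theorem exists_contDiffAt_leftInverse (e : SmoothChart Γ) {x : Eu d} (hx : x ∈ e.π.source) :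
    ∃ G : Eu (d + 1) → Eu d, ContDiffAt ℝ ∞ G (e.π x : Eu (d + 1)) ∧
      ∀ᶠ z in 𝓝 x, G (e.π z : Eu (d + 1)) = z := by
  obtain ⟨l, hl⟩ := LinearMap.exists_leftInverse_of_injective
    (fderiv ℝ (fun x => (e.π x : Eu (d + 1))) x : Eu d →ₗ[ℝ] Eu (d + 1))
    (LinearMap.ker_eq_bot.2 (e.immersion x hx))
  let L : Eu (d + 1) →L[ℝ] Eu d := LinearMap.toContinuousLinearMap l
  have hf : ContDiffAt ℝ ∞ (fun z => L (e.π z : Eu (d + 1))) x :=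
    L.contDiff.contDiffAt.comp x (e.contDiffAt hx)
  have hf' : HasFDerivAt (fun z => L (e.π z : Eu (d + 1)))
      ((ContinuousLinearEquiv.refl ℝ (Eu d) : Eu d ≃L[ℝ] Eu d) : Eu d →L[ℝ] Eu d) x := by
    have h1 := L.hasFDerivAt.comp x ((e.contDiffAt hx).differentiableAt (by simp)).hasFDerivAt
    have h2 : L ∘L fderiv ℝ (fun x => (e.π x : Eu (d + 1))) x =
        (ContinuousLinearEquiv.refl ℝ (Eu d) : Eu d ≃L[ℝ] Eu d) :=
      ContinuousLinearMap.ext fun v => LinearMap.congr_fun hl v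
    rw [← h2]
    exact h1
  have hn : (∞ : WithTop ℕ∞) ≠ 0 := by simp
  exact ⟨fun y => hf.localInverse hf' hn (L y),
    (hf.to_localInverse hf' hn).comp _ L.contDiff.contDiffAt,
    (hf.hasStrictFDerivAt' hf' hn).eventually_left_inverse⟩

/-- The transition map `x ↦ π'⁻¹ (π x)` between two charts. -/
noncomputable def transition (e e' : SmoothChart Γ) : OpenPartialHomeomorph (Eu d) (Eu d) :=
  e.π.trans e'.π.symm

theorem mem_transition_source {e e' : SmoothChart Γ} {x : Eu d} :
    x ∈ (e.transition e').source ↔ x ∈ e.π.source ∧ e.π x ∈ e'.π.target := by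
  simp [transition]

theorem transition_apply (e e' : SmoothChart Γ) (x : Eu d) :
    e.transition e' x = e'.π.symm (e.π x) := rfl

theorem transition_symm (e e' : SmoothChart Γ) : (e.transition e').symm = e'.transition e := by
  simp [transition, OpenPartialHomeomorph.trans_symm_eq_symm_trans_symm]

theorem mapsTo_transition (e e' : SmoothChart Γ) :
    MapsTo (e.transition e') (e.transition e').source e'.π.source := fun _ hx =>
  e'.π.map_target (mem_transition_source.1 hx).2

theorem contDiffOn_transition (e e' : SmoothChart Γ) :
    ContDiffOn ℝ ∞ (e.transition e') (e.transition e').source := by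
  intro x hx
  obtain ⟨hx1, hx2⟩ := mem_transition_source.1 hx
  obtain ⟨G, hG, hGe⟩ := e'.exists_contDiffAt_leftInverse (mapsTo_transition e e' hx)
  rw [transition_apply, e'.π.right_inv hx2] at hG
  -- Near `x` the transition map is the smooth left inverse of the second chart composed with the
  -- first chart, both regarded in the ambient space.
  have h1 : ∀ᶠ z in 𝓝 x, e.transition e' z = G (e.π z : Eu (d + 1)) := by
    have hc : ContinuousAt (e.transition e') x := (e.transition e').continuousAt hx
    filter_upwards [hc.eventually hGe, (e.transition e').open_source.mem_nhds hx] with z hz hzs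
    rw [transition_apply, e'.π.right_inv (mem_transition_source.1 hzs).2] at hz
    exact hz.symm
  exact ((hG.comp x (e.contDiffAt hx1)).congr_of_eventuallyEq h1).contDiffWithinAt

theorem contDiffOn_transition_symm (e e' : SmoothChart Γ) :
    ContDiffOn ℝ ∞ (e.transition e').symm (e.transition e').target := by
  have := contDiffOn_transition e' e
  rwa [← transition_symm] at this

/-- The Gram operator is positive, so its determinant is a product of nonnegative eigenvalues; it is
injective because the differential is. -/
theorem density_sq_pos (e : SmoothChart Γ) {x : Eu d} (hx : x ∈ e.π.source) :
    0 < (ContinuousLinearMap.adjoint (fderiv ℝ (fun x => (e.π x : Eu (d + 1))) x) ∘L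
      fderiv ℝ (fun x => (e.π x : Eu (d + 1))) x).det := by
  set D := fderiv ℝ (fun x => (e.π x : Eu (d + 1))) x with hD
  have hpos := (ContinuousLinearMap.isPositive_adjoint_comp_self D).toLinearMap
  refine lt_of_le_of_ne ?_ fun h0 => ?_
  · rw [ContinuousLinearMap.det, hpos.isSymmetric.det_eq_prod_eigenvalues rfl]
    exact Finset.prod_nonneg fun i _ => hpos.nonneg_eigenvalues rfl i
  · obtain ⟨v, hv, hv0⟩ := (Submodule.ne_bot_iff _).1
      (LinearMap.bot_lt_ker_of_det_eq_zero h0.symm).ne'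
    refine hv0 (e.immersion x hx ?_)
    have h1 : ContinuousLinearMap.adjoint D (D v) = 0 := hv
    have h2 : inner ℝ (D v) (D v) = 0 := by
      rw [← ContinuousLinearMap.adjoint_inner_right, h1, inner_zero_right]
    rw [← hD, map_zero]
    exact inner_self_eq_zero.1 h2

theorem density_pos (e : SmoothChart Γ) {x : Eu d} (hx : x ∈ e.π.source) : 0 < e.density x :=
  Real.sqrt_pos.2 (e.density_sq_pos hx)

theorem contDiffOn_density (e : SmoothChart Γ) : ContDiffOn ℝ ∞ e.density e.π.source := by
  let adj : (Eu d →L[ℝ] Eu (d + 1)) →ₗ[ℝ] Eu (d + 1) →L[ℝ] Eu d :=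
    { toFun := ContinuousLinearMap.adjoint
      map_add' := map_add _
      map_smul' := fun c D => by simp }
  have h1 : ContDiffOn ℝ ∞ (fderiv ℝ fun x => (e.π x : Eu (d + 1))) e.π.source :=
    e.smooth.fderiv_of_isOpen e.π.open_source (by simp)
  have h2 : ContDiffOn ℝ ∞ (fun x => ContinuousLinearMap.adjoint
      (fderiv ℝ (fun x => (e.π x : Eu (d + 1))) x)) e.π.source :=
    (LinearMap.toContinuousLinearMap adj).contDiff.comp_contDiffOn h1
  exact (contDiff_det.comp_contDiffOn (h2.clm_comp h1)).sqrt fun x hx => (e.density_sq_pos hx).ne'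

theorem contDiffOn_density_inv (e : SmoothChart Γ) :
    ContDiffOn ℝ ∞ (fun x => ((e.density x : ℂ))⁻¹) e.π.source :=
  (Complex.ofRealCLM.contDiff.comp_contDiffOn e.contDiffOn_density).inv fun x hx => by
    simpa using (e.density_pos hx).ne'

theorem isCompact_inter_preimage (e : SmoothChart Γ) {K : Set (Eu d)} (hK : IsCompact K)
    (hKe : K ⊆ e.π.source) {S : Set Γ} (hS : IsClosed S) : IsCompact (K ∩ e.π ⁻¹' S) :=
  hK.of_isClosed_subset ((e.π.continuousOn.mono hKe).preimage_isClosed_of_isClosed hK.isClosed hS)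
    inter_subset_left

end SmoothChart

end RefinedBesov

namespace RefinedBesov

/-! ### Passage between functions on the hypersurface and functions in a chart -/

section LocalOperators

variable {d : ℕ} {Γ : Set (Eu (d + 1))}

theorem SmoothFunction.contDiffOn (g : SmoothFunction Γ) (e : SmoothChart Γ) :
    ContDiffOn ℝ ∞ (fun x => g (e.π x)) e.π.source := g.2 e

theorem SmoothFunction.ext {g h : SmoothFunction Γ} (H : ∀ y, g y = h y) : g = h :=
  Subtype.ext (funext H)

theorem SmoothFunction.contDiffAt (g : SmoothFunction Γ) (e : SmoothChart Γ) {x : Eu d}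
    (hx : x ∈ e.π.source) : ContDiffAt ℝ ∞ (fun x => g (e.π x)) x :=
  (g.contDiffOn e).contDiffAt (e.π.open_source.mem_nhds hx)

theorem SmoothFunction.tendstoUniformlyOn (e : SmoothChart Γ) (m : ℕ) {K : Set (Eu d)}
    (hK : IsCompact K) (hKe : K ⊆ e.π.source) (g₀ : SmoothFunction Γ) :
    TendstoUniformlyOn (fun (g : SmoothFunction Γ) => iteratedFDeriv ℝ m fun x => g (e.π x))
      (iteratedFDeriv ℝ m fun x => g₀ (e.π x)) (𝓝 g₀) K := by
  have h : Continuous fun g : SmoothFunction Γ =>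
      UniformOnFun.ofFun {K : Set (Eu d) | IsCompact K ∧ K ⊆ e.π.source}
        (iteratedFDeriv ℝ m (fun x => g (e.π x))) :=
    continuous_iff_le_induced.2 ((iInf_le _ e).trans (iInf_le _ m))
  exact UniformOnFun.tendsto_iff_tendstoUniformlyOn.1 (h.tendsto g₀) K ⟨hK, hKe⟩

theorem SmoothFunction.continuous_of_tendstoUniformlyOn {X : Type*} [TopologicalSpace X]
    {L : X → SmoothFunction Γ}
    (h : ∀ (e : SmoothChart Γ) (m : ℕ) (K : Set (Eu d)), IsCompact K → K ⊆ e.π.source → ∀ x₀,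
      TendstoUniformlyOn (fun x => iteratedFDeriv ℝ m fun z => L x (e.π z))
        (iteratedFDeriv ℝ m fun z => L x₀ (e.π z)) (𝓝 x₀) K) : Continuous L := by
  refine continuous_iInf_rng.2 fun e => continuous_iInf_rng.2 fun m => continuous_induced_rng.2 ?_
  exact continuous_iff_continuousAt.2 fun x₀ =>
    UniformOnFun.tendsto_iff_tendstoUniformlyOn.2 fun K hK => h e m K hK.1 hK.2 x₀

/-- The function `χ · (f / J) ∘ π⁻¹` on `Γ`. -/
noncomputable def pushFun (e : SmoothChart Γ) (χ : Γ → ℂ) (f : Eu d → ℂ) (y : Γ) : ℂ :=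
  χ y * (f (e.π.symm y) / (e.density (e.π.symm y) : ℂ))

/-- The factor in the expression of `pushFun` in another chart. -/
noncomputable def pushFactor (e e' : SmoothChart Γ) (χ : Γ → ℂ) (x : Eu d) : ℂ :=
  χ (e'.π x) * (e.density (e'.transition e x) : ℂ)⁻¹

theorem pushFun_apply_chart (e e' : SmoothChart Γ) (χ : Γ → ℂ) (f : Eu d → ℂ) (x : Eu d) :
    pushFun e χ f (e'.π x) = pushFactor e e' χ x * f (e'.transition e x) := by
  simp only [pushFun, pushFactor, SmoothChart.transition_apply]
  ring

theorem contDiffOn_pushFactor (e e' : SmoothChart Γ) (χ : SmoothFunction Γ) :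
    ContDiffOn ℝ ∞ (pushFactor e e' χ) (e'.transition e).source :=
  ((χ.contDiffOn e').mono fun _ hx => (SmoothChart.mem_transition_source.1 hx).1).mul
    (e.contDiffOn_density_inv.comp (e'.contDiffOn_transition e) (e'.mapsTo_transition e))

/-- Off the range of the chart the values of `π⁻¹` carry no meaning. They are annihilated by `χ`, so
smoothness and bounds need a proof over the support of `χ` only. -/
theorem pushFun_eventuallyEq_zero (e e' : SmoothChart Γ) {χ : Γ → ℂ} (f : Eu d → ℂ) {x : Eu d}
    (hx : x ∈ e'.π.source) (hχ : e'.π x ∉ tsupport χ) :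
    (fun x => pushFun e χ f (e'.π x)) =ᶠ[𝓝 x] 0 := by
  filter_upwards [(e'.π.continuousAt hx).eventually (notMem_tsupport_iff_eventuallyEq.1 hχ)]
    with z hz
  simp only [pushFun, hz, Pi.zero_apply, zero_mul]

theorem pushFun_mem (e : SmoothChart Γ) (χ : SmoothFunction Γ)
    (hχ : tsupport (χ : Γ → ℂ) ⊆ e.π.target) {f : Eu d → ℂ} (hf : ContDiff ℝ ∞ f) :
    pushFun e χ f ∈ smoothSubmodule Γ := by
  intro e' x hx
  by_cases hxχ : e'.π x ∈ tsupport (χ : Γ → ℂ)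
  · have hxs : x ∈ (e'.transition e).source := SmoothChart.mem_transition_source.2 ⟨hx, hχ hxχ⟩
    have h1 : ContDiffOn ℝ ∞ (fun x => pushFactor e e' χ x * f (e'.transition e x))
        (e'.transition e).source :=
      (contDiffOn_pushFactor e e' χ).mul (hf.comp_contDiffOn (e'.contDiffOn_transition e))
    simp only [pushFun_apply_chart]
    exact (h1.contDiffAt ((e'.transition e).open_source.mem_nhds hxs)).contDiffWithinAt
  · exact (contDiffAt_const.congr_of_eventuallyEq
      (pushFun_eventuallyEq_zero e e' f hx hxχ)).contDiffWithinAt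

theorem exists_norm_iteratedFDeriv_pushFun_le (e e' : SmoothChart Γ) (χ : SmoothFunction Γ)
    (hχ : tsupport (χ : Γ → ℂ) ⊆ e.π.target) {K : Set (Eu d)} (hK : IsCompact K)
    (hKe : K ⊆ e'.π.source) (n : ℕ) :
    ∃ C : ℝ≥0, ∀ f : 𝓢(Eu d, ℂ), ∀ x ∈ K,
      ‖iteratedFDeriv ℝ n (fun x => pushFun e χ f (e'.π x)) x‖ ≤
        C * ∑ i ∈ Finset.range (n + 1), SchwartzMap.seminorm ℂ 0 i f := by
  obtain ⟨C, hC⟩ := exists_norm_iteratedFDeriv_mul_comp_le (e'.transition e).open_source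
    isOpen_univ (e'.isCompact_inter_preimage hK hKe (isClosed_tsupport (χ : Γ → ℂ)))
    (fun x hx => SmoothChart.mem_transition_source.2 ⟨hKe hx.1, hχ hx.2⟩)
    (contDiffOn_pushFactor e e' χ) (e'.contDiffOn_transition e) (mapsTo_univ _ _) n
  refine ⟨C, fun f x hx => ?_⟩
  by_cases hxχ : e'.π x ∈ tsupport (χ : Γ → ℂ)
  · simp only [pushFun_apply_chart]
    refine (hC f (f.smooth _).contDiffOn x ⟨hx, hxχ⟩).trans ?_
    gcongr with i hi
    simpa using SchwartzMap.le_seminorm ℂ 0 i f (e'.transition e x)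
  · have h0 := (pushFun_eventuallyEq_zero e e' f (hKe hx) hxχ).iteratedFDeriv ℝ n
    rw [h0.self_of_nhds]
    simp only [iteratedFDeriv_zero, Pi.zero_apply, norm_zero]
    positivity

/-- The operator `f ↦ χ · (f / J) ∘ π⁻¹` from test functions on `ℝ^d` to functions on `Γ`. -/
noncomputable def push (e : SmoothChart Γ) (χ : SmoothFunction Γ)
    (hχ : tsupport (χ : Γ → ℂ) ⊆ e.π.target) : 𝓢(Eu d, ℂ) →L[ℂ] SmoothFunction Γ where
  toFun f := ⟨pushFun e χ f, pushFun_mem e χ hχ (f.smooth ⊤)⟩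
  map_add' f g := SmoothFunction.ext fun y => by
    change pushFun e χ _ y = pushFun e χ _ y + pushFun e χ _ y
    simp only [pushFun, add_apply]
    ring
  map_smul' c f := SmoothFunction.ext fun y => by
    change pushFun e χ _ y = c * pushFun e χ _ y
    simp only [pushFun, smul_apply, smul_eq_mul]
    ring
  cont := by
    refine SmoothFunction.continuous_of_tendstoUniformlyOn fun e' m K hK hKe f₀ => ?_
    obtain ⟨C, hC⟩ := exists_norm_iteratedFDeriv_pushFun_le e e' χ hχ hK hKe m
    refine Metric.tendstoUniformlyOn_iff.2 fun ε hε => ?_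
    have hS : Tendsto (fun f : 𝓢(Eu d, ℂ) =>
        (C : ℝ) * ∑ i ∈ Finset.range (m + 1), SchwartzMap.seminorm ℂ 0 i (f₀ - f)) (𝓝 f₀)
        (𝓝 0) := by
      have : Continuous fun f : 𝓢(Eu d, ℂ) =>
          (C : ℝ) * ∑ i ∈ Finset.range (m + 1), SchwartzMap.seminorm ℂ 0 i (f₀ - f) :=
        continuous_const.mul (continuous_finsetSum _ fun i _ =>
          ((schwartz_withSeminorms ℂ (Eu d) ℂ).continuous_seminorm (0, i)).comp
            (continuous_const.sub continuous_id))
      simpa using this.tendsto f₀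
    filter_upwards [hS.eventually (gt_mem_nhds hε)] with f hf x hx
    have hsm : ∀ f : 𝓢(Eu d, ℂ), ContDiffAt ℝ m (fun x => pushFun e χ f (e'.π x)) x := fun f =>
      (SmoothFunction.contDiffAt ⟨pushFun e χ f, pushFun_mem e χ hχ (f.smooth ⊤)⟩ e'
        (hKe hx)).of_le (mod_cast le_top)
    refine lt_of_le_of_lt ?_ hf
    rw [dist_eq_norm]
    refine le_trans (le_of_eq ?_) (hC (f₀ - f) x hx)
    change ‖iteratedFDeriv ℝ m (fun x => pushFun e χ f₀ (e'.π x)) x -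
      iteratedFDeriv ℝ m (fun x => pushFun e χ f (e'.π x)) x‖ = _
    rw [← iteratedFDeriv_sub_apply (hsm f₀) (hsm f)]
    congr 3
    funext x
    simp only [pushFun, sub_apply, Pi.sub_apply]
    ring

theorem push_apply (e : SmoothChart Γ) (χ : SmoothFunction Γ)
    (hχ : tsupport (χ : Γ → ℂ) ⊆ e.π.target) (f : 𝓢(Eu d, ℂ)) (y : Γ) :
    push e χ hχ f y = χ y * (f (e.π.symm y) / (e.density (e.π.symm y) : ℂ)) := rfl

/-- A smooth function with compact support in the domain of a chart. -/
structure IsChartCutoff (e : SmoothChart Γ) (η : Eu d → ℝ) : Prop where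
  smooth : ContDiff ℝ ∞ η
  compact : HasCompactSupport η
  supp : tsupport η ⊆ e.π.source

/-- The function `η · J`. -/
noncomputable def pullFactor (e : SmoothChart Γ) (η : Eu d → ℝ) (x : Eu d) : ℂ :=
  (η x : ℂ) * (e.density x : ℂ)

namespace IsChartCutoff

variable {e : SmoothChart Γ} {η : Eu d → ℝ}

theorem contDiffOn_pullFactor (h : IsChartCutoff e η) :
    ContDiffOn ℝ ∞ (pullFactor e η) e.π.source :=
  (Complex.ofRealCLM.contDiff.comp h.smooth).contDiffOn.mul
    (Complex.ofRealCLM.contDiff.comp_contDiffOn e.contDiffOn_density)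

theorem tsupport_pullFactor_mul_subset (g : Eu d → ℂ) :
    tsupport (fun x => pullFactor e η x * g x) ⊆ tsupport η := by
  refine closure_mono fun x hx h0 => hx ?_
  simp [pullFactor, h0]

theorem contDiff_pullFactor_mul (h : IsChartCutoff e η) (g : SmoothFunction Γ) :
    ContDiff ℝ ∞ fun x => pullFactor e η x * g (e.π x) :=
  contDiff_of_tsupport e.π.open_source (h.contDiffOn_pullFactor.mul (g.contDiffOn e))
    ((tsupport_pullFactor_mul_subset _).trans h.supp)

theorem hasCompactSupport_pullFactor_mul (h : IsChartCutoff e η) (g : Eu d → ℂ) :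
    HasCompactSupport fun x => pullFactor e η x * g x :=
  h.compact.isCompact.of_isClosed_subset (isClosed_tsupport _) (tsupport_pullFactor_mul_subset g)

/-- The operator `g ↦ η J · (g ∘ π)` from functions on `Γ` to test functions on `ℝ^d`. -/
noncomputable def pull (h : IsChartCutoff e η) : SmoothFunction Γ →L[ℂ] 𝓢(Eu d, ℂ) where
  toFun g := (h.hasCompactSupport_pullFactor_mul fun x => g (e.π x)).toSchwartzMap
    (h.contDiff_pullFactor_mul g)
  map_add' f g := by
    ext x
    exact mul_add (pullFactor e η x) (f (e.π x)) (g (e.π x))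
  map_smul' c f := by
    ext x
    exact mul_left_comm (pullFactor e η x) c (f (e.π x))
  cont := by
    refine continuous_iff_continuousAt.2 fun g₀ =>
      ((schwartz_withSeminorms ℂ (Eu d) ℂ).tendsto_nhds _ _).2 fun n ε hε => ?_
    obtain ⟨C, hC⟩ := exists_norm_iteratedFDeriv_mul_comp_le e.π.open_source e.π.open_source
      h.compact.isCompact h.supp h.contDiffOn_pullFactor contDiffOn_id (mapsTo_id _) n.2
    obtain ⟨R, hR⟩ := h.compact.isCompact.isBounded.exists_norm_le
    set B : ℝ := |R| ^ n.1 * (C * (n.2 + 1)) with hB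
    have hB0 : 0 ≤ B := by positivity
    have hu : ∀ᶠ g : SmoothFunction Γ in 𝓝 g₀, ∀ i ∈ Finset.range (n.2 + 1), ∀ x ∈ tsupport η,
        dist (iteratedFDeriv ℝ i (fun x => g₀ (e.π x)) x)
          (iteratedFDeriv ℝ i (fun x => g (e.π x)) x) < ε / (B + 1) := by
      -- Seminorms of `pull g` involve finitely many derivatives of `g ∘ π` on the compact support
      -- of `η`, and these converge uniformly there by the definition of the topology of `C^∞(Γ)`.
      -- Closeness `ε / (B + 1)` leaves room for the factor `B`.
      refine (Finset.eventually_all _).2 fun i _ => ?_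
      exact Metric.tendstoUniformlyOn_iff.1 (SmoothFunction.tendstoUniformlyOn e i
        h.compact.isCompact h.supp g₀) _ (by positivity)
    filter_upwards [hu] with g hg
    refine lt_of_le_of_lt (b := B * (ε / (B + 1))) ?_ ?_
    · refine SchwartzMap.seminorm_le_bound ℂ n.1 n.2 _ (by positivity) fun x => ?_
      set u : Eu d → ℂ := fun x => pullFactor e η x * (g (e.π x) - g₀ (e.π x)) with hu_def
      have hcoe : ⇑((h.hasCompactSupport_pullFactor_mul fun x => g (e.π x)).toSchwartzMap
          (h.contDiff_pullFactor_mul g) -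
          (h.hasCompactSupport_pullFactor_mul fun x => g₀ (e.π x)).toSchwartzMap
          (h.contDiff_pullFactor_mul g₀)) = u :=
        funext fun x => (mul_sub (pullFactor e η x) (g (e.π x)) (g₀ (e.π x))).symm
      change ‖x‖ ^ n.1 * ‖iteratedFDeriv ℝ n.2 (⇑((h.hasCompactSupport_pullFactor_mul
        fun x => g (e.π x)).toSchwartzMap (h.contDiff_pullFactor_mul g) -
          (h.hasCompactSupport_pullFactor_mul fun x => g₀ (e.π x)).toSchwartzMap
          (h.contDiff_pullFactor_mul g₀))) x‖ ≤ _
      rw [hcoe]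
      by_cases hx : x ∈ tsupport η
      · have h1 := hC (fun x => g (e.π x) - g₀ (e.π x))
          ((g.contDiffOn e).sub (g₀.contDiffOn e)) x hx
        have h2 : ∀ i ∈ Finset.range (n.2 + 1),
            ‖iteratedFDeriv ℝ i (fun x => g (e.π x) - g₀ (e.π x)) x‖ ≤ ε / (B + 1) := by
          intro i hi
          have h3 := iteratedFDeriv_sub_apply (i := i)
            ((g.contDiffAt e (h.supp hx)).of_le (mod_cast le_top))
            ((g₀.contDiffAt e (h.supp hx)).of_le (mod_cast le_top))
          refine le_trans (le_of_eq ?_) (hg i hi x hx).le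
          rw [dist_eq_norm, norm_sub_rev, ← h3]
          rfl
        rw [hB, mul_assoc, mul_assoc]
        gcongr
        · exact (hR x hx).trans (le_abs_self R)
        · refine h1.trans ?_
          gcongr
          refine (Finset.sum_le_sum h2).trans (le_of_eq ?_)
          simp [hB]
      · have h0 : iteratedFDeriv ℝ n.2 u x = 0 := Function.notMem_support.1 fun h' =>
          hx (tsupport_pullFactor_mul_subset _ (support_iteratedFDeriv_subset n.2 h'))
        rw [h0, norm_zero, mul_zero]
        positivity
    · rw [mul_div_assoc', div_lt_iff₀ (by positivity)]
      nlinarith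

theorem pull_apply (h : IsChartCutoff e η) (g : SmoothFunction Γ) (x : Eu d) :
    h.pull g x = (η x : ℂ) * (e.density x : ℂ) * g (e.π x) := rfl

end IsChartCutoff

end LocalOperators

end RefinedBesov

namespace RefinedBesov

/-! ### Interpolation of Besov spaces over `ℝ^d` -/

theorem one_lt_of_one_div_eq {p₀ p₁ p θ : ℝ} (hp₀ : 1 < p₀) (hp₁ : 1 < p₁) (hθ₀ : 0 < θ)
    (hθ₁ : θ < 1) (hp : 1 / p = (1 - θ) / p₀ + θ / p₁) : 1 < p := by
  have h₀ : (1 - θ) / p₀ < 1 - θ := div_lt_self (by linarith) hp₀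
  have h₁ : θ / p₁ < θ := div_lt_self hθ₀ hp₁
  have h₀' : 0 < (1 - θ) / p₀ := div_pos (by linarith) (by linarith)
  have h₁' : 0 < θ / p₁ := div_pos hθ₀ (by linarith)
  -- Only `1 / p` is prescribed; its positivity yields that of `p`.
  have hp0 : 0 < p := one_div_pos.1 (by linarith)
  exact (div_lt_one hp0).1 (by linarith)

theorem isUpsilon_and_equivENorm_besovENorm {d : ℕ} {β₀ : Eu d → ℂ} (hβ : IsCutoff β₀)
    {s₀ s₁ s p₀ p₁ p θ : ℝ} {φ₀ φ₁ φ : ℝ → ℝ} (hφ₀ : IsUpsilon φ₀) (hφ₁ : IsUpsilon φ₁)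
    (hp₀ : 1 < p₀) (hp₁ : 1 < p₁) (hθ₀ : 0 < θ) (hθ₁ : θ < 1)
    (hs : s = (1 - θ) * s₀ + θ * s₁) (hp : 1 / p = (1 - θ) / p₀ + θ / p₁)
    (hφ : ∀ t : ℝ, 1 ≤ t → φ t = φ₀ t ^ (1 - θ) * φ₁ t ^ θ) :
    IsUpsilon φ ∧
      EquivENorm (interpENorm (besovENorm β₀ s₀ φ₀ p₀) (besovENorm β₀ s₁ φ₁ p₁) θ)
        (besovENorm β₀ s φ p) := by
  have hpq₀ := Real.HolderConjugate.conjExponent hp₀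
  have hpq₁ := Real.HolderConjugate.conjExponent hp₁
  have hpq := Real.HolderConjugate.conjExponent (one_lt_of_one_div_eq hp₀ hp₁ hθ₀ hθ₁ hp)
  have hφU : IsUpsilon φ := IsUpsilon.geomMean hφ₀ hφ₁ hφ
  obtain ⟨C, hC0, hC⟩ := exists_interpENorm_le hβ hpq₀ hpq₁ hpq hφ₀ hφ₁ hφU hθ₀ hθ₁ hs hp hφ
  refine ⟨hφU, C + 1, by positivity, fun w => ⟨(hC w).trans ?_, ?_⟩⟩
  · gcongr
    exact le_add_right le_rfl
  · refine (besovENorm_le_interpENorm hpq₀ hpq₁ hpq hφ₀ hφ₁ hφU hθ₀ hθ₁ hs hp hφ w).trans ?_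
    exact le_mul_of_one_le_left zero_le (by simp)

/-! ### Interpolation of Besov spaces over the hypersurface -/

section Boundary

variable {d : ℕ} {Γ : Set (Eu (d + 1))}

/-- The extension by zero onto `ℝ^d` of the image of the distribution `χ v` in a chart. -/
noncomputable def localImage (e : SmoothChart Γ) (χ : SmoothFunction Γ)
    (hχ : tsupport (χ : Γ → ℂ) ⊆ e.π.target) : BdryDistribution Γ →ₗ[ℂ] 𝓢'(Eu d, ℂ) where
  toFun v := v.comp (push e χ hχ)
  map_add' _ _ := rfl
  map_smul' _ _ := rfl

theorem localImage_apply (e : SmoothChart Γ) (χ : SmoothFunction Γ)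
    (hχ : tsupport (χ : Γ → ℂ) ⊆ e.π.target) (v : BdryDistribution Γ) (f : 𝓢(Eu d, ℂ)) :
    localImage e χ hχ v f = v (push e χ hχ f) := rfl

/-- A smooth function on `Γ` is determined by its values, so there is exactly one admissible `w`,
and the infimum in the boundary norm has a single term. -/
theorem isLocalImage_iff (e : SmoothChart Γ) (χ : SmoothFunction Γ)
    (hχ : tsupport (χ : Γ → ℂ) ⊆ e.π.target) (v : BdryDistribution Γ) (w : 𝓢'(Eu d, ℂ)) :
    IsLocalImage e χ v w ↔ w = localImage e χ hχ v := by
  refine ⟨fun h => DFunLike.ext _ _ fun f => ?_, ?_⟩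
  · obtain ⟨g, hg, hw⟩ := h f
    rw [hw, localImage_apply]
    exact congrArg v (SmoothFunction.ext fun y => hg y)
  · rintro rfl f
    exact ⟨push e χ hχ f, fun y => push_apply e χ hχ f y, rfl⟩

theorem besovBdryENorm_eq (A : LocalData Γ) (β₀ : Eu d → ℂ) (s : ℝ) (φ : ℝ → ℝ) (p : ℝ)
    (v : BdryDistribution Γ) : besovBdryENorm A β₀ s φ p v =
      ∑ j, besovENorm β₀ s φ p (localImage (A.chart j) (A.χ j) (A.supp j) v) := by
  simp only [besovBdryENorm, isLocalImage_iff _ _ (A.supp _), iInf_iInf_eq_left]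

/-- The distribution on `Γ` obtained from a distribution in a chart. -/
noncomputable def IsChartCutoff.globalize {e : SmoothChart Γ} {η : Eu d → ℝ}
    (h : IsChartCutoff e η) : 𝓢'(Eu d, ℂ) →ₗ[ℂ] BdryDistribution Γ where
  toFun w := ContinuousLinearMap.comp (show 𝓢(Eu d, ℂ) →L[ℂ] ℂ from w) h.pull
  map_add' _ _ := rfl
  map_smul' _ _ := rfl

theorem IsChartCutoff.globalize_apply {e : SmoothChart Γ} {η : Eu d → ℝ} (h : IsChartCutoff e η)
    (w : 𝓢'(Eu d, ℂ)) (g : SmoothFunction Γ) : h.globalize w g = w (h.pull g) := rfl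

theorem exists_isChartCutoff [CompactSpace Γ] (e : SmoothChart Γ) (χ : SmoothFunction Γ)
    (hχ : tsupport (χ : Γ → ℂ) ⊆ e.π.target) : ∃ η : Eu d → ℝ, IsChartCutoff e η ∧
      ∀ y ∈ tsupport (χ : Γ → ℂ), η (e.π.symm y) = 1 := by
  have hK : IsCompact (e.π.symm '' tsupport (χ : Γ → ℂ)) :=
    (isClosed_tsupport _).isCompact.image_of_continuousOn (e.π.symm.continuousOn.mono hχ)
  obtain ⟨η, h1, h2, h3, h4⟩ := exists_contDiff_eq_one hK e.π.open_source
    ((image_mono hχ).trans e.π.symm.mapsTo.image_subset)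
  exact ⟨η, ⟨h1, h2, h3⟩, fun y hy => h4 _ (mem_image_of_mem _ hy)⟩

/-- The densities cancel and the chart cutoff equals `1` over the support of `χ`. Summed over the
partition of unity, this shows that the `globalize` operators recover `v` from its local images. -/
theorem push_pull_apply {e : SmoothChart Γ} {χ : SmoothFunction Γ}
    (hχ : tsupport (χ : Γ → ℂ) ⊆ e.π.target) {η : Eu d → ℝ} (h : IsChartCutoff e η)
    (hη : ∀ y ∈ tsupport (χ : Γ → ℂ), η (e.π.symm y) = 1) (g : SmoothFunction Γ) (y : Γ) :
    push e χ hχ (h.pull g) y = χ y * g y := by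
  rw [push_apply, IsChartCutoff.pull_apply]
  by_cases hy : y ∈ tsupport (χ : Γ → ℂ)
  · have hJ : (e.density (e.π.symm y) : ℂ) ≠ 0 := by
      exact_mod_cast (e.density_pos (e.π.map_target (hχ hy))).ne'
    rw [hη y hy, e.π.right_inv (hχ hy)]
    field_simp
    simp
  · rw [image_eq_zero_of_notMem_tsupport hy, zero_mul, zero_mul]

theorem isCutDiffeo_transition {e e' : SmoothChart Γ} {χ : SmoothFunction Γ}
    (hχ : tsupport (χ : Γ → ℂ) ⊆ e.π.target) {η : Eu d → ℝ} (h : IsChartCutoff e' η) :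
    IsCutDiffeo (e'.transition e) fun x => pullFactor e' η x * pushFactor e e' χ x := by
  have hK := e'.isCompact_inter_preimage h.compact.isCompact h.supp
    (isClosed_tsupport (χ : Γ → ℂ))
  have hsub : tsupport (fun x => pullFactor e' η x * pushFactor e e' χ x) ⊆
      tsupport η ∩ e'.π ⁻¹' tsupport (χ : Γ → ℂ) := by
    refine closure_minimal (fun x hx => ⟨subset_tsupport _ fun h0 => hx ?_,
      subset_tsupport _ fun h0 => hx ?_⟩) hK.isClosed
    · simp [pullFactor, h0]
    · simp [pushFactor, h0]
  have hsource : tsupport (fun x => pullFactor e' η x * pushFactor e e' χ x) ⊆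
      (e'.transition e).source := fun x hx =>
    SmoothChart.mem_transition_source.2 ⟨h.supp (hsub hx).1, hχ (hsub hx).2⟩
  exact
    { smooth := e'.contDiffOn_transition e
      smooth_symm := e'.contDiffOn_transition_symm e
      smooth_cut := contDiff_of_tsupport (e'.transition e).open_source
        ((h.contDiffOn_pullFactor.mono fun x hx => (SmoothChart.mem_transition_source.1 hx).1).mul
          (contDiffOn_pushFactor e e' χ)) hsource
      compact := hK.of_isClosed_subset (isClosed_tsupport _) hsub
      supp := hsource }

/-- Carrying a distribution from one chart to `Γ` and reading it in another is the transpose of a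
cut off change of variables, so it falls under the boundedness theorem for Besov spaces. -/
theorem localImage_globalize {e e' : SmoothChart Γ} {χ : SmoothFunction Γ}
    (hχ : tsupport (χ : Γ → ℂ) ⊆ e.π.target) {η : Eu d → ℝ} (h : IsChartCutoff e' η)
    (w : 𝓢'(Eu d, ℂ)) : localImage e χ hχ (h.globalize w) =
      PointwiseConvergenceCLM.precomp ℂ (isCutDiffeo_transition hχ h).cutComp w := by
  refine DFunLike.ext _ _ fun f => ?_
  change w (h.pull (push e χ hχ f)) = w ((isCutDiffeo_transition hχ h).cutComp f)
  congr 1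
  ext x
  change pullFactor e' η x * pushFun e χ f (e'.π x) =
    pullFactor e' η x * pushFactor e e' χ x * f (e'.transition e x)
  rw [pushFun_apply_chart, mul_assoc]

theorem exists_besovENorm_localImage_globalize_le (A : LocalData Γ) {η : Fin A.num → Eu d → ℝ}
    (h : ∀ j, IsChartCutoff (A.chart j) (η j)) {β₀ : Eu d → ℂ} (hβ : IsCutoff β₀) {p q : ℝ}
    (hpq : p.HolderConjugate q) (s : ℝ) {φ : ℝ → ℝ} (hφ : IsUpsilon φ) :
    ∃ C : ℝ≥0, ∀ i j w, besovENorm β₀ s φ p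
      (localImage (A.chart i) (A.χ i) (A.supp i) ((h j).globalize w)) ≤
        C * besovENorm β₀ s φ p w := by
  choose C hC using fun i j => (isCutDiffeo_transition (A.supp i) (h j)).exists_besovENorm_precomp_le
    hβ hpq s hφ
  refine ⟨∑ i, ∑ j, C i j, fun i j w => ?_⟩
  rw [localImage_globalize]
  refine (hC i j w).trans ?_
  gcongr
  exact (Finset.single_le_sum (f := C i) (fun _ _ => zero_le) (Finset.mem_univ j)).trans
    (Finset.single_le_sum (f := fun i => ∑ j, C i j) (fun _ _ => zero_le) (Finset.mem_univ i))

theorem EquivENorm.besovBdryENorm [CompactSpace Γ] (A : LocalData Γ) {β₀ : Eu d → ℂ}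
    (hβ : IsCutoff β₀) {s₀ s₁ s p₀ p₁ p q₀ q₁ θ : ℝ} {φ₀ φ₁ φ : ℝ → ℝ}
    (hpq₀ : p₀.HolderConjugate q₀) (hpq₁ : p₁.HolderConjugate q₁) (hφ₀ : IsUpsilon φ₀)
    (hφ₁ : IsUpsilon φ₁)
    (h : EquivENorm (interpENorm (besovENorm β₀ s₀ φ₀ p₀) (besovENorm β₀ s₁ φ₁ p₁) θ)
      (besovENorm β₀ s φ p)) :
    EquivENorm (interpENorm (besovBdryENorm A β₀ s₀ φ₀ p₀) (besovBdryENorm A β₀ s₁ φ₁ p₁) θ)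
      (besovBdryENorm A β₀ s φ p) := by
  choose η hη hη1 using fun j => exists_isChartCutoff (A.chart j) (A.χ j) (A.supp j)
  obtain ⟨C₀, hC₀⟩ := exists_besovENorm_localImage_globalize_le A hη hβ hpq₀ s₀ hφ₀
  obtain ⟨C₁, hC₁⟩ := exists_besovENorm_localImage_globalize_le A hη hβ hpq₁ s₁ hφ₁
  -- The local images serve as coretractions and the `globalize` operators as retractions; the
  -- boundary norm is by definition the sum of the norms of the local images.
  refine EquivENorm.of_retract (fun j => localImage (A.chart j) (A.χ j) (A.supp j))
    (fun j => (hη j).globalize) (fun v => ?_) (besovBdryENorm_eq A β₀ s₀ φ₀ p₀)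
    (besovBdryENorm_eq A β₀ s₁ φ₁ p₁) (besovBdryENorm_eq A β₀ s φ p)
    (besovENorm_isSubadditive hpq₀ β₀ s₀ φ₀) (besovENorm_isSubadditive hpq₁ β₀ s₁ φ₁)
    (C := 1 + (C₀ + C₁)) (by positivity) (fun i j w => (hC₀ i j w).trans ?_)
    (fun i j w => (hC₁ i j w).trans ?_) h
  · ext g
    have h1 : ∑ j, push (A.chart j) (A.χ j) (A.supp j) ((hη j).pull g) = g := by
      refine SmoothFunction.ext fun y => ?_
      have h2 : (∑ j, push (A.chart j) (A.χ j) (A.supp j) ((hη j).pull g)).1 y =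
          ∑ j, push (A.chart j) (A.χ j) (A.supp j) ((hη j).pull g) y := by
        let ev : SmoothFunction Γ →ₗ[ℂ] ℂ :=
          { toFun := fun g => g y
            map_add' := fun _ _ => rfl
            map_smul' := fun _ _ => rfl }
        exact map_sum ev _ _
      rw [h2]
      simp only [push_pull_apply (A.supp _) (hη _) (hη1 _)]
      rw [← Finset.sum_mul, A.sum_eq_one, one_mul]
    calc (∑ j, (hη j).globalize (localImage (A.chart j) (A.χ j) (A.supp j) v)) g
        = ∑ j, v (push (A.chart j) (A.χ j) (A.supp j) ((hη j).pull g)) := by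
          simp [sum_apply, IsChartCutoff.globalize_apply, localImage_apply]
      _ = v g := by rw [← map_sum, h1]
  · gcongr
    exact le_add_left (le_add_right le_rfl)
  · gcongr
    exact le_add_left (le_add_left le_rfl)

end Boundary

end RefinedBesov


/-! ### The theorem over `ℝ^d` and over `Γ` -/

theorem mainTheorem9 (d : ℕ) (hd : 1 ≤ d)
    (s₀ s₁ s p₀ p₁ p θ : ℝ) (φ₀ φ₁ φ : ℝ → ℝ)
    (hφ₀ : RefinedBesov.IsUpsilon φ₀) (hφ₁ : RefinedBesov.IsUpsilon φ₁)
    (hp₀ : 1 < p₀) (hp₁ : 1 < p₁) (hθ₀ : 0 < θ) (hθ₁ : θ < 1)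
    (hs : s = (1 - θ) * s₀ + θ * s₁)
    (hp : 1 / p = (1 - θ) / p₀ + θ / p₁)
    (hφ : ∀ t : ℝ, 1 ≤ t → φ t = φ₀ t ^ (1 - θ) * φ₁ t ^ θ)
    (β₀ : RefinedBesov.Eu d → ℂ) (hβ₀ : RefinedBesov.IsCutoff β₀) :
    RefinedBesov.IsUpsilon φ ∧
    RefinedBesov.EquivENorm
      (RefinedBesov.interpENorm (RefinedBesov.besovENorm β₀ s₀ φ₀ p₀)
        (RefinedBesov.besovENorm β₀ s₁ φ₁ p₁) θ)
      (RefinedBesov.besovENorm β₀ s φ p) ∧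
    ∀ Ω : Set (RefinedBesov.Eu (d + 1)), RefinedBesov.IsSmoothBoundedDomain Ω →
      ∀ A : RefinedBesov.LocalData (frontier Ω),
        RefinedBesov.EquivENorm
          (RefinedBesov.interpENorm (RefinedBesov.besovBdryENorm A β₀ s₀ φ₀ p₀)
            (RefinedBesov.besovBdryENorm A β₀ s₁ φ₁ p₁) θ)
          (RefinedBesov.besovBdryENorm A β₀ s φ p) := by
  obtain ⟨hφU, hE⟩ := RefinedBesov.isUpsilon_and_equivENorm_besovENorm hβ₀ hφ₀ hφ₁ hp₀ hp₁ hθ₀ hθ₁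
    hs hp hφ
  refine ⟨hφU, hE, fun Ω hΩ A => ?_⟩
  -- Compactness of `Γ` is what makes the supports of the `χ_j` compact and so provides the chart
  -- cutoffs.
  have : CompactSpace (frontier Ω) := isCompact_iff_compactSpace.1
    (hΩ.isBounded.isCompact_closure.of_isClosed_subset isClosed_frontier frontier_subset_closure)
  exact RefinedBesov.EquivENorm.besovBdryENorm A hβ₀ (Real.HolderConjugate.conjExponent hp₀)
    (Real.HolderConjugate.conjExponent hp₁) hφ₀ hφ₁ hE
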